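/- **Theorem (Kac–Gilbert).** Let $V:\mathbb R\to\mathbb R$ be locally integrable. Call $V$ limit circle at $+\infty$ (resp. $-\infty$) if for all $z\in\mathbb C$ all solutions $u$ of $-u''+Vu=zu$ on $\mathbb R$ are square integrable on $(0,\infty)$ (resp. $(-\infty,0)$), and limit point there otherwise. (By Weyl's alternative, "all $z$" may equivalently be replaced by "some $z$".) Suppose that $V$ is limit point at both $+\infty$ and $-\infty$. Then the operator $H=-\frac{d^2}{dx^2}+V$ on $L^2(\mathbb R;\mathbb C)$ with domain $$D(H)=\{u\in L^2(\mathbb R): u,u' \text{ locally absolutely continuous},\ -u''+Vu\in L^2(\mathbb R)\}$$ is self-adjoint, and its singular spectrum is simple. The latter means: let $\mathcal H_{\rm s}$ be the set of all $\psi\in L^2(\mathbb R)$ whose spectral measure $\mu_\psi$, i.e. the finite Borel measure on $\mathbb R$ with $$\langle\psi,(H-z)^{-1}\psi\rangle=\int_{\mathbb R}\frac{d\mu_\psi(t)}{t-z}\qquad(z\in\mathbb C\setminus\mathbb R),$$ is singular with respect to Lebesgue measure; then there is $\psi\in\mathcal H_{\rm s}$ such that the closed linear span of $\{(H-z)^{-1}\psi: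 z\in\mathbb C\setminus\mathbb R\}$ equals $\mathcal H_{\rm s}$. -/

import Mathlib

noncomputable section

namespace KacGilbert

open MeasureTheory Set

/-! ### The differential expression `-d²/dx² + V` on the line -/

/-- `-u'' + V u = f` on `ℝ`, in the Carathéodory sense: `u` is differentiable everywhere, and
its derivative `v` is locally absolutely continuous with `v' = V u - f` almost everywhere, that is,
`v` is an indefinite integral of the locally integrable function `V u - f`. -/
def SolvesSchrodinger (V : ℝ → ℝ) (u f : ℝ → ℂ) : Prop :=
  LocallyIntegrable (fun x => (V x : ℂ) * u x - f x) volume ∧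
    ∃ v : ℝ → ℂ, (∀ x, HasDerivAt u (v x) x) ∧
      ∀ a b : ℝ, v b - v a = ∫ x in a..b, ((V x : ℂ) * u x - f x)

/-- The limit circle case at `+∞`: for all `z`, all solutions of `-u'' + V u = z u` are square
integrable near `+∞`. -/
def LimitCircleAtTop (V : ℝ → ℝ) : Prop :=
  ∀ (z : ℂ) (u : ℝ → ℂ), SolvesSchrodinger V u (fun x => z * u x) →
    MemLp u 2 (volume.restrict (Ioi 0))

/-- The limit circle case at `-∞`. -/
def LimitCircleAtBot (V : ℝ → ℝ) : Prop :=
  ∀ (z : ℂ) (u : ℝ → ℂ), SolvesSchrodinger V u (fun x => z * u x) →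
    MemLp u 2 (volume.restrict (Iio 0))

/-- `V` is limit point at `+∞` if it is not limit circle there. -/
def LimitPointAtTop (V : ℝ → ℝ) : Prop := ¬ LimitCircleAtTop V

/-- `V` is limit point at `-∞` if it is not limit circle there. -/
def LimitPointAtBot (V : ℝ → ℝ) : Prop := ¬ LimitCircleAtBot V

/-! ### The whole-line operator on `L²(ℝ)` -/

/-- The complex Hilbert space `L²(ℝ, dx)`. -/
abbrev L2R : Type := Lp ℂ 2 (volume : Measure ℝ)

theorem SolvesSchrodinger.add {V : ℝ → ℝ} {u f u' f' : ℝ → ℂ}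
    (h : SolvesSchrodinger V u f) (h' : SolvesSchrodinger V u' f') :
    SolvesSchrodinger V (u + u') (f + f') := by
  obtain ⟨hi, v, hv, hvi⟩ := h
  obtain ⟨hi', v', hv', hvi'⟩ := h'
  have e : (fun x => (V x : ℂ) * (u + u') x - (f + f') x) =
      fun x => ((V x : ℂ) * u x - f x) + ((V x : ℂ) * u' x - f' x) := by
    funext x; simp only [Pi.add_apply]; ring
  refine ⟨by rw [e]; exact hi.add hi', v + v', fun x => (hv x).add (hv' x), fun a b => ?_⟩
  rw [e, intervalIntegral.integral_add
      (hi.integrableOn_isCompact isCompact_uIcc).intervalIntegrable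
      (hi'.integrableOn_isCompact isCompact_uIcc).intervalIntegrable,
    ← hvi a b, ← hvi' a b]
  simp only [Pi.add_apply]; ring

theorem SolvesSchrodinger.smul {V : ℝ → ℝ} {u f : ℝ → ℂ} (c : ℂ)
    (h : SolvesSchrodinger V u f) : SolvesSchrodinger V (c • u) (c • f) := by
  obtain ⟨hi, v, hv, hvi⟩ := h
  have e : (fun x => (V x : ℂ) * (c • u) x - (c • f) x) =
      fun x => c • ((V x : ℂ) * u x - f x) := by
    funext x; simp only [Pi.smul_apply, smul_eq_mul]; ring
  refine ⟨by rw [e]; exact hi.smul c, c • v, fun x => (hv x).const_smul c, fun a b => ?_⟩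
  rw [e, intervalIntegral.integral_smul, ← hvi a b]
  simp only [Pi.smul_apply, smul_eq_mul]; ring

theorem SolvesSchrodinger.congr_right {V : ℝ → ℝ} {u f f' : ℝ → ℂ}
    (h : SolvesSchrodinger V u f) (hf : f =ᵐ[volume] f') : SolvesSchrodinger V u f' := by
  obtain ⟨hi, v, hv, hvi⟩ := h
  have e : (fun x => (V x : ℂ) * u x - f x) =ᵐ[volume] fun x => (V x : ℂ) * u x - f' x := by
    filter_upwards [hf] with x hx
    rw [hx]
  refine ⟨hi.congr e, v, hv, fun a b => ?_⟩
  rw [hvi a b]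
  exact intervalIntegral.integral_congr_ae (e.mono fun x hx _ => hx)

/-- The graph of the maximal operator of `-d²/dx² + V` in `L²(ℝ)`: the pairs `(ψ, η)` such that
`ψ` has a representative `u` with `u`, `u'` locally absolutely continuous and `-u'' + V u = η`. -/
def schrodingerGraph (V : ℝ → ℝ) : Submodule ℂ (L2R × L2R) where
  carrier := {p | ∃ u : ℝ → ℂ, p.1 =ᵐ[volume] u ∧ SolvesSchrodinger V u p.2}
  zero_mem' := by
    refine ⟨0, Lp.coeFn_zero ℂ 2 volume, ?_⟩
    refine SolvesSchrodinger.congr_right (f := 0) ?_ (Lp.coeFn_zero ℂ 2 volume).symm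
    refine ⟨?_, 0, fun x => hasDerivAt_const x 0, fun a b => ?_⟩
    · simpa using (locallyIntegrable_const (0 : ℂ))
    · simp
  add_mem' := by
    rintro p q ⟨u, hu, h⟩ ⟨w, hw, h'⟩
    exact ⟨u + w, (Lp.coeFn_add p.1 q.1).trans (hu.add hw),
      (h.add h').congr_right (Lp.coeFn_add p.2 q.2).symm⟩
  smul_mem' := by
    rintro c p ⟨u, hu, h⟩
    exact ⟨c • u, (Lp.coeFn_smul c p.1).trans (hu.const_smul c),
      (h.smul c).congr_right (Lp.coeFn_smul c p.2).symm⟩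

theorem mem_schrodingerGraph {V : ℝ → ℝ} {p : L2R × L2R} :
    p ∈ schrodingerGraph V ↔ ∃ u : ℝ → ℂ, p.1 =ᵐ[volume] u ∧ SolvesSchrodinger V u p.2 :=
  Iff.rfl

theorem schrodingerGraph_functional (V : ℝ → ℝ) (p : L2R × L2R)
    (hp : p ∈ schrodingerGraph V) (h0 : p.1 = 0) : p.2 = 0 := by
  obtain ⟨u, hu, hi, v, hv, hvi⟩ := hp
  have huc : Continuous u := continuous_iff_continuousAt.2 fun x => (hv x).continuousAt
  have hu0 : u = 0 := by
    refine (huc.ae_eq_iff_eq volume continuous_zero).1 ?_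
    refine hu.symm.trans ?_
    rw [h0]
    exact Lp.coeFn_zero ℂ 2 volume
  subst hu0
  have hv0 : ∀ x, v x = 0 := fun x => (hv x).unique (hasDerivAt_const x 0)
  have hz : ∀ a b : ℝ, ∫ x in a..b, ((V x : ℂ) * (0 : ℝ → ℂ) x - p.2 x) = 0 := fun a b => by
    rw [← hvi a b, hv0, hv0, sub_zero]
  have hae := LocallyIntegrable.ae_hasDerivAt_integral hi
  rw [Lp.eq_zero_iff_ae_eq_zero]
  filter_upwards [hae] with x hx
  have h1 := hx 0
  simp only [hz] at h1
  have h2 := h1.unique (hasDerivAt_const x 0)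
  simpa using h2

/-- The whole-line Schrödinger operator `-d²/dx² + V` in `L²(ℝ)`, on the maximal domain of all
`u ∈ L²` with `u`, `u'` locally absolutely continuous and `-u'' + V u ∈ L²`. -/
def schrodingerOperator (V : ℝ → ℝ) : L2R →ₗ.[ℂ] L2R :=
  (schrodingerGraph V).toLinearPMap

theorem schrodingerOperator_graph (V : ℝ → ℝ) :
    (schrodingerOperator V).graph = schrodingerGraph V :=
  Submodule.toLinearPMap_graph_eq _ (schrodingerGraph_functional V)

/-! ### Simple singular spectrum of a self-adjoint operator -/

section Spectral

variable {E : Type*} [NormedAddCommGroup E] [InnerProductSpace ℂ E]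

/-- `φ = (A - z)⁻¹ ψ`, as a relation. -/
def IsResolventOf (A : E →ₗ.[ℂ] E) (z : ℂ) (ψ φ : E) : Prop :=
  ∃ h : φ ∈ A.domain, A ⟨φ, h⟩ - z • φ = ψ

/-- `μ` is the spectral measure of the vector `ψ` for the self-adjoint operator `A`: the finite
Borel measure on `ℝ` with `⟪ψ, (A - z)⁻¹ ψ⟫ = ∫ (t - z)⁻¹ dμ(t)` for all nonreal `z`. (For
self-adjoint `A` it exists and is unique; it is `⟪ψ, P(·) ψ⟫` with `P` the projection-valued
measure of `A`.) -/
def IsSpectralMeasure (A : E →ₗ.[ℂ] E) (ψ : E) (μ : Measure ℝ) : Prop :=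
  IsFiniteMeasure μ ∧ ∀ (z : ℂ) (φ : E), z.im ≠ 0 → IsResolventOf A z ψ φ →
    inner ℂ ψ φ = ∫ t : ℝ, ((t : ℂ) - z)⁻¹ ∂μ

/-- The singular subspace of a self-adjoint operator `A`: the vectors whose spectral measure is
singular with respect to Lebesgue measure. -/
def singularSubspace (A : E →ₗ.[ℂ] E) : Set E :=
  {ψ | ∃ μ : Measure ℝ, IsSpectralMeasure A ψ μ ∧ μ ⟂ₘ (volume : Measure ℝ)}

/-- The cyclic subspace generated by `ψ` and `A`: the closed linear span of the vectors
`(A - z)⁻¹ ψ`, `z` nonreal. -/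
def cyclicSubspace (A : E →ₗ.[ℂ] E) (ψ : E) : Submodule ℂ E :=
  (Submodule.span ℂ {φ | ∃ z : ℂ, z.im ≠ 0 ∧ IsResolventOf A z ψ φ}).topologicalClosure

/-- The self-adjoint operator `A` has simple singular spectrum: its restriction to the singular
subspace has a cyclic vector. -/
def HasSimpleSingularSpectrum (A : E →ₗ.[ℂ] E) : Prop :=
  ∃ ψ ∈ singularSubspace A, (cyclicSubspace A ψ : Set E) = singularSubspace A

end Spectral

end KacGilbert

end

noncomputable section

namespace KacGilbert

open MeasureTheory Set Filter Topology ComplexConjugate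

-- Absolutely continuous functions and indefinite integrals

section AbsolutelyContinuous

-- For nonreal w the equation -u'' + Vu = wu has Weyl solutions ψ±, square integrable at ±∞, with
-- ψ±(0) = 1 and ψ±'(0) = ±m±. In the limit point case they give a unique L² solution u of the
-- resolvent equation for each source f. Let A, B be the complex conjugates of ψ+, ψ- cut off to the
-- right and left half-line. Lagrange's identity gives ⟨A, f⟩ = u'(0) - m₊u(0) and ⟨B, f⟩ = -u'(0) -
-- m₋u(0), and the sign of Im(ū u') gives |Im w|‖u‖ ≤ ‖f‖ and ‖A‖² ≤ Im m₊ / Im w, ‖B‖² ≤ Im m₋ / Im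
-- w (`nonempty_weylData`). Solvability and the resolvent bound at all nonreal w imply
-- self-adjointness (`isSelfAdjoint_of_resolvent`).
--
-- Let γ₁, γ₂ represent f ↦ u(0) and f ↦ u'(0) at w = i. Their cyclic subspaces span everything: on
-- a cyclic subspace orthogonal to both, (H - i)⁻¹g always has zero Cauchy data at 0, and continuous
-- dependence on the source at each real energy forces the relevant spectral distribution functions
-- to be constant (`inner_eq_zero_of_boundary_zero`). So H is multiplication by t on L²(μ₁) ⊕
-- L²(μ₂), where μ₁ is the spectral measure of γ₁ and μ₂ that of the component of γ₂ orthogonal to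
-- the cyclic subspace of γ₁.
--
-- It remains to see that the singular parts of μ₁ and μ₂ are mutually singular. At w = x + iε let G
-- and σ be the images of γ₁ and of that component under (H + i)(H - w̄)⁻¹. Then A + B = -conj(m₊ +
-- m₋) G, while A - σ and B + σ lie in the cyclic subspace of γ₁. Since A ⊥ B,
-- `norm_sq_mul_norm_sq_le` gives |m₊ + m₋|²‖G‖²‖σ‖² ≤ ‖A‖²‖B‖² ≤ Im m₊ Im m₋ / ε². The Weyl
-- coefficients cancel because 4 Im m₊ Im m₋ ≤ |m₊ + m₋|², leaving ‖G‖²‖σ‖² ≤ 1/(4ε²). As 2ε²‖G‖²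
-- and 2ε²‖σ‖² dominate the masses of the interval of radius ε about x
-- (`Intertwines.measure_closedBall_le`), the product of these masses is at most ε². Differentiation
-- of measures then separates the singular parts (`exists_disjoint_null_sets`), and the sum of the
-- two indicator functions of their supports is a cyclic vector
-- (`hasSimpleSingularSpectrum_of_pair`).

theorem _root_.MeasureTheory.LocallyIntegrable.norm' {F : Type*} [NormedAddCommGroup F] {f : ℝ → F}
    (hf : LocallyIntegrable f volume) : LocallyIntegrable (fun x => ‖f x‖) volume :=
  fun x => let ⟨s, hs, h⟩ := hf x; ⟨s, hs, h.norm⟩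

theorem _root_.MeasureTheory.LocallyIntegrable.intervalIntegrable' {F : Type*}
    [NormedAddCommGroup F] {f : ℝ → F}
    (hf : LocallyIntegrable f volume) (a b : ℝ) : IntervalIntegrable f volume a b :=
  (hf.integrableOn_isCompact isCompact_uIcc).intervalIntegrable

theorem _root_.MeasureTheory.LocallyIntegrable.continuous_smul' {c : ℝ → ℂ} {f : ℝ → ℂ}
    (hf : LocallyIntegrable f volume) (hc : Continuous c) :
    LocallyIntegrable (fun x => c x * f x) volume := by
  rw [← locallyIntegrableOn_univ] at *
  exact hf.continuousOn_mul hc.continuousOn isOpen_univ.isLocallyClosed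

variable {F : Type*} [NormedAddCommGroup F] [NormedSpace ℝ F]

/-- Increments of the vector-valued primitive are dominated by those of the scalar primitive of ‖f‖;
the base point drops out of increments. -/
theorem _root_.MeasureTheory.LocallyIntegrable.absolutelyContinuousOnInterval_integral {f : ℝ → F}
    (hf : LocallyIntegrable f volume) (c a b : ℝ) :
    AbsolutelyContinuousOnInterval (fun x => ∫ t in c..x, f t) a b := by
  have h := (hf.norm'.intervalIntegrable' a b).absolutelyContinuousOnInterval_intervalIntegral
    (c := a) left_mem_uIcc
  unfold AbsolutelyContinuousOnInterval at h ⊢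
  refine squeeze_zero (fun _ => Finset.sum_nonneg fun _ _ => dist_nonneg) (fun E => ?_) h
  refine Finset.sum_le_sum fun i _ => ?_
  rw [dist_eq_norm, dist_eq_norm, intervalIntegral.integral_interval_sub_left
    (hf.intervalIntegrable' _ _) (hf.intervalIntegrable' _ _),
    intervalIntegral.integral_interval_sub_left
    (hf.norm'.intervalIntegrable' _ _) (hf.norm'.intervalIntegrable' _ _), Real.norm_eq_abs]
  exact intervalIntegral.norm_integral_le_abs_integral_norm

/-- Subtracting the primitive of `g` leaves an absolutely continuous function with derivative zero
almost everywhere, hence a constant. -/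
theorem _root_.AbsolutelyContinuousOnInterval.integral_eq_sub_of_ae_hasDerivAt [CompleteSpace F]
    {f g : ℝ → F} {a b : ℝ} (hf : AbsolutelyContinuousOnInterval f a b)
    (hg : LocallyIntegrable g volume) (h : ∀ᵐ x, HasDerivAt f (g x) x) :
    ∫ x in a..b, g x = f b - f a := by
  have hac := hf.sub (hg.absolutelyContinuousOnInterval_integral a a b)
  obtain ⟨C, hC⟩ := hac.const_of_ae_hasDerivAt_zero (by
    filter_upwards [h, LocallyIntegrable.ae_hasDerivAt_integral hg] with x hx hx' _
    simpa using hx.sub (hx' a))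
  have h1 := hC a left_mem_uIcc
  have h2 := hC b right_mem_uIcc
  simp only [Pi.sub_apply, intervalIntegral.integral_same, sub_zero] at h1 h2
  rw [h1, ← h2]; abel

/-- Integration by parts for indefinite integrals. -/
theorem integral_deriv_mul_eq_sub_of_indefinite {u u' w w' : ℝ → ℂ}
    (hu' : LocallyIntegrable u' volume) (hw' : LocallyIntegrable w' volume)
    (hu : ∀ a b, u b - u a = ∫ x in a..b, u' x) (hw : ∀ a b, w b - w a = ∫ x in a..b, w' x)
    (a b : ℝ) : ∫ x in a..b, (u' x * w x + u x * w' x) = u b * w b - u a * w a := by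
  have eu : u = fun x => u a + ∫ t in a..x, u' t := by funext x; rw [← hu]; ring
  have ew : w = fun x => w a + ∫ t in a..x, w' t := by funext x; rw [← hw]; ring
  have cst (c : ℂ) : AbsolutelyContinuousOnInterval (fun _ : ℝ => c) a b :=
    (LipschitzWith.const c).lipschitzOnWith.absolutelyContinuousOnInterval
  have acu : AbsolutelyContinuousOnInterval u a b := by
    rw [eu]; exact (cst _).add (hu'.absolutelyContinuousOnInterval_integral a a b)
  have acw : AbsolutelyContinuousOnInterval w a b := by
    rw [ew]; exact (cst _).add (hw'.absolutelyContinuousOnInterval_integral a a b)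
  have cu : Continuous u := by
    rw [eu]; exact continuous_const.add
      (intervalIntegral.continuous_primitive (fun a b => hu'.intervalIntegrable' a b) a)
  have cw : Continuous w := by
    rw [ew]; exact continuous_const.add
      (intervalIntegral.continuous_primitive (fun a b => hw'.intervalIntegrable' a b) a)
  refine (acu.fun_smul acw).integral_eq_sub_of_ae_hasDerivAt ?_ ?_
  · refine LocallyIntegrable.add ?_ (hw'.continuous_smul' cu)
    simpa only [mul_comm] using hu'.continuous_smul' cw
  · filter_upwards [LocallyIntegrable.ae_hasDerivAt_integral hu', LocallyIntegrable.ae_hasDerivAt_integral hw'] with x hx hx'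
    have h1 : HasDerivAt u (u' x) x := by rw [eu]; exact (hx a).const_add _
    have h2 : HasDerivAt w (w' x) x := by rw [ew]; exact (hx' a).const_add _
    exact h1.mul h2

/-- The chain rule for the exponential of an indefinite integral. -/
theorem integral_mul_exp_integral {a : ℝ → ℝ} (ha : LocallyIntegrable a volume) {c : ℝ}
    (hc : c ≠ 0) (x y : ℝ) :
    ∫ t in x..y, a t * Real.exp (c * ∫ s in (0 : ℝ)..t, a s) =
      (Real.exp (c * ∫ s in (0 : ℝ)..y, a s) - Real.exp (c * ∫ s in (0 : ℝ)..x, a s)) / c := by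
  set α : ℝ → ℝ := fun t => ∫ s in (0 : ℝ)..t, a s with hα
  have hαc : Continuous α :=
    intervalIntegral.continuous_primitive (fun a b => ha.intervalIntegrable' a b) 0
  obtain ⟨B, hB⟩ := (isCompact_uIcc (a := x) (b := y)).exists_bound_of_continuousOn
    hαc.continuousOn
  -- The exponential is Lipschitz on the bounded range of α, so composing with it preserves absolute
  -- continuity.
  obtain ⟨K, hK⟩ := (((contDiff_const.mul contDiff_id).exp :
    ContDiff ℝ 1 fun s : ℝ => Real.exp (c * s)).contDiffOn (s := Icc (-B) B)).exists_lipschitzOnWith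
    (by decide) (convex_Icc _ _) isCompact_Icc
  have hac : AbsolutelyContinuousOnInterval (fun t => Real.exp (c * α t)) x y := by
    have h := ha.absolutelyContinuousOnInterval_integral 0 x y
    unfold AbsolutelyContinuousOnInterval at h ⊢
    have h2 := h.const_mul (K : ℝ)
    rw [mul_zero] at h2
    refine squeeze_zero' (Eventually.of_forall fun _ =>
      Finset.sum_nonneg fun _ _ => dist_nonneg) ?_ h2
    rw [eventually_inf_principal]
    filter_upwards with E hE
    rw [Finset.mul_sum]
    refine Finset.sum_le_sum fun i hi => ?_
    exact hK.dist_le_mul _ (abs_le.1 (hB _ (hE.1 i hi).1)) _ (abs_le.1 (hB _ (hE.1 i hi).2))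
  have key := (hac.fun_smul (LipschitzWith.const (1 / c)).lipschitzOnWith.absolutelyContinuousOnInterval)
    |>.integral_eq_sub_of_ae_hasDerivAt (g := fun t => a t * Real.exp (c * α t)) ?_ ?_
  · rw [key]; simp only [smul_eq_mul]; ring
  · rw [← locallyIntegrableOn_univ] at *
    exact ha.mul_continuousOn (by fun_prop) isOpen_univ.isLocallyClosed
  · filter_upwards [LocallyIntegrable.ae_hasDerivAt_integral ha] with t ht
    have h1 : HasDerivAt (fun t => Real.exp (c * α t) * (1 / c)) _ t :=
      (((ht 0).const_mul c).exp).mul_const (1 / c)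
    exact h1.congr_deriv (by field_simp; simp only [hα]; ring)

end AbsolutelyContinuous

-- Linear integral equations with locally integrable coefficients

section LinearODE

/-- Integrating `a` against the weight exp(2|∫a|) returns half the weight, up to a constant. This
factor 1/2 drives both the Gronwall bound and the Picard iteration. -/
theorem norm_integral_le_of_le_exp {F : Type*} [NormedAddCommGroup F] [NormedSpace ℝ F]
    {a : ℝ → ℝ} (ha : LocallyIntegrable a volume) (ha0 : ∀ t, 0 ≤ a t) {Z : ℝ → F} {M x : ℝ}
    (hZ : ∀ t ∈ uIcc 0 x, ‖Z t‖ ≤ a t * (M * Real.exp (2 * |∫ s in (0 : ℝ)..t, a s|))) :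
    ‖∫ t in (0 : ℝ)..x, Z t‖ ≤ M / 2 * (Real.exp (2 * |∫ s in (0 : ℝ)..x, a s|) - 1) := by
  have hint (c : ℝ) (x y : ℝ) : IntervalIntegrable
      (fun t => M * (a t * Real.exp (c * ∫ s in (0 : ℝ)..t, a s))) volume x y := by
    refine ((ha.intervalIntegrable' x y).mul_continuousOn (Continuous.continuousOn ?_)).const_mul M
    have := intervalIntegral.continuous_primitive (fun a b => ha.intervalIntegrable' a b) 0
    fun_prop
  rcases le_total 0 x with hx | hx
  · have h0 : 0 ≤ ∫ s in (0 : ℝ)..x, a s := intervalIntegral.integral_nonneg hx fun t _ => ha0 t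
    have h := intervalIntegral.norm_integral_le_of_norm_le (f := Z) hx
      (Eventually.of_forall fun t ht => ?_) (hint 2 0 x)
    · refine h.trans (le_of_eq ?_)
      rw [intervalIntegral.integral_const_mul, integral_mul_exp_integral ha two_ne_zero,
        abs_of_nonneg h0]
      simp; ring
    · have h1 : 0 ≤ ∫ s in (0 : ℝ)..t, a s :=
        intervalIntegral.integral_nonneg ht.1.le fun t _ => ha0 t
      have := hZ t (by rw [uIcc_of_le hx]; exact ⟨ht.1.le, ht.2⟩)
      rw [abs_of_nonneg h1] at this
      linarith
  · have h0 : 0 ≤ ∫ s in x..(0 : ℝ), a s := intervalIntegral.integral_nonneg hx fun t _ => ha0 t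
    have h := intervalIntegral.norm_integral_le_of_norm_le (f := Z) hx
      -- Left of 0 the primitive of `a` is nonpositive, so the weight exp(2|·|) becomes exp(-2·).
      (Eventually.of_forall fun t ht => ?_) (hint (-2) x 0)
    · rw [intervalIntegral.integral_symm, norm_neg]
      refine h.trans (le_of_eq ?_)
      rw [intervalIntegral.integral_const_mul, integral_mul_exp_integral ha (by norm_num),
        intervalIntegral.integral_symm x 0, abs_neg, abs_of_nonneg h0]
      simp; ring
    · have h1 : 0 ≤ ∫ s in t..(0 : ℝ), a s :=
        intervalIntegral.integral_nonneg ht.2 fun t _ => ha0 t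
      have := hZ t (by rw [uIcc_of_ge hx]; exact ⟨ht.1.le, ht.2⟩)
      rw [intervalIntegral.integral_symm, abs_neg, abs_of_nonneg h1] at this
      rw [intervalIntegral.integral_symm]
      have e : (-2 : ℝ) * -∫ s in t..(0 : ℝ), a s = 2 * ∫ s in t..(0 : ℝ), a s := by ring
      rw [e]
      linarith

variable {F : Type*} [NormedAddCommGroup F] [NormedSpace ℝ F]
  {A : ℝ → F →L[ℝ] F}

theorem locallyIntegrable_clm_apply (hA : LocallyIntegrable A volume) {Y : ℝ → F}
    (hY : Continuous Y) : LocallyIntegrable (fun t => A t (Y t)) volume := by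
  intro x
  obtain ⟨s, hs, h⟩ := hA x
  obtain ⟨K, hK, hKx⟩ := exists_compact_mem_nhds x
  obtain ⟨B, hB⟩ := hK.exists_bound_of_continuousOn hY.continuousOn
  obtain ⟨t, ht, hto, hxt⟩ := mem_nhds_iff.1 (inter_mem hs hKx)
  refine ⟨t, hto.mem_nhds hxt, ?_⟩
  have h' : IntegrableOn A t volume := h.mono_set (ht.trans inter_subset_left)
  refine (h'.norm.mul_const B).mono' ?_ ?_
  · exact isBoundedBilinearMap_apply.continuous.comp_aestronglyMeasurable
      (h'.aestronglyMeasurable.prodMk hY.aestronglyMeasurable)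
  · refine (ae_restrict_iff' hto.measurableSet).2 (Eventually.of_forall fun y hy => ?_)
    exact (A y).le_opNorm_of_le (hB y (ht hy).2)

/-- Gronwall's bound for a linear integral equation with locally integrable coefficients. -/
theorem norm_le_of_linear_integral_equation (hA : LocallyIntegrable A volume) {Y Y₀ : ℝ → F}
    (hY : Continuous Y) (h : ∀ x, Y x = Y₀ x + ∫ t in (0 : ℝ)..x, A t (Y t)) {b K : ℝ}
    (hb : 0 ≤ b) (hK : ∀ x ∈ Icc (-b) b, ‖Y₀ x‖ ≤ K) :
    ∀ x ∈ Icc (-b) b, ‖Y x‖ ≤ 2 * K * Real.exp (2 * ∫ t in (-b)..b, ‖A t‖) := by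
  have ha := hA.norm'
  set α : ℝ → ℝ := fun x => ∫ t in (0 : ℝ)..x, ‖A t‖ with hα
  have hαc : Continuous α :=
    intervalIntegral.continuous_primitive (fun a b => ha.intervalIntegrable' a b) 0
  -- The equation is evaluated where the weighted norm is maximal; there half of the maximum can be
  -- absorbed into the left side.
  obtain ⟨x₀, hx₀, hmax⟩ := (isCompact_Icc (a := -b) (b := b)).exists_isMaxOn
    ⟨0, by simpa using hb⟩ (f := fun x => ‖Y x‖ * Real.exp (-(2 * |α x|)))
    (Continuous.continuousOn (by fun_prop))
  set θ := ‖Y x₀‖ * Real.exp (-(2 * |α x₀|)) with hθ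
  have hle : ∀ x ∈ Icc (-b) b, ‖Y x‖ ≤ θ * Real.exp (2 * |α x|) := fun x hx => by
    have := hmax hx
    simp only [mem_ofPred_eq, ← hθ] at this
    rwa [Real.exp_neg, ← div_eq_mul_inv, div_le_iff₀ (Real.exp_pos _)] at this
  have hK0 : 0 ≤ K := (norm_nonneg _).trans (hK 0 ⟨by linarith, hb⟩)
  have hsub : ∀ x ∈ Icc (-b) b, uIcc 0 x ⊆ Icc (-b) b := fun x hx =>
    uIcc_subset_Icc ⟨by linarith, hb⟩ hx
  have h1 : ‖Y x₀‖ ≤ K + θ / 2 * (Real.exp (2 * |α x₀|) - 1) := by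
    rw [h x₀]
    refine (norm_add_le _ _).trans (add_le_add (hK _ hx₀) ?_)
    exact norm_integral_le_of_le_exp ha (fun _ => norm_nonneg _) fun t ht =>
      (A t).le_opNorm_of_le (hle t (hsub _ hx₀ ht))
  have hθ0 : 0 ≤ θ := by positivity
  have h2 : ‖Y x₀‖ = θ * Real.exp (2 * |α x₀|) := by
    rw [hθ, mul_assoc, ← Real.exp_add]; simp
  have h3 : 1 ≤ Real.exp (2 * |α x₀|) := Real.one_le_exp (by positivity)
  have h4 : θ ≤ 2 * K := by
    rw [h2] at h1
    nlinarith
  intro x hx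
  refine (hle x hx).trans ?_
  gcongr
  rcases le_total 0 x with h0 | h0
  · rw [abs_of_nonneg (intervalIntegral.integral_nonneg h0 fun t _ => norm_nonneg _)]
    exact intervalIntegral.integral_mono_interval (by linarith) h0 hx.2
      (Eventually.of_forall fun t => norm_nonneg _) (ha.intervalIntegrable' _ _)
  · rw [hα]
    simp only
    rw [intervalIntegral.integral_symm, abs_neg,
      abs_of_nonneg (intervalIntegral.integral_nonneg h0 fun t _ => norm_nonneg _)]
    exact intervalIntegral.integral_mono_interval hx.1 h0 hb
      (Eventually.of_forall fun t => norm_nonneg _) (ha.intervalIntegrable' _ _)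

/-- The Picard iterates of a linear integral equation. -/
def picardTerm (A : ℝ → F →L[ℝ] F) (Y₀ : ℝ → F) : ℕ → ℝ → F
  | 0 => Y₀
  | n + 1 => fun x => ∫ t in (0 : ℝ)..x, A t (picardTerm A Y₀ n t)

theorem continuous_picardTerm (hA : LocallyIntegrable A volume) {Y₀ : ℝ → F}
    (hY₀ : Continuous Y₀) : ∀ n, Continuous (picardTerm A Y₀ n)
  | 0 => hY₀
  | n + 1 => intervalIntegral.continuous_primitive (fun a b =>
      (locallyIntegrable_clm_apply hA (continuous_picardTerm hA hY₀ n)).intervalIntegrable' a b) 0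

/-- Each integration gains a factor 1/2 in the weighted norm, so the Picard series is dominated by a
geometric one on every bounded interval. -/
theorem norm_picardTerm_le (hA : LocallyIntegrable A volume) {Y₀ : ℝ → F} {b M : ℝ}
    (hM : ∀ x ∈ Icc (-b) b, ‖Y₀ x‖ ≤ M) (n : ℕ) :
    ∀ x ∈ Icc (-b) b, ‖picardTerm A Y₀ n x‖ ≤
      M * (1 / 2) ^ n * Real.exp (2 * |∫ t in (0 : ℝ)..x, ‖A t‖|) := by
  induction n with
  | zero =>
    intro x hx
    have hM0 : 0 ≤ M := (norm_nonneg _).trans (hM x hx)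
    have h3 : 1 ≤ Real.exp (2 * |∫ t in (0 : ℝ)..x, ‖A t‖|) := Real.one_le_exp (by positivity)
    have := hM x hx
    simp only [picardTerm, pow_zero, mul_one]
    nlinarith
  | succ n ih =>
    intro x hx
    have hM0 : 0 ≤ M := (norm_nonneg _).trans (hM x hx)
    have hsub : uIcc 0 x ⊆ Icc (-b) b :=
      uIcc_subset_Icc ⟨by linarith [hx.1, hx.2], by linarith [hx.1, hx.2]⟩ hx
    have := norm_integral_le_of_le_exp hA.norm' (fun _ => norm_nonneg _)
      (Z := fun t => A t (picardTerm A Y₀ n t)) (x := x) fun t ht =>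
      (A t).le_opNorm_of_le (ih t (hsub ht))
    refine this.trans ?_
    have h0 : 0 ≤ M * (1 / 2) ^ n := by positivity
    rw [pow_succ]
    nlinarith

/-- Global solvability of linear integral equations with locally integrable coefficients. -/
theorem exists_linear_integral_equation [CompleteSpace F] (hA : LocallyIntegrable A volume)
    {Y₀ : ℝ → F} (hY₀ : Continuous Y₀) :
    ∃ Y : ℝ → F, Continuous Y ∧ ∀ x, Y x = Y₀ x + ∫ t in (0 : ℝ)..x, A t (Y t) := by
  set α : ℝ → ℝ := fun x => ∫ t in (0 : ℝ)..x, ‖A t‖ with hα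
  have hαc : Continuous α :=
    intervalIntegral.continuous_primitive (fun a b => hA.norm'.intervalIntegrable' a b) 0
  have hbound : ∀ b : ℝ, ∃ M, 0 ≤ M ∧ ∀ n, ∀ x ∈ Icc (-b) b,
      ‖picardTerm A Y₀ n x‖ ≤ M * (1 / 2) ^ n := by
    intro b
    obtain ⟨M, hM⟩ := (isCompact_Icc (a := -b) (b := b)).exists_bound_of_continuousOn
      hY₀.continuousOn
    obtain ⟨N, hN⟩ := (isCompact_Icc (a := -b) (b := b)).exists_bound_of_continuousOn
      (f := fun x => Real.exp (2 * |α x|)) (Continuous.continuousOn (by fun_prop))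
    refine ⟨|M| * |N|, by positivity, fun n x hx => ?_⟩
    refine (norm_picardTerm_le hA (M := |M|) (fun x hx => (hM x hx).trans (le_abs_self M)) n x
      hx).trans ?_
    have := ((le_abs_self _).trans (hN x hx)).trans (le_abs_self N)
    calc |M| * (1 / 2) ^ n * Real.exp (2 * |∫ t in (0 : ℝ)..x, ‖A t‖|)
        ≤ |M| * (1 / 2) ^ n * |N| := by gcongr
      _ = _ := by ring
  have hgeo : ∀ M : ℝ, Summable fun n : ℕ => M * (1 / 2 : ℝ) ^ n := fun M =>
    (summable_geometric_of_lt_one (by norm_num) (by norm_num)).mul_left M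
  set Y : ℝ → F := fun x => ∑' n, picardTerm A Y₀ n x with hYdef
  have hsum : ∀ x, Summable fun n => picardTerm A Y₀ n x := fun x => by
    obtain ⟨M, -, hM⟩ := hbound |x|
    exact .of_norm_bounded (hgeo M) fun n => hM n x ⟨neg_abs_le x, le_abs_self x⟩
  have hYc : Continuous Y := by
    refine continuous_iff_continuousAt.2 fun x => ?_
    obtain ⟨M, -, hM⟩ := hbound (|x| + 1)
    have : ContinuousOn Y (Icc (-(|x| + 1)) (|x| + 1)) :=
      continuousOn_tsum (fun n => (continuous_picardTerm hA hY₀ n).continuousOn) (hgeo M) hM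
    refine this.continuousAt (Icc_mem_nhds ?_ ?_)
    · linarith [neg_abs_le x]
    · linarith [le_abs_self x]
  refine ⟨Y, hYc, fun x => ?_⟩
  obtain ⟨M, hM0, hM⟩ := hbound |x|
  have hx : uIcc 0 x ⊆ Icc (-|x|) |x| :=
    uIcc_subset_Icc ⟨by simp, by simp⟩ ⟨neg_abs_le x, le_abs_self x⟩
  have h1 : HasSum (fun n => ∫ t in (0 : ℝ)..x, A t (picardTerm A Y₀ n t))
      (∫ t in (0 : ℝ)..x, A t (Y t)) := by
    refine intervalIntegral.hasSum_integral_of_dominated_convergence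
      (fun n t => ‖A t‖ * (M * (1 / 2) ^ n)) (fun n => ?_) (fun n => ?_) ?_ ?_ ?_
    · exact (locallyIntegrable_clm_apply hA
        (continuous_picardTerm hA hY₀ n)).aestronglyMeasurable.restrict
    · exact Eventually.of_forall fun t ht =>
        (A t).le_opNorm_of_le (hM n t (hx (uIoc_subset_uIcc ht)))
    · exact Eventually.of_forall fun t _ => (hgeo M).mul_left _
    · simp_rw [tsum_mul_left]
      exact (hA.norm'.intervalIntegrable' _ _).mul_const _
    · exact Eventually.of_forall fun t _ => (A t).hasSum (hsum t).hasSum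
  have h2 := (hsum x).tsum_eq_zero_add
  rw [hYdef]
  simp only
  rw [h2, ← h1.tsum_eq]
  rfl

end LinearODE

-- Lagrange's identity and initial value problems

section Schrodinger

variable {V : ℝ → ℝ} {u w f g : ℝ → ℂ}

namespace SolvesSchrodinger

theorem hasDerivAt (h : SolvesSchrodinger V u f) (x : ℝ) : HasDerivAt u (deriv u x) x := by
  obtain ⟨-, v, hv, -⟩ := h
  exact (hv x).differentiableAt.hasDerivAt

theorem deriv_sub_deriv (h : SolvesSchrodinger V u f) (a b : ℝ) :
    deriv u b - deriv u a = ∫ x in a..b, ((V x : ℂ) * u x - f x) := by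
  obtain ⟨-, v, hv, hvi⟩ := h
  rw [(hv a).deriv, (hv b).deriv, hvi]

theorem continuous (h : SolvesSchrodinger V u f) : Continuous u :=
  continuous_iff_continuousAt.2 fun x => (h.hasDerivAt x).continuousAt

theorem continuous_deriv (h : SolvesSchrodinger V u f) : Continuous (deriv u) := by
  have : deriv u = fun x => deriv u 0 + ∫ t in (0 : ℝ)..x, ((V t : ℂ) * u t - f t) := by
    funext x; rw [← h.deriv_sub_deriv]; ring
  rw [this]
  exact continuous_const.add
    (intervalIntegral.continuous_primitive (fun a b => h.1.intervalIntegrable' a b) 0)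

theorem sub_eq_integral_deriv (h : SolvesSchrodinger V u f) (a b : ℝ) :
    u b - u a = ∫ x in a..b, deriv u x :=
  (intervalIntegral.integral_eq_sub_of_hasDerivAt (fun x _ => h.hasDerivAt x)
    (h.continuous_deriv.intervalIntegrable a b)).symm

theorem sub (h : SolvesSchrodinger V u f) (h' : SolvesSchrodinger V w g) :
    SolvesSchrodinger V (u - w) (f - g) := by
  simpa [sub_eq_add_neg] using h.add (h'.smul (-1))

theorem conjugate (h : SolvesSchrodinger V u f) :
    SolvesSchrodinger V (fun x => conj (u x)) (fun x => conj (f x)) := by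
  have e : (fun x => (V x : ℂ) * conj (u x) - conj (f x)) =
      fun x => conj ((V x : ℂ) * u x - f x) := by
    funext x; simp
  refine ⟨?_, fun x => conj (deriv u x), fun x => ?_, fun a b => ?_⟩
  · rw [e]
    intro x
    obtain ⟨s, hs, hi⟩ := h.1 x
    exact ⟨s, hs, (integrable_norm_iff (Complex.continuous_conj.comp_aestronglyMeasurable
      hi.aestronglyMeasurable)).1 
      (hi.norm.congr (Eventually.of_forall fun y => by
        exact (RCLike.norm_conj _).symm))⟩
  · exact (h.hasDerivAt x).star
  · rw [e, ← map_sub, h.deriv_sub_deriv]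
    simp only [intervalIntegral, map_sub, ← integral_conj]

theorem deriv_conj (h : SolvesSchrodinger V u f) (x : ℝ) :
    deriv (fun x => conj (u x)) x = conj (deriv u x) :=
  (h.hasDerivAt x).star.deriv

theorem comp_neg (h : SolvesSchrodinger V u f) :
    SolvesSchrodinger (fun x => V (-x)) (fun x => u (-x)) (fun x => f (-x)) := by
  refine ⟨?_, fun x => -deriv u (-x), fun x => ?_, fun a b => ?_⟩
  · intro x
    obtain ⟨s, hs, hi⟩ := h.1 (-x)
    refine ⟨Neg.neg ⁻¹' s, continuous_neg.continuousAt hs, ?_⟩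
    exact ((Measure.measurePreserving_neg volume).integrableOn_comp_preimage
      (Homeomorph.neg ℝ).measurableEmbedding).2 hi
  · have := (h.hasDerivAt (-x)).scomp x (hasDerivAt_neg x)
    rw [neg_one_smul] at this
    exact this
  · rw [intervalIntegral.integral_comp_neg (fun x => (V x : ℂ) * u x - f x), ← h.deriv_sub_deriv]
    ring

theorem deriv_comp_neg (u : ℝ → ℂ) (x : ℝ) : deriv (fun x => u (-x)) x = -deriv u (-x) :=
  _root_.deriv_comp_neg u x

end SolvesSchrodinger

/-- The (modified) Wronskian of two functions. -/
def wronskian (u w : ℝ → ℂ) (x : ℝ) : ℂ := u x * deriv w x - deriv u x * w x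

theorem locallyIntegrable_ofReal_mul (hV : LocallyIntegrable V volume) (hu : Continuous u) :
    LocallyIntegrable (fun x => (V x : ℂ) * u x) volume := by
  have : LocallyIntegrable (fun x => (V x : ℂ)) volume := fun x => by
    obtain ⟨s, hs, hi⟩ := hV x
    exact ⟨s, hs, hi.ofReal⟩
  simpa only [mul_comm] using this.continuous_smul' hu

/-- Lagrange's identity. -/
theorem wronskian_sub_wronskian (hu : SolvesSchrodinger V u f) (hw : SolvesSchrodinger V w g)
    (a b : ℝ) : wronskian u w b - wronskian u w a = ∫ x in a..b, (f x * w x - u x * g x) := by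
  have h1 := integral_deriv_mul_eq_sub_of_indefinite hu.continuous_deriv.locallyIntegrable hw.1
    hu.sub_eq_integral_deriv hw.deriv_sub_deriv a b
  have h2 := integral_deriv_mul_eq_sub_of_indefinite hu.1 hw.continuous_deriv.locallyIntegrable
    hu.deriv_sub_deriv hw.sub_eq_integral_deriv a b
  have i1 : LocallyIntegrable (fun x => deriv u x * deriv w x +
      u x * ((V x : ℂ) * w x - g x)) volume :=
    (hu.continuous_deriv.mul hw.continuous_deriv).locallyIntegrable.add
      (hw.1.continuous_smul' hu.continuous)
  have i2 : LocallyIntegrable (fun x => ((V x : ℂ) * u x - f x) * w x +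
      deriv u x * deriv w x) volume := by
    refine LocallyIntegrable.add ?_
      (hu.continuous_deriv.mul hw.continuous_deriv).locallyIntegrable
    simpa only [mul_comm] using hu.1.continuous_smul' hw.continuous
  have h3 := intervalIntegral.integral_sub (i1.intervalIntegrable' a b)
    (i2.intervalIntegrable' a b)
  rw [h1, h2] at h3
  simp only [wronskian]
  rw [show u b * deriv w b - deriv u b * w b - (u a * deriv w a - deriv u a * w a) =
    u b * deriv w b - u a * deriv w a - (deriv u b * w b - deriv u a * w a) by ring, ← h3]
  congr 1; funext x; ring

/-- The coefficient matrix of the first order system for `-u'' + V u = z u`. -/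
def systemCoeff (V : ℝ → ℝ) (z : ℂ) (t : ℝ) : ℂ × ℂ →L[ℝ] ℂ × ℂ :=
  (ContinuousLinearMap.snd ℝ ℂ ℂ).prod ((-z) • ContinuousLinearMap.fst ℝ ℂ ℂ) -
    V t • ContinuousLinearMap.prod 0 (-ContinuousLinearMap.fst ℝ ℂ ℂ)

theorem systemCoeff_apply (V : ℝ → ℝ) (z : ℂ) (t : ℝ) (p : ℂ × ℂ) :
    systemCoeff V z t p = (p.2, (V t : ℂ) * p.1 - z * p.1) := by
  ext
  · simp [systemCoeff]
  · simp [systemCoeff]; ring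

theorem locallyIntegrable_systemCoeff (hV : LocallyIntegrable V volume) (z : ℂ) :
    LocallyIntegrable (systemCoeff V z) volume := by
  have h0 : LocallyIntegrable (fun _ : ℝ => (ContinuousLinearMap.snd ℝ ℂ ℂ).prod
      ((-z) • ContinuousLinearMap.fst ℝ ℂ ℂ)) volume := continuous_const.locallyIntegrable
  -- Apart from a constant, the coefficient is `V` times a fixed operator, so local integrability is
  -- that of `V`.
  refine h0.sub fun x => ?_
  obtain ⟨s, hs, hi⟩ := hV x
  exact ⟨s, hs, Integrable.smul_const hi _⟩

theorem integral_systemCoeff (hV : LocallyIntegrable V volume) (z : ℂ) {Y : ℝ → ℂ × ℂ}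
    (hY : Continuous Y) (x : ℝ) : ∫ t in (0 : ℝ)..x, systemCoeff V z t (Y t) =
      (∫ t in (0 : ℝ)..x, (Y t).2, ∫ t in (0 : ℝ)..x, ((V t : ℂ) * (Y t).1 - z * (Y t).1)) := by
  have hi := (locallyIntegrable_clm_apply (locallyIntegrable_systemCoeff hV z) hY).intervalIntegrable'
    0 x
  ext1
  · have := (ContinuousLinearMap.fst ℝ ℂ ℂ).intervalIntegral_comp_comm hi
    simpa [systemCoeff_apply] using this.symm
  · have := (ContinuousLinearMap.snd ℝ ℂ ℂ).intervalIntegral_comp_comm hi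
    simpa [systemCoeff_apply] using this.symm

/-- Initial value problems for the Schrödinger equation are solvable. -/
theorem exists_solvesSchrodinger (hV : LocallyIntegrable V volume) (z : ℂ)
    (hf : LocallyIntegrable f volume) (a b : ℂ) :
    ∃ u : ℝ → ℂ, SolvesSchrodinger V u (fun x => z * u x + f x) ∧ u 0 = a ∧ deriv u 0 = b := by
  have hfc : Continuous fun x => ∫ t in (0 : ℝ)..x, f t :=
    intervalIntegral.continuous_primitive (fun a b => hf.intervalIntegrable' a b) 0
  obtain ⟨Y, hY, h⟩ := exists_linear_integral_equation (locallyIntegrable_systemCoeff hV z)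
    (Y₀ := fun x => (a, b - ∫ t in (0 : ℝ)..x, f t)) (by fun_prop)
  simp_rw [integral_systemCoeff hV z hY] at h
  have h1 : ∀ x, (Y x).1 = a + ∫ t in (0 : ℝ)..x, (Y t).2 := fun x => by rw [h x]; simp
  have i1 : LocallyIntegrable (fun t => (V t : ℂ) * (Y t).1 - z * (Y t).1) volume :=
    (locallyIntegrable_ofReal_mul hV hY.fst).sub
      (continuous_const.mul hY.fst).locallyIntegrable
  have i2 : LocallyIntegrable (fun t => (V t : ℂ) * (Y t).1 - (z * (Y t).1 + f t)) volume := by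
    simp_rw [← sub_sub]
    exact i1.sub hf
  have h2 : ∀ x, (Y x).2 = b + ∫ t in (0 : ℝ)..x, ((V t : ℂ) * (Y t).1 - (z * (Y t).1 + f t)) :=
    fun x => by
      simp_rw [← sub_sub]
      rw [intervalIntegral.integral_sub (i1.intervalIntegrable' _ _) (hf.intervalIntegrable' _ _),
        h x]
      simp; ring
  have h3 : ∀ x, HasDerivAt (fun x => (Y x).1) (Y x).2 x := fun x => by
    simp_rw [h1]
    exact (hY.snd.integral_hasStrictDerivAt 0 x).hasDerivAt.const_add _
  refine ⟨fun x => (Y x).1, ⟨i2, fun x => (Y x).2, h3, fun c d => ?_⟩, by simp [h1],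
    by rw [(h3 0).deriv]; simp [h2]⟩
  beta_reduce
  rw [h2 d, h2 c, ← intervalIntegral.integral_interval_sub_left (i2.intervalIntegrable' 0 d)
    (i2.intervalIntegrable' 0 c)]
  ring

/-- Continuous dependence of solutions on the Cauchy data and the source, on `[-b, b]`. -/
theorem exists_norm_solution_le (hV : LocallyIntegrable V volume) (z : ℂ) {b : ℝ} (hb : 0 ≤ b) :
    ∃ C, 0 ≤ C ∧ ∀ u f : ℝ → ℂ, LocallyIntegrable f volume →
      SolvesSchrodinger V u (fun x => z * u x + f x) → ∀ x ∈ Icc (-b) b,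
      ‖u x‖ ≤ C * (‖u 0‖ + ‖deriv u 0‖ + ∫ t in (-b)..b, ‖f t‖) ∧
      ‖deriv u x‖ ≤ C * (‖u 0‖ + ‖deriv u 0‖ + ∫ t in (-b)..b, ‖f t‖) := by
  refine ⟨2 * Real.exp (2 * ∫ t in (-b)..b, ‖systemCoeff V z t‖), by positivity,
    fun u f hf hu x hx => ?_⟩
  have hY : Continuous fun x => (u x, deriv u x) := hu.continuous.prodMk hu.continuous_deriv
  have i1 : LocallyIntegrable (fun t => (V t : ℂ) * u t - z * u t) volume :=
    (locallyIntegrable_ofReal_mul hV hu.continuous).sub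
      (continuous_const.mul hu.continuous).locallyIntegrable
  have key := norm_le_of_linear_integral_equation (locallyIntegrable_systemCoeff hV z) hY
    (Y₀ := fun x => (u 0, deriv u 0 - ∫ t in (0 : ℝ)..x, f t)) (fun x => ?_) hb
    (K := ‖u 0‖ + ‖deriv u 0‖ + ∫ t in (-b)..b, ‖f t‖) (fun x hx => ?_) x hx
  · have h1 := (norm_fst_le (u x, deriv u x)).trans key
    have h2 := (norm_snd_le (u x, deriv u x)).trans key
    constructor
    · linarith
    · linarith
  · rw [integral_systemCoeff hV z hY]
    ext1
    · rw [Prod.fst_add, ← hu.sub_eq_integral_deriv]; ring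
    · rw [Prod.snd_add]
      dsimp only
      rw [eq_comm, sub_add_eq_add_sub, add_sub_assoc, ← intervalIntegral.integral_sub
        (i1.intervalIntegrable' _ _) (hf.intervalIntegrable' _ _)]
      simp_rw [sub_sub]
      rw [← hu.deriv_sub_deriv]; ring
  · have h0 : 0 ≤ ∫ t in (-b)..b, ‖f t‖ :=
      intervalIntegral.integral_nonneg (by linarith) fun _ _ => norm_nonneg _
    have h1 : ‖∫ t in (0 : ℝ)..x, f t‖ ≤ ∫ t in (-b)..b, ‖f t‖ := by
      rcases le_total 0 x with h | h
      · refine (intervalIntegral.norm_integral_le_integral_norm h).trans ?_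
        exact intervalIntegral.integral_mono_interval (by linarith) h hx.2
          (Eventually.of_forall fun t => norm_nonneg _) (hf.norm'.intervalIntegrable' _ _)
      · rw [intervalIntegral.integral_symm, norm_neg]
        refine (intervalIntegral.norm_integral_le_integral_norm h).trans ?_
        exact intervalIntegral.integral_mono_interval hx.1 h hb
          (Eventually.of_forall fun t => norm_nonneg _) (hf.norm'.intervalIntegrable' _ _)
    rw [Prod.norm_def]
    refine max_le ?_ ?_
    · linarith [norm_nonneg (deriv u 0)]
    · refine (norm_sub_le _ _).trans ?_
      linarith [norm_nonneg (u 0)]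

end Schrodinger

-- Weyl discs and the Weyl solution at +∞

section Weyl

variable {V : ℝ → ℝ} {u w f g : ℝ → ℂ} {z : ℂ}

/-- The boundary form `Im (conj u * u')`. -/
def flux (u : ℝ → ℂ) (x : ℝ) : ℝ := (conj (u x) * deriv u x).im

/-- Lagrange's identity for conj u and u: as V is real, conj u solves the equation with conjugate
source, and the Wronskian of the pair is 2i times the flux. For the source z u this ties the L² norm
of u to boundary values. -/
theorem flux_sub_flux (h : SolvesSchrodinger V u g) (a b : ℝ) :
    flux u b - flux u a = -∫ x in a..b, (conj (u x) * g x).im := by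
  have h1 := wronskian_sub_wronskian h.conjugate h a b
  have e (x : ℝ) : wronskian (fun x => conj (u x)) u x = (2 * Complex.I) * (flux u x : ℂ) := by
    rw [wronskian, h.deriv_conj, flux, mul_comm 2, mul_assoc, ← Complex.ofReal_ofNat,
      ← Complex.ofReal_mul]
    apply Complex.ext <;> simp <;> ring
  have e2 : (fun x => conj (g x) * u x - conj (u x) * g x) =
      fun x => (-(2 * Complex.I)) * (((conj (u x) * g x).im : ℝ) : ℂ) := by
    funext x
    apply Complex.ext <;> simp <;> ring
  rw [e, e, e2, intervalIntegral.integral_const_mul, intervalIntegral.integral_ofReal] at h1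
  have h2 : (2 * Complex.I) * (((flux u b - flux u a : ℝ) : ℂ)) =
      (2 * Complex.I) * (((-∫ x in a..b, (conj (u x) * g x).im : ℝ)) : ℂ) := by
    push_cast
    linear_combination h1
  exact_mod_cast mul_left_cancel₀ (by simp) h2

theorem flux_sub_flux_of_homogeneous (h : SolvesSchrodinger V u (fun x => z * u x)) (a b : ℝ) :
    flux u b - flux u a = -(z.im * ∫ x in a..b, ‖u x‖ ^ 2) := by
  rw [flux_sub_flux h,
    ← intervalIntegral.integral_const_mul]
  congr 2; funext x
  rw [mul_left_comm, ← Complex.normSq_eq_conj_mul_self, Complex.normSq_eq_norm_sq,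
    Complex.im_mul_ofReal]

theorem integral_sq_norm_pos (hu : Continuous u) {a b c : ℝ} (hab : a < b) (hc : c ∈ Icc a b)
    (h : u c ≠ 0) : 0 < ∫ x in a..b, ‖u x‖ ^ 2 :=
  intervalIntegral.integral_pos hab (hu.norm.pow 2).continuousOn (fun _ _ => by positivity)
    ⟨c, hc, by positivity⟩

/-- Needed for the solution with u(0) = 0: were u zero on [0, b], its one-sided derivative at 0
would vanish. -/
theorem integral_sq_norm_pos_of_deriv (h : SolvesSchrodinger V u f) {b : ℝ} (hb : 0 < b)
    (h1 : deriv u 0 ≠ 0) : 0 < ∫ x in (0 : ℝ)..b, ‖u x‖ ^ 2 := by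
  by_contra hcon
  have h0 : ∀ x ∈ Icc 0 b, u x = 0 := fun x hx => by
    by_contra hne
    exact hcon (integral_sq_norm_pos h.continuous hb hx hne)
  refine h1 ?_
  have hd : HasDerivWithinAt u 0 (Icc 0 b) 0 :=
    (hasDerivWithinAt_const 0 (Icc 0 b) (0 : ℂ)).congr h0 (h0 0 ⟨le_rfl, hb.le⟩)
  exact (uniqueDiffOn_Icc hb 0 ⟨le_rfl, hb.le⟩).eq_deriv _ (h.hasDerivAt 0).hasDerivWithinAt hd

theorem memLp_two_Ioi_of_bound (hu : Continuous u) {I : ℝ} {a : ℝ}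
    (h : ∀ b, a ≤ b → ∫ x in a..b, ‖u x‖ ^ 2 ≤ I) :
    MemLp u 2 (volume.restrict (Ioi a)) ∧ ∫ x in Ioi a, ‖u x‖ ^ 2 ≤ I := by
  have hi : IntegrableOn (fun x => ‖u x‖ ^ 2) (Ioi a) volume := by
    refine integrableOn_Ioi_of_intervalIntegral_norm_bounded I a (b := fun b : ℝ => b)
      (l := atTop) (fun i => ?_) tendsto_id ?_
    · exact ((hu.norm.pow 2).integrableOn_Icc).mono_set Ioc_subset_Icc_self
    · filter_upwards [eventually_ge_atTop a] with b hb
      simpa using h b hb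
  refine ⟨(memLp_two_iff_integrable_sq_norm hu.aestronglyMeasurable).2 hi, ?_⟩
  refine le_of_tendsto (intervalIntegral_tendsto_integral_Ioi a hi tendsto_id) ?_
  filter_upwards [eventually_ge_atTop a] with b hb using h b hb

theorem wronskian_const (hu : SolvesSchrodinger V u (fun x => z * u x))
    (hw : SolvesSchrodinger V w (fun x => z * w x)) (x y : ℝ) :
    wronskian u w x = wronskian u w y := by
  rw [← sub_eq_zero, wronskian_sub_wronskian hu hw]
  simp [mul_assoc, mul_left_comm]

/-- Existence of the Weyl solution at `+∞`. -/
theorem exists_weyl_solution (hV : LocallyIntegrable V volume) (hz : z.im ≠ 0) :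
    ∃ (ψ : ℝ → ℂ) (m : ℂ), SolvesSchrodinger V ψ (fun x => z * ψ x) ∧ ψ 0 = 1 ∧ deriv ψ 0 = m ∧
      0 < z.im * m.im ∧ (∀ b, 0 ≤ b → 0 ≤ z.im * flux ψ b) ∧
      MemLp ψ 2 (volume.restrict (Ioi 0)) ∧ ∫ x in Ioi (0 : ℝ), ‖ψ x‖ ^ 2 ≤ m.im / z.im := by
  obtain ⟨c, hc, hc0, hc1⟩ := exists_solvesSchrodinger hV z (locallyIntegrable_const (0 : ℂ)) 1 0
  obtain ⟨s, hs, hs0, hs1⟩ := exists_solvesSchrodinger hV z (locallyIntegrable_const (0 : ℂ)) 0 1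
  simp only [add_zero] at hc hs
  -- The ψ m are the solutions with value 1 at 0. The m with 0 ≤ Im z · flux (ψ m) b form Weyl's
  -- disc at b; the discs shrink as b grows, and any m common to all of them is a Weyl coefficient.
  set ψ : ℂ → ℝ → ℂ := fun m => c + m • s with hψ
  have hsol : ∀ m, SolvesSchrodinger V (ψ m) (fun x => z * ψ m x) := fun m => by
    have := hc.add (hs.smul m)
    convert this using 1
    funext x; simp [hψ]; ring
  have hd : ∀ m x, deriv (ψ m) x = deriv c x + m * deriv s x := fun m x =>
    ((hc.hasDerivAt x).add ((hs.hasDerivAt x).const_smul m)).deriv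
  have hfl : ∀ m x, flux (ψ m) x =
      (conj (c x + m * s x) * (deriv c x + m * deriv s x)).im := fun m x => by
    rw [flux, hd]; rfl
  have hmono : ∀ m {a b : ℝ}, a ≤ b → z.im * flux (ψ m) b ≤ z.im * flux (ψ m) a :=
    fun m a b hab => by
      have h1 := flux_sub_flux_of_homogeneous (hsol m) a b
      have h2 : 0 ≤ ∫ x in a..b, ‖ψ m x‖ ^ 2 :=
        intervalIntegral.integral_nonneg hab fun _ _ => by positivity
      have h3 : flux (ψ m) b = flux (ψ m) a - z.im * ∫ x in a..b, ‖ψ m x‖ ^ 2 := by linarith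
      rw [h3]
      nlinarith [mul_nonneg (sq_nonneg z.im) h2]
  have hsneg : ∀ b : ℝ, 0 < b → z.im * flux s b < 0 := fun b hb => by
    have h1 := flux_sub_flux_of_homogeneous hs 0 b
    have h2 := integral_sq_norm_pos_of_deriv hs hb (by rw [hs1]; exact one_ne_zero)
    have h0 : flux s 0 = 0 := by simp [flux, hs0]
    have h3 : flux s b = - (z.im * ∫ x in (0 : ℝ)..b, ‖s x‖ ^ 2) := by linarith
    rw [h3]
    have : 0 < z.im ^ 2 := by positivity
    nlinarith
  -- The index starts at n + 1 because at b = 0 the disc degenerates to a half-plane, which is not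
  -- compact.
  have hne : (⋂ n : ℕ, {m : ℂ | 0 ≤ z.im * flux (ψ m) (n + 1)}).Nonempty := by
    have hclosed : ∀ n : ℕ, IsClosed {m : ℂ | 0 ≤ z.im * flux (ψ m) (n + 1)} := fun n => by
      refine isClosed_le continuous_const (continuous_const.mul ?_)
      simp_rw [hfl]
      exact Complex.continuous_im.comp ((Complex.continuous_conj.comp (by fun_prop)).mul
        (by fun_prop))
    refine IsCompact.nonempty_iInter_of_sequence_nonempty_isCompact_isClosed _
      (fun n m hm => ?_) (fun n => ?_) ?_ hclosed
    · simp only [mem_ofPred_eq] at hm ⊢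
      exact hm.trans (hmono m (by push_cast; linarith))
    · have hsn : s (n + 1) ≠ 0 := fun h0 => by
        have := hsneg (n + 1) (by positivity)
        simp [flux, h0] at this
      -- For this m the solution vanishes at n + 1, and so does its flux.
      refine ⟨-(c (n + 1) / s (n + 1)), ?_⟩
      simp only [mem_ofPred_eq, hfl]
      rw [show c (n + 1) + -(c (n + 1) / s (n + 1)) * s (n + 1) = 0 by field_simp; ring]
      simp
    · refine Metric.isCompact_of_isClosed_isBounded (hclosed 0) ?_
      -- -κ is the coefficient of |m|² in Im z · flux (ψ m) 1; its being negative makes the first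
      -- disc bounded.
      set κ := -(z.im * flux s 1) with hκ
      have hκ0 : 0 < κ := by have := hsneg 1 one_pos; linarith
      set K0 := |z.im * (conj (c 1) * deriv c 1).im|
      set K1 := |z.im| * (‖c 1‖ * ‖deriv s 1‖ + ‖s 1‖ * ‖deriv c 1‖)
      refine (Metric.isBounded_closedBall (x := (0 : ℂ)) (r := 1 + (K0 + K1) / κ)).subset
        fun m hm => ?_
      rw [mem_closedBall_zero_iff]
      simp only [mem_ofPred_eq, hfl, CharP.cast_eq_zero, zero_add] at hm
      have e : (conj (c 1 + m * s 1) * (deriv c 1 + m * deriv s 1)).im =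
          (conj (c 1) * deriv c 1).im + ((conj (c 1) * (m * deriv s 1)).im +
          (conj (m * s 1) * deriv c 1).im) + ‖m‖ ^ 2 * flux s 1 := by
        rw [← Complex.normSq_eq_norm_sq, flux, Complex.normSq_apply]
        simp; ring
      have h1 : |(conj (c 1) * (m * deriv s 1)).im + (conj (m * s 1) * deriv c 1).im| ≤
          ‖m‖ * (‖c 1‖ * ‖deriv s 1‖ + ‖s 1‖ * ‖deriv c 1‖) := by
        refine (abs_add_le _ _).trans ?_
        refine (add_le_add (Complex.abs_im_le_norm _) (Complex.abs_im_le_norm _)).trans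
          (le_of_eq ?_)
        simp; ring
      have h2 : z.im * ((conj (c 1) * (m * deriv s 1)).im + (conj (m * s 1) * deriv c 1).im) ≤
          ‖m‖ * K1 := by
        refine (le_abs_self _).trans ?_
        rw [abs_mul]
        refine (mul_le_mul_of_nonneg_left h1 (abs_nonneg _)).trans (le_of_eq ?_)
        ring
      have h3 : z.im * (conj (c 1) * deriv c 1).im ≤ K0 := le_abs_self _
      rw [e] at hm
      have h4 : κ * ‖m‖ ^ 2 ≤ K0 + K1 * ‖m‖ := by rw [hκ]; nlinarith
      have hK0 : 0 ≤ K0 := abs_nonneg _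
      have hK1 : 0 ≤ K1 := by positivity
      rcases le_total ‖m‖ 1 with hm1 | hm1
      · have : 0 ≤ (K0 + K1) / κ := by positivity
        linarith
      · have h5 : ‖m‖ ≤ (K0 + K1) / κ := by
          rw [le_div_iff₀ hκ0]
          have : κ * ‖m‖ * ‖m‖ ≤ (K0 + K1) * ‖m‖ := by nlinarith
          have := le_of_mul_le_mul_right this (by linarith)
          linarith
        linarith
  obtain ⟨m, hm⟩ := hne
  rw [mem_iInter] at hm
  have hpos : ∀ b : ℝ, 0 ≤ z.im * flux (ψ m) b := fun b => by
    obtain ⟨n, hn⟩ := exists_nat_ge b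
    exact (hm n).trans (hmono m (by linarith))
  have hψ0 : ψ m 0 = 1 := by simp [hψ, hc0, hs0]
  have hψ1 : deriv (ψ m) 0 = m := by rw [hd, hc1, hs1]; ring
  have hfl0 : flux (ψ m) 0 = m.im := by simp [flux, hψ0, hψ1]
  have hz2 : 0 < z.im ^ 2 := by positivity
  have hbd : ∀ b : ℝ, z.im ^ 2 * ∫ x in (0 : ℝ)..b, ‖ψ m x‖ ^ 2 ≤ z.im * m.im := fun b => by
    have h1 := flux_sub_flux_of_homogeneous (hsol m) 0 b
    have h2 := hpos b
    have h3 : flux (ψ m) b = m.im - z.im * ∫ x in (0 : ℝ)..b, ‖ψ m x‖ ^ 2 := by linarith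
    rw [h3] at h2
    nlinarith
  have hmem := memLp_two_Ioi_of_bound (hsol m).continuous (a := 0) (I := m.im / z.im)
    fun b _ => by
      rw [show m.im / z.im = z.im * m.im / z.im ^ 2 by field_simp, le_div_iff₀ hz2]
      linarith [hbd b]
  refine ⟨ψ m, m, hsol m, hψ0, hψ1, ?_, fun b _ => hpos b, hmem⟩
  have h1 := hbd 1
  have h2 := integral_sq_norm_pos (hsol m).continuous (a := 0) (b := 1) (c := 0) one_pos
    ⟨le_rfl, zero_le_one⟩ (by rw [hψ0]; exact one_ne_zero)
  exact lt_of_lt_of_le (mul_pos hz2 h2) h1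

/-- The Cauchy–Schwarz inequality for interval integrals. -/
theorem sq_integral_mul_le_of_intervalIntegrable {p q : ℝ → ℝ} {a b : ℝ}
    (hp : IntervalIntegrable (fun x => p x ^ 2) volume a b)
    (hq : IntervalIntegrable (fun x => q x ^ 2) volume a b)
    (hpq : IntervalIntegrable (fun x => p x * q x) volume a b) (hab : a ≤ b) :
    (∫ x in a..b, p x * q x) ^ 2 ≤ (∫ x in a..b, p x ^ 2) * ∫ x in a..b, q x ^ 2 := by
  have h : ∀ t : ℝ, 0 ≤ (∫ x in a..b, q x ^ 2) * (t * t) +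
      (-(2 * ∫ x in a..b, p x * q x)) * t + ∫ x in a..b, p x ^ 2 := fun t => by
    have h0 : 0 ≤ ∫ x in a..b, (p x - t * q x) ^ 2 :=
      intervalIntegral.integral_nonneg hab fun _ _ => sq_nonneg _
    have e : (fun x => (p x - t * q x) ^ 2) =
        fun x => p x ^ 2 - (2 * t) * (p x * q x) + (t * t) * q x ^ 2 := by funext x; ring
    rw [e, intervalIntegral.integral_add (hp.sub (hpq.const_mul _)) (hq.const_mul _),
      intervalIntegral.integral_sub hp (hpq.const_mul _),
      intervalIntegral.integral_const_mul, intervalIntegral.integral_const_mul] at h0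
    linarith
  have := discrim_le_zero h
  rw [discrim] at this
  nlinarith

theorem sq_integral_mul_le {p q : ℝ → ℝ} (hp : Continuous p) (hq : Continuous q) {a b : ℝ}
    (hab : a ≤ b) : (∫ x in a..b, p x * q x) ^ 2 ≤
      (∫ x in a..b, p x ^ 2) * ∫ x in a..b, q x ^ 2 :=
  sq_integral_mul_le_of_intervalIntegrable ((hp.pow 2).intervalIntegrable _ _)
    ((hq.pow 2).intervalIntegrable _ _) ((hp.mul hq).intervalIntegrable _ _) hab

end Weyl

-- Weyl's alternative

section WeylAlternative

variable {V : ℝ → ℝ} {u w y f g : ℝ → ℂ} {z z₀ : ℂ}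

/-- Expands y in the basis u, w, with Wronskians as coefficients. -/
theorem mul_wronskian_eq (u w y : ℝ → ℂ) (x : ℝ) :
    y x * wronskian u w x = wronskian y w x * u x - wronskian y u x * w x := by
  simp only [wronskian]; ring

/-- By Lagrange's identity W(y, u) drifts by (z - z₀)∫ y u. After Cauchy–Schwarz the unknown ∫|y|²
appears only with the factor T, which is small far out. -/
theorem sq_norm_wronskian_le (hu : SolvesSchrodinger V u (fun x => z₀ * u x))
    (hy : SolvesSchrodinger V y (fun x => z * y x)) {a x X T : ℝ} (hax : a ≤ x) (hxX : x ≤ X)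
    (hT : ∫ t in a..X, ‖u t‖ ^ 2 ≤ T) :
    ‖wronskian y u x‖ ^ 2 ≤ 2 * ‖wronskian y u a‖ ^ 2 +
      2 * ‖z - z₀‖ ^ 2 * ((∫ t in a..X, ‖y t‖ ^ 2) * T) := by
  have h1 := wronskian_sub_wronskian hy hu a x
  have e : (fun t => z * y t * u t - y t * (z₀ * u t)) = fun t => (z - z₀) * (y t * u t) := by
    funext t; ring
  rw [e, intervalIntegral.integral_const_mul] at h1
  have h2 : ‖∫ t in a..x, y t * u t‖ ≤ ∫ t in a..x, ‖y t‖ * ‖u t‖ := by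
    refine (intervalIntegral.norm_integral_le_integral_norm hax).trans (le_of_eq ?_)
    simp only [norm_mul]
  have h3 := sq_integral_mul_le hy.continuous.norm hu.continuous.norm hax
  have mono : ∀ {v : ℝ → ℂ}, Continuous v →
      ∫ t in a..x, ‖v t‖ ^ 2 ≤ ∫ t in a..X, ‖v t‖ ^ 2 := fun hv =>
    intervalIntegral.integral_mono_interval le_rfl hax hxX
      (Eventually.of_forall fun _ => by positivity) ((hv.norm.pow 2).intervalIntegrable _ _)
  have nn : 0 ≤ ∫ t in a..x, ‖u t‖ ^ 2 :=
    intervalIntegral.integral_nonneg hax fun _ _ => by positivity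
  have nn' : 0 ≤ ∫ t in a..X, ‖y t‖ ^ 2 :=
    intervalIntegral.integral_nonneg (hax.trans hxX) fun _ _ => by positivity
  have h4 : ‖∫ t in a..x, y t * u t‖ ^ 2 ≤ (∫ t in a..X, ‖y t‖ ^ 2) * T := by
    calc ‖∫ t in a..x, y t * u t‖ ^ 2 ≤ (∫ t in a..x, ‖y t‖ * ‖u t‖) ^ 2 := by gcongr
      _ ≤ _ := h3
      _ ≤ _ := mul_le_mul (mono hy.continuous) ((mono hu.continuous).trans hT) nn nn'
  have h5 : ‖wronskian y u x‖ ≤ ‖wronskian y u a‖ + ‖z - z₀‖ * ‖∫ t in a..x, y t * u t‖ := by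
    rw [← norm_mul, ← h1]
    calc ‖wronskian y u x‖ = ‖wronskian y u a + (wronskian y u x - wronskian y u a)‖ := by
          congr 1; ring
      _ ≤ _ := norm_add_le _ _
  calc ‖wronskian y u x‖ ^ 2
      ≤ (‖wronskian y u a‖ + ‖z - z₀‖ * ‖∫ t in a..x, y t * u t‖) ^ 2 := by gcongr
    _ ≤ 2 * ‖wronskian y u a‖ ^ 2 + 2 * ‖z - z₀‖ ^ 2 * ‖∫ t in a..x, y t * u t‖ ^ 2 := by
        nlinarith [sq_nonneg (‖wronskian y u a‖ - ‖z - z₀‖ * ‖∫ t in a..x, y t * u t‖)]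
    _ ≤ _ := by gcongr

theorem exists_tail_sq_norm_lt (hu : Continuous u) (h : MemLp u 2 (volume.restrict (Ioi 0)))
    {ε : ℝ} (hε : 0 < ε) :
    ∃ a₀ : ℝ, 0 ≤ a₀ ∧ ∀ a X, a₀ ≤ a → a ≤ X → ∫ x in a..X, ‖u x‖ ^ 2 ≤ ε := by
  have hi : IntegrableOn (fun x => ‖u x‖ ^ 2) (Ioi 0) volume :=
    (memLp_two_iff_integrable_sq_norm hu.aestronglyMeasurable).1 h
  have ht := intervalIntegral_tendsto_integral_Ioi 0 hi tendsto_id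
  have hii (a b : ℝ) : IntervalIntegrable (fun x => ‖u x‖ ^ 2) volume a b :=
    (hu.norm.pow 2).intervalIntegrable _ _
  have hle : ∀ X, 0 ≤ X → ∫ x in (0 : ℝ)..X, ‖u x‖ ^ 2 ≤ ∫ x in Ioi (0 : ℝ), ‖u x‖ ^ 2 :=
    fun X hX => by
      rw [intervalIntegral.integral_of_le hX]
      exact setIntegral_mono_set hi (Eventually.of_forall fun _ => by positivity)
        Ioc_subset_Ioi_self.eventuallyLE
  have h1 : ∀ᶠ a in atTop, (∫ x in Ioi (0 : ℝ), ‖u x‖ ^ 2) - ε < ∫ x in (0 : ℝ)..a, ‖u x‖ ^ 2 :=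
    ht.eventually (lt_mem_nhds (by linarith))
  obtain ⟨a₀, ha₀⟩ := eventually_atTop.1 h1
  refine ⟨max a₀ 0, le_max_right _ _, fun a X ha hX => ?_⟩
  have h2 := ha₀ a ((le_max_left _ _).trans ha)
  have h3 := hle X ((le_max_right _ _).trans (ha.trans hX))
  rw [← intervalIntegral.integral_interval_sub_left (hii 0 X) (hii 0 a)]
  linarith

/-- Weyl's alternative: if two linearly independent solutions for one spectral parameter are
square integrable at `+∞`, then so are all solutions for all parameters. -/
theorem limitCircleAtTop_of_wronskian_ne_zero (hu : SolvesSchrodinger V u (fun x => z₀ * u x))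
    (hw : SolvesSchrodinger V w (fun x => z₀ * w x)) (hu2 : MemLp u 2 (volume.restrict (Ioi 0)))
    (hw2 : MemLp w 2 (volume.restrict (Ioi 0))) (h0 : wronskian u w 0 ≠ 0) :
    LimitCircleAtTop V := by
  intro z y hy
  set D := wronskian u w 0 with hD
  set q := ‖D‖ ^ 2 with hq
  have hq0 : 0 < q := by positivity
  set L := ‖z - z₀‖ ^ 2 with hL
  -- The estimate below reads q Y ≤ 8 K T + 8 L T² Y; this choice of T makes the last term at most q
  -- Y / 2, so that it is absorbed.
  obtain ⟨T, hT0, hT⟩ : ∃ T : ℝ, 0 < T ∧ 16 * L * T ^ 2 ≤ q := by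
    refine ⟨Real.sqrt (q / (16 * (L + 1))), by positivity, ?_⟩
    rw [Real.sq_sqrt (by positivity), ← mul_div_assoc, div_le_iff₀ (by positivity)]
    have : 0 ≤ L := by positivity
    nlinarith
  obtain ⟨a₁, ha₁, h1⟩ := exists_tail_sq_norm_lt hu.continuous hu2 hT0
  obtain ⟨a₂, ha₂, h2⟩ := exists_tail_sq_norm_lt hw.continuous hw2 hT0
  set a := max a₁ a₂
  set K := ‖wronskian y w a‖ ^ 2 + ‖wronskian y u a‖ ^ 2 with hK
  have hii {v : ℝ → ℂ} (hv : Continuous v) (a b : ℝ) :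
      IntervalIntegrable (fun x => ‖v x‖ ^ 2) volume a b := (hv.norm.pow 2).intervalIntegrable _ _
  have key : ∀ X, a ≤ X → ∫ x in a..X, ‖y x‖ ^ 2 ≤ 16 * K * T / q := fun X hX => by
    set Y := ∫ x in a..X, ‖y x‖ ^ 2 with hY
    have hY0 : 0 ≤ Y := intervalIntegral.integral_nonneg hX fun _ _ => by positivity
    have hTu := h1 a X (le_max_left _ _) hX
    have hTw := h2 a X (le_max_right _ _) hX
    have hp : ∀ x ∈ Icc a X, q * ‖y x‖ ^ 2 ≤
        (4 * K + 4 * L * (Y * T)) * (‖u x‖ ^ 2 + ‖w x‖ ^ 2) := fun x hx => by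
      have e := mul_wronskian_eq u w y x
      rw [wronskian_const hu hw x 0, ← hD] at e
      have e1 : ‖y x‖ * ‖D‖ ≤ ‖wronskian y w x‖ * ‖u x‖ + ‖wronskian y u x‖ * ‖w x‖ := by
        rw [← norm_mul, e, ← norm_mul, ← norm_mul]; exact norm_sub_le _ _
      have e2 := sq_norm_wronskian_le hw hy hx.1 hx.2 hTw
      have e3 := sq_norm_wronskian_le hu hy hx.1 hx.2 hTu
      have f2 : ‖wronskian y w x‖ ^ 2 ≤ 2 * K + 2 * L * (Y * T) := by
        rw [hK]; linarith [sq_nonneg ‖wronskian y u a‖]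
      have f3 : ‖wronskian y u x‖ ^ 2 ≤ 2 * K + 2 * L * (Y * T) := by
        rw [hK]; linarith [sq_nonneg ‖wronskian y w a‖]
      calc q * ‖y x‖ ^ 2 = (‖y x‖ * ‖D‖) ^ 2 := by rw [hq]; ring
        _ ≤ (‖wronskian y w x‖ * ‖u x‖ + ‖wronskian y u x‖ * ‖w x‖) ^ 2 := by gcongr
        _ ≤ 2 * (‖wronskian y w x‖ ^ 2 * ‖u x‖ ^ 2) +
            2 * (‖wronskian y u x‖ ^ 2 * ‖w x‖ ^ 2) := by
          nlinarith [sq_nonneg (‖wronskian y w x‖ * ‖u x‖ - ‖wronskian y u x‖ * ‖w x‖)]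
        _ ≤ 2 * ((2 * K + 2 * L * (Y * T)) * ‖u x‖ ^ 2) +
            2 * ((2 * K + 2 * L * (Y * T)) * ‖w x‖ ^ 2) := by gcongr
        _ = _ := by ring
    have hint := intervalIntegral.integral_mono_on hX ((hii hy.continuous a X).const_mul q)
      (((hii hu.continuous a X).add (hii hw.continuous a X)).const_mul _) hp
    rw [intervalIntegral.integral_const_mul, intervalIntegral.integral_const_mul,
      intervalIntegral.integral_add (hii hu.continuous a X) (hii hw.continuous a X), ← hY] at hint
    have hc : 0 ≤ 4 * K + 4 * L * (Y * T) := by positivity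
    have h3 : q * Y ≤ (4 * K + 4 * L * (Y * T)) * (2 * T) :=
      hint.trans (mul_le_mul_of_nonneg_left (by linarith) hc)
    rw [le_div_iff₀ hq0]
    nlinarith
  refine (memLp_two_Ioi_of_bound hy.continuous
    (I := (∫ x in (0 : ℝ)..a, ‖y x‖ ^ 2) + 16 * K * T / q) fun X hX => ?_).1
  have ha0 : 0 ≤ a := ha₁.trans (le_max_left _ _)
  rcases le_total a X with h | h
  · rw [← intervalIntegral.integral_add_adjacent_intervals (hii hy.continuous 0 a)
      (hii hy.continuous a X)]
    linarith [key X h]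
  · have : ∫ x in (0 : ℝ)..X, ‖y x‖ ^ 2 ≤ ∫ x in (0 : ℝ)..a, ‖y x‖ ^ 2 :=
      intervalIntegral.integral_mono_interval le_rfl hX h
        (Eventually.of_forall fun _ => by positivity) (hii hy.continuous _ _)
    have : 0 ≤ 16 * K * T / q := by positivity
    linarith

/-- The definition of limit point only provides a solution that is not square integrable for some
parameter; Weyl's alternative carries the conclusion over to the given `z`. -/
theorem LimitPointAtTop.wronskian_eq_zero (hV : LimitPointAtTop V)
    (hu : SolvesSchrodinger V u (fun x => z * u x))
    (hw : SolvesSchrodinger V w (fun x => z * w x)) (hu2 : MemLp u 2 (volume.restrict (Ioi 0)))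
    (hw2 : MemLp w 2 (volume.restrict (Ioi 0))) (x : ℝ) : wronskian u w x = 0 := by
  rw [wronskian_const hu hw x 0]
  by_contra h
  exact hV (limitCircleAtTop_of_wronskian_ne_zero hu hw hu2 hw2 h)

theorem memLp_restrict_comp_neg {s : Set ℝ} (hs : MeasurableSet s)
    (hu : MemLp u 2 (volume.restrict s)) :
    MemLp (fun x => u (-x)) 2 (volume.restrict (Neg.neg ⁻¹' s)) :=
  hu.comp_measurePreserving ((Measure.measurePreserving_neg volume).restrict_preimage hs)

/-- Reflection x ↦ -x turns every statement at +∞ into one at -∞. -/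
theorem LimitPointAtBot.comp_neg (hV : LimitPointAtBot V) :
    LimitPointAtTop (fun x => V (-x)) := by
  intro h
  refine hV fun z u hu => ?_
  have := memLp_restrict_comp_neg measurableSet_Ioi (h z _ hu.comp_neg)
  simpa using this

theorem wronskian_comp_neg (u w : ℝ → ℂ) (x : ℝ) :
    wronskian (fun x => u (-x)) (fun x => w (-x)) x = -wronskian u w (-x) := by
  simp only [wronskian, SolvesSchrodinger.deriv_comp_neg]; ring

theorem LimitPointAtBot.wronskian_eq_zero (hV : LimitPointAtBot V)
    (hu : SolvesSchrodinger V u (fun x => z * u x))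
    (hw : SolvesSchrodinger V w (fun x => z * w x)) (hu2 : MemLp u 2 (volume.restrict (Iio 0)))
    (hw2 : MemLp w 2 (volume.restrict (Iio 0))) (x : ℝ) : wronskian u w x = 0 := by
  have h1 := memLp_restrict_comp_neg measurableSet_Iio hu2
  have h2 := memLp_restrict_comp_neg measurableSet_Iio hw2
  have := hV.comp_neg.wronskian_eq_zero hu.comp_neg hw.comp_neg (by simpa using h1)
    (by simpa using h2) (-x)
  rwa [wronskian_comp_neg, neg_neg, neg_eq_zero] at this

theorem locallyIntegrable_comp_neg (hV : LocallyIntegrable V volume) :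
    LocallyIntegrable (fun x => V (-x)) volume := by
  intro x
  obtain ⟨s, hs, hi⟩ := hV (-x)
  refine ⟨Neg.neg ⁻¹' s, continuous_neg.continuousAt hs, ?_⟩
  exact ((Measure.measurePreserving_neg volume).integrableOn_comp_preimage
    (Homeomorph.neg ℝ).measurableEmbedding).2 hi

/-- Existence of the Weyl solution at `-∞`. -/
theorem exists_weyl_solution_bot (hV : LocallyIntegrable V volume) (hz : z.im ≠ 0) :
    ∃ (ψ : ℝ → ℂ) (m : ℂ), SolvesSchrodinger V ψ (fun x => z * ψ x) ∧ ψ 0 = 1 ∧ deriv ψ 0 = -m ∧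
      0 < z.im * m.im ∧ (∀ b, b ≤ 0 → z.im * flux ψ b ≤ 0) ∧
      MemLp ψ 2 (volume.restrict (Iio 0)) ∧ ∫ x in Iio (0 : ℝ), ‖ψ x‖ ^ 2 ≤ m.im / z.im := by
  obtain ⟨ψ, m, h, h0, h1, hm, hfl, hL, hI⟩ :=
    exists_weyl_solution (locallyIntegrable_comp_neg hV) hz
  have h' := h.comp_neg
  simp only [neg_neg] at h'
  refine ⟨fun x => ψ (-x), m, h', by simpa using h0, ?_, hm, fun b hb => ?_, ?_, ?_⟩
  · rw [SolvesSchrodinger.deriv_comp_neg, neg_zero, h1]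
  · have := hfl (-b) (by linarith)
    rw [flux, SolvesSchrodinger.deriv_comp_neg]
    rw [flux] at this
    simp only [mul_neg, Complex.neg_im]
    linarith
  · simpa using memLp_restrict_comp_neg measurableSet_Ioi hL
  · rw [← integral_Iic_eq_integral_Iio, ← neg_zero, ← integral_comp_neg_Ioi]
    simpa using hI

end WeylAlternative

-- The resolvent equation on the line for sources of bounded support

section LineResolvent

variable {V : ℝ → ℝ} {w : ℂ}

theorem norm_sq_eq_integral {α : Type*} [MeasurableSpace α] {μ : Measure α} (f : Lp ℂ 2 μ) :
    ‖f‖ ^ 2 = ∫ x, ‖f x‖ ^ 2 ∂μ := by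
  rw [← inner_self_eq_norm_sq (𝕜 := ℂ), L2.inner_def]
  simp only [inner_self_eq_norm_sq_to_K]
  norm_cast

theorem integrable_norm_sq {α : Type*} [MeasurableSpace α] {μ : Measure α} (f : Lp ℂ 2 μ) :
    Integrable (fun x => ‖f x‖ ^ 2) μ :=
  (memLp_two_iff_integrable_sq_norm (Lp.aestronglyMeasurable f)).1 (Lp.memLp f)

theorem locallyIntegrable_coe (f : L2R) : LocallyIntegrable f volume :=
  (Lp.memLp f).locallyIntegrable one_le_two

theorem integral_sq_le_norm_sq (f : L2R) {a b : ℝ} (hab : a ≤ b) :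
    ∫ x in a..b, ‖f x‖ ^ 2 ≤ ‖f‖ ^ 2 := by
  rw [norm_sq_eq_integral, intervalIntegral.integral_of_le hab]
  exact setIntegral_le_integral (integrable_norm_sq f) (Eventually.of_forall fun _ => by positivity)

theorem integral_norm_le_sqrt_mul (f : L2R) {b : ℝ} (hb : 0 ≤ b) :
    ∫ x in (-b)..b, ‖f x‖ ≤ Real.sqrt (2 * b) * ‖f‖ := by
  have hi := (integrable_norm_sq f).intervalIntegrable (a := -b) (b := b)
  have h := sq_integral_mul_le_of_intervalIntegrable (p := fun _ => 1) (q := fun x => ‖f x‖)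
    (a := -b) (b := b) (by simp) hi
    (by simpa using (locallyIntegrable_coe f).norm'.intervalIntegrable' (-b) b) (by linarith)
  have h2 := integral_sq_le_norm_sq f (a := -b) (b := b) (by linarith)
  refine (sq_le_sq₀ (intervalIntegral.integral_nonneg (by linarith) fun _ _ => norm_nonneg _)
    (by positivity)).1 ?_
  rw [mul_pow, Real.sq_sqrt (by positivity)]
  simp only [one_mul, one_pow, intervalIntegral.integral_const, smul_eq_mul, mul_one] at h
  refine h.trans ?_
  rw [show b - -b = 2 * b by ring]
  gcongr

/-- `u` is the continuous representative of `φ`, and it solves `-u'' + V u - w u = f`. -/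
structure IsLineSolution (V : ℝ → ℝ) (w : ℂ) (u : ℝ → ℂ) (φ f : L2R) : Prop where
  ae_eq : φ =ᵐ[volume] u
  solves : SolvesSchrodinger V u (fun x => w * u x + f x)

theorem deriv_mul_wronskian_eq (u w y : ℝ → ℂ) (x : ℝ) :
    deriv y x * wronskian u w x = wronskian y w x * deriv u x - wronskian y u x * deriv w x := by
  simp only [wronskian]; ring

/-- At x the Cauchy data of u are k times those of ψ₁, so the flux is multiplied by |k|². Thus u
inherits the sign of the flux of a Weyl solution. -/
theorem flux_eq_of_wronskian_eq_zero {u ψ₁ ψ₂ : ℝ → ℂ} {x : ℝ} (h : wronskian u ψ₁ x = 0)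
    (h0 : wronskian ψ₁ ψ₂ x ≠ 0) : ∃ c : ℝ, 0 ≤ c ∧ flux u x = c * flux ψ₁ x := by
  set k := wronskian u ψ₂ x / wronskian ψ₁ ψ₂ x
  have hk : k * wronskian ψ₁ ψ₂ x = wronskian u ψ₂ x := div_mul_cancel₀ _ h0
  have h1 : u x = k * ψ₁ x := by
    have := mul_wronskian_eq ψ₁ ψ₂ u x
    rw [h] at this
    refine mul_right_cancel₀ h0 ?_
    linear_combination this - ψ₁ x * hk
  have h2 : deriv u x = k * deriv ψ₁ x := by
    have := deriv_mul_wronskian_eq ψ₁ ψ₂ u x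
    rw [h] at this
    refine mul_right_cancel₀ h0 ?_
    linear_combination this - deriv ψ₁ x * hk
  refine ⟨‖k‖ ^ 2, by positivity, ?_⟩
  rw [flux, flux, h1, h2, ← Complex.normSq_eq_norm_sq, Complex.normSq_apply]
  simp; ring

theorem wronskian_tail {u ψ f : ℝ → ℂ} (hu : SolvesSchrodinger V u (fun x => w * u x + f x))
    (hψ : SolvesSchrodinger V ψ (fun x => w * ψ x)) (x y : ℝ) :
    wronskian u ψ y - wronskian u ψ x = ∫ t in x..y, f t * ψ t := by
  rw [wronskian_sub_wronskian hu hψ]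
  congr 1; funext t; ring

theorem memLp_two_of_bound {u : ℝ → ℂ} (hu : Continuous u) {I a : ℝ}
    (h : ∀ b, a ≤ b → ∫ x in (-b)..b, ‖u x‖ ^ 2 ≤ I) :
    MemLp u 2 volume ∧ ∫ x, ‖u x‖ ^ 2 ≤ I := by
  have hi : Integrable (fun x => ‖u x‖ ^ 2) volume := by
    refine integrable_of_intervalIntegral_norm_bounded I (a := fun b : ℝ => -b)
      (b := fun b : ℝ => b) (l := atTop) (fun i => ?_) tendsto_neg_atTop_atBot tendsto_id ?_
    · exact ((hu.norm.pow 2).integrableOn_Icc).mono_set Ioc_subset_Icc_self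
    · filter_upwards [eventually_ge_atTop a] with b hb
      simpa using h b hb
  refine ⟨(memLp_two_iff_integrable_sq_norm hu.aestronglyMeasurable).2 hi, ?_⟩
  refine le_of_tendsto (intervalIntegral_tendsto_integral hi tendsto_neg_atTop_atBot tendsto_id) ?_
  filter_upwards [eventually_ge_atTop a] with b hb using h b hb

/-- The resolvent equation for sources of bounded support. -/
theorem exists_solution_of_bounded_support (hV : LocallyIntegrable V volume) (hw : w.im ≠ 0)
    {ψp ψm : ℝ → ℂ} (hp : SolvesSchrodinger V ψp (fun x => w * ψp x))
    (hm : SolvesSchrodinger V ψm (fun x => w * ψm x)) (hpm : wronskian ψp ψm 0 ≠ 0)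
    (hfp : ∀ b, 0 ≤ b → 0 ≤ w.im * flux ψp b) (hfm : ∀ b, b ≤ 0 → w.im * flux ψm b ≤ 0)
    (f : L2R) {f₀ : ℝ → ℂ} (hff : f =ᵐ[volume] f₀) {a : ℝ} (ha : 0 ≤ a)
    (hf0 : ∀ x, x ∉ Ioo (-a) a → f₀ x = 0) :
    ∃ u φ, IsLineSolution V w u φ f ∧ |w.im| * ‖φ‖ ≤ ‖f‖ ∧
      ∫ x in Ioi (0 : ℝ), f x * ψp x = -wronskian u ψp 0 ∧
      ∫ x in Iio (0 : ℝ), f x * ψm x = wronskian u ψm 0 := by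
  have hfl : LocallyIntegrable f₀ volume := (locallyIntegrable_coe f).congr hff
  obtain ⟨y, hy, -, -⟩ := exists_solvesSchrodinger hV w hfl 0 0
  set D := wronskian ψp ψm 0 with hD
  have hDx : ∀ x, wronskian ψp ψm x = D := fun x => wronskian_const hp hm x 0
  -- The particular solution y is corrected so that u is proportional to ψm left of -a and to ψp
  -- right of a: p cancels the Wronskian with ψm at -a, q the one with ψp at a.
  set p := -(wronskian y ψm (-a) / D)
  set q := wronskian y ψp a / D
  set u : ℝ → ℂ := y + p • ψp + q • ψm with hu_def
  have hu0 : SolvesSchrodinger V u (fun x => w * u x + f₀ x) := by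
    convert (hy.add (hp.smul p)).add (hm.smul q) using 1
    funext x; simp [hu_def]; ring
  have hu : SolvesSchrodinger V u (fun x => w * u x + f x) :=
    hu0.congr_right (hff.symm.mono fun x hx => by simp only [hx])
  have hud : ∀ x, deriv u x = deriv y x + p * deriv ψp x + q * deriv ψm x := fun x =>
    (((hy.hasDerivAt x).add ((hp.hasDerivAt x).const_smul p)).add
      ((hm.hasDerivAt x).const_smul q)).deriv
  have hWp : wronskian u ψp a = 0 := by
    have h1 : wronskian u ψp a = wronskian y ψp a - q * wronskian ψp ψm a := by
      simp only [wronskian, hud]; simp [hu_def]; ring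
    rw [h1, hDx, div_mul_cancel₀ _ hpm, sub_self]
  have hWm : wronskian u ψm (-a) = 0 := by
    have h1 : wronskian u ψm (-a) = wronskian y ψm (-a) + p * wronskian ψp ψm (-a) := by
      simp only [wronskian, hud]; simp [hu_def]; ring
    rw [h1, hDx, neg_mul, div_mul_cancel₀ _ hpm, add_neg_cancel]
  have hWp' : ∀ x, a ≤ x → wronskian u ψp x = 0 := fun x hx => by
    have h1 := wronskian_tail hu0 hp a x
    rw [intervalIntegral.integral_congr (g := fun _ => 0) fun t ht => ?_] at h1
    · rw [hWp] at h1; simpa using h1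
    · rw [uIcc_of_le hx] at ht
      simp [hf0 t fun h => absurd h.2 (not_lt.2 ht.1)]
  have hWm' : ∀ x, x ≤ -a → wronskian u ψm x = 0 := fun x hx => by
    have h1 := wronskian_tail hu0 hm (-a) x
    rw [intervalIntegral.integral_congr (g := fun _ => 0) fun t ht => ?_] at h1
    · rw [hWm] at h1; simpa using h1
    · rw [uIcc_of_ge hx] at ht
      simp [hf0 t fun h => absurd h.1 (not_lt.2 ht.2)]
  have hw2 : 0 < w.im ^ 2 := by positivity
  -- Outside the support the fluxes of u have the sign of those of ψp and ψm, so the boundary terms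
  -- of the flux identity can be dropped: (Im w)² ∫|u|² ≤ |Im w| ∫|u||f|.
  have hbound : ∀ b, a ≤ b → ∫ x in (-b)..b, ‖u x‖ ^ 2 ≤ ‖f‖ ^ 2 / w.im ^ 2 := fun b hb => by
    have hb0 : -b ≤ b := by linarith
    set Y := ∫ x in (-b)..b, ‖u x‖ ^ 2 with hY
    have hY0 : 0 ≤ Y := intervalIntegral.integral_nonneg hb0 fun _ _ => by positivity
    have f1 : 0 ≤ w.im * flux u b := by
      obtain ⟨c, hc, e⟩ := flux_eq_of_wronskian_eq_zero (hWp' b hb) (ψ₂ := ψm) (by rwa [hDx])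
      rw [e, mul_left_comm]; exact mul_nonneg hc (hfp b (ha.trans hb))
    have f2 : w.im * flux u (-b) ≤ 0 := by
      obtain ⟨c, hc, e⟩ := flux_eq_of_wronskian_eq_zero (hWm' (-b) (by linarith)) (ψ₂ := ψp) (by
        rw [show wronskian ψm ψp (-b) = -wronskian ψp ψm (-b) by simp only [wronskian]; ring,
          hDx]
        exact neg_ne_zero.2 hpm)
      rw [e, mul_left_comm]
      exact mul_nonpos_of_nonneg_of_nonpos hc (hfm _ (by linarith))
    have iu : IntervalIntegrable (fun x => ‖u x‖ ^ 2) volume (-b) b :=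
      (hu.continuous.norm.pow 2).intervalIntegrable _ _
    have iuf : IntervalIntegrable (fun x => conj (u x) * f x) volume (-b) b :=
      ((locallyIntegrable_coe f).continuous_smul'
        (Complex.continuous_conj.comp hu.continuous)).intervalIntegrable' _ _
    have iuf' : IntervalIntegrable (fun x => (conj (u x) * f x).im) volume (-b) b :=
      ⟨iuf.1.im, iuf.2.im⟩
    have iufn : IntervalIntegrable (fun x => ‖u x‖ * ‖f x‖) volume (-b) b := by
      simpa using iuf.norm
    have e := flux_sub_flux hu (-b) b
    have e2 : (fun x => (conj (u x) * (w * u x + f x)).im) =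
        fun x => w.im * ‖u x‖ ^ 2 + (conj (u x) * f x).im := by
      funext x
      rw [← Complex.normSq_eq_norm_sq, Complex.normSq_apply]
      simp; ring
    rw [e2, intervalIntegral.integral_add (iu.const_mul _) iuf',
      intervalIntegral.integral_const_mul, ← hY] at e
    set Q := ∫ x in (-b)..b, (conj (u x) * f x).im
    set P := ∫ x in (-b)..b, ‖u x‖ * ‖f x‖ with hP
    have hQ : |Q| ≤ P := by
      refine (intervalIntegral.abs_integral_le_integral_abs hb0).trans ?_
      refine intervalIntegral.integral_mono_on hb0 iuf'.abs iufn fun x _ => ?_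
      refine (Complex.abs_im_le_norm _).trans (by simp)
    have hPF : P ^ 2 ≤ Y * ‖f‖ ^ 2 :=
      (sq_integral_mul_le_of_intervalIntegrable iu
        ((integrable_norm_sq f).intervalIntegrable) iufn hb0).trans
        (mul_le_mul_of_nonneg_left (integral_sq_le_norm_sq f hb0) hY0)
    have h3 : w.im ^ 2 * Y ≤ |w.im| * P := by
      have : w.im * (flux u b - flux u (-b)) = -(w.im ^ 2 * Y + w.im * Q) := by rw [e]; ring
      have h4 : -(w.im * Q) ≤ |w.im| * P := by
        refine (neg_le_abs _).trans ?_
        rw [abs_mul]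
        gcongr
      nlinarith
    rw [le_div_iff₀ hw2]
    have hP0 : 0 ≤ P := (abs_nonneg _).trans hQ
    have h5 : (w.im ^ 2 * Y) ^ 2 ≤ w.im ^ 2 * (Y * ‖f‖ ^ 2) := by
      calc (w.im ^ 2 * Y) ^ 2 ≤ (|w.im| * P) ^ 2 := by gcongr
        _ = w.im ^ 2 * P ^ 2 := by rw [mul_pow, sq_abs]
        _ ≤ _ := by gcongr
    rcases hY0.eq_or_lt with h0 | h0
    · rw [← h0]; simp
    · have h6 : (w.im ^ 2 * Y) * (Y * w.im ^ 2) ≤ (w.im ^ 2 * Y) * ‖f‖ ^ 2 := by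
        calc _ = (w.im ^ 2 * Y) ^ 2 := by ring
          _ ≤ _ := h5
          _ = _ := by ring
      exact le_of_mul_le_mul_left h6 (by positivity)
  obtain ⟨hu2, hun⟩ := memLp_two_of_bound hu.continuous hbound
  refine ⟨u, hu2.toLp u, ⟨hu2.coeFn_toLp, hu⟩, ?_, ?_, ?_⟩
  · refine (sq_le_sq₀ (by positivity) (norm_nonneg _)).1 ?_
    rw [mul_pow, sq_abs, norm_sq_eq_integral]
    rw [integral_congr_ae (hu2.coeFn_toLp.mono fun x hx => by
      simp only [hx] : _ =ᵐ[volume] fun x => ‖u x‖ ^ 2)]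
    rw [le_div_iff₀ hw2] at hun
    linarith
  · have h1 := wronskian_tail hu0 hp 0 a
    rw [hWp, zero_sub] at h1
    rw [h1, intervalIntegral.integral_of_le ha,
      setIntegral_congr_ae (g := fun x => f₀ x * ψp x) measurableSet_Ioi
        (hff.mono fun x hx _ => by rw [hx])]
    exact setIntegral_eq_of_subset_of_forall_sdiff_eq_zero measurableSet_Ioi Ioc_subset_Ioi_self
      fun x hx => by
        have : ¬ x < a := fun h => hx.2 ⟨hx.1, h.le⟩
        simp [hf0 x fun h => this h.2]
  · have h1 := wronskian_tail hu0 hm (-a) 0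
    rw [hWm, sub_zero] at h1
    rw [h1, intervalIntegral.integral_of_le (by linarith),
      setIntegral_congr_ae (g := fun x => f₀ x * ψm x) measurableSet_Iio
        (hff.mono fun x hx _ => by rw [hx]), ← integral_Iic_eq_integral_Iio]
    exact setIntegral_eq_of_subset_of_forall_sdiff_eq_zero measurableSet_Iic Ioc_subset_Iic_self
      fun x hx => by
        have : ¬ -a < x := fun h => hx.2 ⟨h, hx.1⟩
        simp [hf0 x fun h => this h.1]

end LineResolvent

-- Weyl data for arbitrary square integrable sources

section WeylData

variable {V : ℝ → ℝ} {w : ℂ}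

theorem IsLineSolution.sub {u u' : ℝ → ℂ} {φ φ' f f' : L2R} (h : IsLineSolution V w u φ f)
    (h' : IsLineSolution V w u' φ' f') : IsLineSolution V w (u - u') (φ - φ') (f - f') := by
  refine ⟨(Lp.coeFn_sub φ φ').trans (h.ae_eq.sub h'.ae_eq), ?_⟩
  refine (h.solves.sub h'.solves).congr_right ?_
  filter_upwards [Lp.coeFn_sub f f'] with x hx
  simp only [Pi.sub_apply, hx]; ring

/-- A square integrable solution of the homogeneous equation has zero Wronskian with both ψp and ψm,
which are linearly independent. -/
theorem IsLineSolution.eq_zero (hTop : LimitPointAtTop V) (hBot : LimitPointAtBot V)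
    {ψp ψm : ℝ → ℂ} (hp : SolvesSchrodinger V ψp (fun x => w * ψp x))
    (hm : SolvesSchrodinger V ψm (fun x => w * ψm x)) (hpm : wronskian ψp ψm 0 ≠ 0)
    (hp2 : MemLp ψp 2 (volume.restrict (Ioi 0))) (hm2 : MemLp ψm 2 (volume.restrict (Iio 0)))
    {u : ℝ → ℂ} {φ : L2R} (h : IsLineSolution V w u φ 0) : φ = 0 ∧ ∀ x, u x = 0 := by
  have hu : SolvesSchrodinger V u (fun x => w * u x) := h.solves.congr_right <|
    Eventually.of_forall fun x => by simp
  have hu2 : MemLp u 2 volume := (memLp_congr_ae h.ae_eq).1 (Lp.memLp φ)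
  have h0 : ∀ x, u x = 0 := fun x => by
    have e := mul_wronskian_eq ψp ψm u x
    rw [hTop.wronskian_eq_zero hu hp (hu2.restrict _) hp2,
      hBot.wronskian_eq_zero hu hm (hu2.restrict _) hm2, wronskian_const hp hm x 0] at e
    simpa [hpm] using e
  refine ⟨?_, h0⟩
  rw [Lp.eq_zero_iff_ae_eq_zero]
  filter_upwards [h.ae_eq] with x hx
  rw [hx, h0, Pi.zero_apply]

/-- `f` vanishes almost everywhere outside a bounded interval. -/
def BoundedSupport (f : L2R) : Prop :=
  ∃ (f₀ : ℝ → ℂ) (a : ℝ), f =ᵐ[volume] f₀ ∧ 0 ≤ a ∧ ∀ x, x ∉ Ioo (-a) a → f₀ x = 0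

theorem BoundedSupport.sub {f g : L2R} (hf : BoundedSupport f) (hg : BoundedSupport g) :
    BoundedSupport (f - g) := by
  obtain ⟨f₀, a, hfa, ha, hf0⟩ := hf
  obtain ⟨g₀, b, hgb, hb, hg0⟩ := hg
  refine ⟨f₀ - g₀, max a b, (Lp.coeFn_sub f g).trans (hfa.sub hgb), le_max_of_le_left ha,
    fun x hx => ?_⟩
  have h1 : x ∉ Ioo (-a) a := fun h => hx ⟨(neg_le_neg (le_max_left a b)).trans_lt h.1,
    h.2.trans_le (le_max_left a b)⟩
  have h2 : x ∉ Ioo (-b) b := fun h => hx ⟨(neg_le_neg (le_max_right a b)).trans_lt h.1,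
    h.2.trans_le (le_max_right a b)⟩
  simp [hf0 x h1, hg0 x h2]

theorem dense_boundedSupport : Dense {f : L2R | BoundedSupport f} := by
  intro f
  rw [Metric.mem_closure_iff]
  intro ε hε
  obtain ⟨g, hgc, hg, -, hg2⟩ := (Lp.memLp f).exists_hasCompactSupport_eLpNorm_sub_le
    (by norm_num) (ε := ENNReal.ofReal (ε / 2)) (by simpa using hε)
  obtain ⟨r, hr⟩ := hgc.isCompact.isBounded.subset_closedBall 0
  refine ⟨hg2.toLp g, ⟨g, |r| + 1, hg2.coeFn_toLp, by positivity, fun x hx => ?_⟩, ?_⟩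
  · by_contra h
    have h1 := hr (subset_tsupport g h)
    rw [mem_closedBall_zero_iff, Real.norm_eq_abs, abs_le] at h1
    exact hx ⟨by linarith [h1.1, le_abs_self r], by linarith [h1.2, le_abs_self r]⟩
  · have e : dist f (hg2.toLp g) = (eLpNorm (⇑f - g) 2 volume).toReal := by
      rw [dist_edist, Lp.edist_def]
      congr 1
      exact eLpNorm_congr_ae (EventuallyEq.rfl.sub hg2.coeFn_toLp)
    rw [e]
    refine (ENNReal.toReal_mono ENNReal.ofReal_ne_top hg).trans_lt ?_
    rw [ENNReal.toReal_ofReal (by linarith)]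
    linarith

/-- The Weyl solutions of the equation `-u'' + V u = w u` at `±∞`, and their relation to the
resolvent equation. -/
structure WeylData (V : ℝ → ℝ) (w : ℂ) where
  /-- the coefficient at `+∞` -/
  mp : ℂ
  /-- the coefficient at `-∞` -/
  mm : ℂ
  /-- the complex conjugate of the Weyl solution on the right half-line -/
  A : L2R
  /-- the complex conjugate of the Weyl solution on the left half-line -/
  B : L2R
  mp_pos : 0 < w.im * mp.im
  mm_pos : 0 < w.im * mm.im
  norm_A : ‖A‖ ^ 2 ≤ mp.im / w.im
  norm_B : ‖B‖ ^ 2 ≤ mm.im / w.im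
  orth : inner ℂ A B = 0
  exists_solution : ∀ f, ∃ u φ, IsLineSolution V w u φ f
  norm_le : ∀ u φ f, IsLineSolution V w u φ f → |w.im| * ‖φ‖ ≤ ‖f‖
  inner_A : ∀ u φ f, IsLineSolution V w u φ f → inner ℂ A f = deriv u 0 - mp * u 0
  inner_B : ∀ u φ f, IsLineSolution V w u φ f → inner ℂ B f = -deriv u 0 - mm * u 0

/-- Conjugation turns the bilinear integrals ∫ f ψ of Lagrange's identity into inner products. -/
theorem exists_conj_extension {s : Set ℝ} (hs : MeasurableSet s) {ψ : ℝ → ℂ}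
    (h : MemLp ψ 2 (volume.restrict s)) :
    ∃ A : L2R, A =ᵐ[volume] s.indicator (fun x => conj (ψ x)) ∧
      ‖A‖ ^ 2 = ∫ x in s, ‖ψ x‖ ^ 2 ∧ ∀ f : L2R, inner ℂ A f = ∫ x in s, f x * ψ x := by
  have h1 : MemLp (s.indicator (fun x => conj (ψ x))) 2 volume := by
    rw [memLp_indicator_iff_restrict hs]
    exact (memLp_norm_iff (Complex.continuous_conj.comp_aestronglyMeasurable
      h.aestronglyMeasurable)).1 (by simpa using! h.norm)
  refine ⟨h1.toLp _, h1.coeFn_toLp, ?_, fun f => ?_⟩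
  · rw [norm_sq_eq_integral, ← integral_indicator hs]
    refine integral_congr_ae ?_
    filter_upwards [h1.coeFn_toLp] with x hx
    rw [hx]
    by_cases hxs : x ∈ s <;> simp [hxs]
  · rw [L2.inner_def, ← integral_indicator hs]
    refine integral_congr_ae ?_
    filter_upwards [h1.coeFn_toLp] with x hx
    rw [hx]
    by_cases hxs : x ∈ s <;> simp [hxs]

theorem nonempty_weylData (hV : LocallyIntegrable V volume) (hTop : LimitPointAtTop V)
    (hBot : LimitPointAtBot V) (hw : w.im ≠ 0) : Nonempty (WeylData V w) := by
  obtain ⟨ψp, mp, hp, hp0, hp1, hmp, hfp, hp2, hpn⟩ := exists_weyl_solution hV hw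
  obtain ⟨ψm, mm, hm, hm0, hm1, hmm, hfm, hm2, hmn⟩ := exists_weyl_solution_bot hV hw
  have hW : wronskian ψp ψm 0 = -(mp + mm) := by simp only [wronskian, hp0, hp1, hm0, hm1]; ring
  have hsum : mp + mm ≠ 0 := fun h => by
    have h1 : mp.im + mm.im = 0 := by simpa using congrArg Complex.im h
    have h2 : 0 < w.im * (mp.im + mm.im) := by linarith
    rw [h1] at h2; simp at h2
  have hpm : wronskian ψp ψm 0 ≠ 0 := by rw [hW]; exact neg_ne_zero.2 hsum
  obtain ⟨A, hA, hAn, hAi⟩ := exists_conj_extension measurableSet_Ioi hp2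
  obtain ⟨B, hB, hBn, hBi⟩ := exists_conj_extension measurableSet_Iio hm2
  have huniq : ∀ {u u' φ φ' f}, IsLineSolution V w u φ f → IsLineSolution V w u' φ' f →
      φ = φ' ∧ u = u' := fun h h' => by
    have h1 := (h.sub h')
    rw [sub_self] at h1
    obtain ⟨h2, h3⟩ := h1.eq_zero hTop hBot hp hm hpm hp2 hm2
    exact ⟨sub_eq_zero.1 h2, funext fun x => sub_eq_zero.1 (h3 x)⟩
  have hex : ∀ f : L2R, BoundedSupport f → ∃ u φ, IsLineSolution V w u φ f ∧
      |w.im| * ‖φ‖ ≤ ‖f‖ ∧ inner ℂ A f = deriv u 0 - mp * u 0 ∧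
      inner ℂ B f = -deriv u 0 - mm * u 0 := by
    rintro f ⟨f₀, a, hff, ha, hf0⟩
    obtain ⟨u, φ, h, hn, i1, i2⟩ :=
      exists_solution_of_bounded_support hV hw hp hm hpm hfp hfm f hff ha hf0
    refine ⟨u, φ, h, hn, ?_, ?_⟩
    · rw [hAi, i1]; simp only [wronskian, hp0, hp1]; ring
    · rw [hBi, i2]; simp only [wronskian, hm0, hm1]; ring
  have hall : ∀ f : L2R, ∃ u φ, IsLineSolution V w u φ f ∧
      |w.im| * ‖φ‖ ≤ ‖f‖ ∧ inner ℂ A f = deriv u 0 - mp * u 0 ∧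
      inner ℂ B f = -deriv u 0 - mm * u 0 := by
    intro f
    -- Approximation by sources of bounded support: the norm bound makes the solutions Cauchy in L²,
    -- and pairing with A and B makes their Cauchy data at 0 converge.
    obtain ⟨F, hFs, hF⟩ := mem_closure_iff_seq_limit.1 (dense_boundedSupport f)
    choose u φ hsol hnorm hiA hiB using fun n => hex (F n) (hFs n)
    have hw0 : 0 < |w.im| := abs_pos.2 hw
    have hdist : ∀ n m, ‖φ n - φ m‖ ≤ |w.im|⁻¹ * ‖F n - F m‖ := fun n m => by
      obtain ⟨u', φ', h', hn', -, -⟩ := hex (F n - F m) ((hFs n).sub (hFs m))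
      rw [(huniq ((hsol n).sub (hsol m)) h').1, ← div_eq_inv_mul, le_div_iff₀ hw0]
      linarith
    have hcauchy : CauchySeq φ := by
      have h1 := cauchySeq_iff_tendsto_dist_atTop_0.1 hF.cauchySeq
      rw [cauchySeq_iff_tendsto_dist_atTop_0]
      refine squeeze_zero (fun _ => dist_nonneg) (fun n => ?_)
        (by simpa using h1.const_mul |w.im|⁻¹)
      rw [dist_eq_norm, dist_eq_norm]
      exact hdist _ _
    obtain ⟨φl, hφ⟩ := cauchySeq_tendsto_of_complete hcauchy
    have hA' : Tendsto (fun n => (inner ℂ A (F n) : ℂ)) atTop (𝓝 (inner ℂ A f)) :=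
      tendsto_const_nhds.inner hF
    have hB' : Tendsto (fun n => (inner ℂ B (F n) : ℂ)) atTop (𝓝 (inner ℂ B f)) :=
      tendsto_const_nhds.inner hF
    -- α and β solve ⟨A, f⟩ = β - mp α, ⟨B, f⟩ = -β - mm α; they are the limits of u n 0 and deriv
    -- (u n) 0.
    set α : ℂ := -(mp + mm)⁻¹ * (inner ℂ A f + inner ℂ B f) with hα
    set β : ℂ := inner ℂ A f + mp * α with hβ
    have hu0 : ∀ n, u n 0 = -(mp + mm)⁻¹ * (inner ℂ A (F n) + inner ℂ B (F n)) := fun n => by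
      rw [hiA, hiB]; field_simp; ring
    have hα' : Tendsto (fun n => u n 0) atTop (𝓝 α) := by
      simp_rw [hu0]; exact (hA'.add hB').const_mul _
    have hβ' : Tendsto (fun n => deriv (u n) 0) atTop (𝓝 β) := by
      have : ∀ n, deriv (u n) 0 = inner ℂ A (F n) + mp * u n 0 := fun n => by rw [hiA]; ring
      simp_rw [this]
      exact hA'.add (hα'.const_mul _)
    obtain ⟨U, hU, hU0, hU1⟩ := exists_solvesSchrodinger hV w (locallyIntegrable_coe f) α β
    -- Continuous dependence gives pointwise convergence to the solution U with the limiting data,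
    -- which identifies U with the L² limit.
    have hconv : ∀ x, Tendsto (fun n => u n x) atTop (𝓝 (U x)) := fun x => by
      obtain ⟨C, hC0, hC⟩ := exists_norm_solution_le hV w (abs_nonneg x)
      rw [tendsto_iff_norm_sub_tendsto_zero]
      have hbd : ∀ n, ‖u n x - U x‖ ≤ C * (‖u n 0 - α‖ + ‖deriv (u n) 0 - β‖ +
          Real.sqrt (2 * |x|) * ‖F n - f‖) := fun n => by
        have hs : SolvesSchrodinger V (u n - U) (fun x => w * (u n - U) x + (F n - f : L2R) x) := by
          refine ((hsol n).solves.sub hU).congr_right ?_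
          filter_upwards [Lp.coeFn_sub (F n) f] with x hx
          simp only [Pi.sub_apply, hx]; ring
        have hd : deriv (u n - U) 0 = deriv (u n) 0 - deriv U 0 :=
          (((hsol n).solves.hasDerivAt 0).sub (hU.hasDerivAt 0)).deriv
        have h1 := (hC _ _ (locallyIntegrable_coe _) hs x ⟨neg_abs_le x, le_abs_self x⟩).1
        rw [hd, Pi.sub_apply, Pi.sub_apply, hU0, hU1] at h1
        refine h1.trans (mul_le_mul_of_nonneg_left ?_ hC0)
        gcongr
        exact integral_norm_le_sqrt_mul _ (abs_nonneg x)
      refine squeeze_zero (fun _ => norm_nonneg _) hbd ?_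
      have h1 := tendsto_iff_norm_sub_tendsto_zero.1 hα'
      have h2 := tendsto_iff_norm_sub_tendsto_zero.1 hβ'
      have h3 := tendsto_iff_norm_sub_tendsto_zero.1 hF
      simpa using ((h1.add h2).add (h3.const_mul (Real.sqrt (2 * |x|)))).const_mul C
    have hae : φl =ᵐ[volume] U := by
      obtain ⟨ns, hns, hlim⟩ := (tendstoInMeasure_of_tendsto_Lp hφ).exists_seq_tendsto_ae
      filter_upwards [hlim, ae_all_iff.2 fun n => (hsol n).ae_eq] with x hx hx'
      refine tendsto_nhds_unique hx ?_
      simp_rw [hx']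
      exact (hconv x).comp hns.tendsto_atTop
    refine ⟨U, φl, ⟨hae, hU⟩, ?_, ?_, ?_⟩
    · exact le_of_tendsto_of_tendsto' (hφ.norm.const_mul _) hF.norm hnorm
    · rw [hU0, hU1, hβ]; ring
    · rw [hU0, hU1, hβ, hα]; field_simp; ring
  refine ⟨⟨mp, mm, A, B, hmp, hmm, hAn.trans_le hpn, hBn.trans_le hmn, ?_, fun f => ?_,
    fun u φ f h => ?_, fun u φ f h => ?_, fun u φ f h => ?_⟩⟩
  -- A and B live on disjoint half-lines. This orthogonality is what later decouples the two
  -- spectral measures.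
  · rw [hAi]
    refine setIntegral_eq_zero_of_ae_eq_zero ?_
    filter_upwards [hB] with x hx h0
    have h1 : x ∉ Iio (0 : ℝ) := fun h : x < 0 => lt_asymm h h0
    rw [hx, indicator_of_notMem h1, zero_mul]
  · obtain ⟨u, φ, h, -⟩ := hall f
    exact ⟨u, φ, h⟩
  all_goals
    obtain ⟨u', φ', h', hn, i1, i2⟩ := hall f
    obtain ⟨rfl, rfl⟩ := huniq h h'
    assumption

end WeylData

-- Self-adjointness from solvability and the resolvent bound

section Resolvent

variable {E : Type*} [NormedAddCommGroup E] [InnerProductSpace ℂ E]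

/-- `R z = (A - z)⁻¹` for all nonreal `z`, with `(R z)† = R (conj z)`. -/
structure IsResolventFamily (A : E →ₗ.[ℂ] E) (R : ℂ → E →L[ℂ] E) : Prop where
  iff : ∀ {z : ℂ}, z.im ≠ 0 → ∀ {ψ φ : E}, IsResolventOf A z ψ φ ↔ R z ψ = φ
  inner_left : ∀ {z : ℂ}, z.im ≠ 0 → ∀ x y : E,
    (inner ℂ (R z x) y : ℂ) = inner ℂ x (R (conj z) y)

variable {A : E →ₗ.[ℂ] E}

theorem isResolventOf_apply {z : ℂ} (x : A.domain) : IsResolventOf A z (A x - z • (x : E)) x :=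
  ⟨x.2, rfl⟩

theorem IsResolventOf.add {z : ℂ} {ψ φ ψ' φ' : E} (h : IsResolventOf A z ψ φ)
    (h' : IsResolventOf A z ψ' φ') : IsResolventOf A z (ψ + ψ') (φ + φ') := by
  obtain ⟨hd, rfl⟩ := h
  obtain ⟨hd', rfl⟩ := h'
  refine ⟨A.domain.add_mem hd hd', ?_⟩
  have : A ⟨φ + φ', A.domain.add_mem hd hd'⟩ = A ⟨φ, hd⟩ + A ⟨φ', hd'⟩ :=
    A.map_add ⟨φ, hd⟩ ⟨φ', hd'⟩
  rw [this, smul_add]; abel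

theorem IsResolventOf.smul {z : ℂ} {ψ φ : E} (h : IsResolventOf A z ψ φ) (c : ℂ) :
    IsResolventOf A z (c • ψ) (c • φ) := by
  obtain ⟨hd, rfl⟩ := h
  refine ⟨A.domain.smul_mem c hd, ?_⟩
  have : A ⟨c • φ, A.domain.smul_mem c hd⟩ = c • A ⟨φ, hd⟩ := A.map_smul c ⟨φ, hd⟩
  rw [this, smul_sub, smul_comm]

theorem IsResolventOf.shift {z w : ℂ} {ψ φ : E} (h : IsResolventOf A z ψ φ) :
    IsResolventOf A w (ψ + (z - w) • φ) φ := by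
  obtain ⟨hd, rfl⟩ := h
  refine ⟨hd, ?_⟩
  rw [sub_smul]; abel

/-- Squaring ‖Ax - iyx‖ ≥ |y|‖x‖ leaves ‖Ax‖² + 2y Im⟨Ax, x⟩ ≥ 0 for all real y ≠ 0, which fails for
suitable y unless the imaginary part vanishes. -/
theorem im_inner_eq_zero
    (hb : ∀ z : ℂ, z.im ≠ 0 → ∀ ψ φ, IsResolventOf A z ψ φ → |z.im| * ‖φ‖ ≤ ‖ψ‖) (x : A.domain) :
    (inner ℂ (A x) (x : E) : ℂ).im = 0 := by
  set c : ℂ := inner ℂ (A x) (x : E) with hc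
  have key : ∀ y : ℝ, y ≠ 0 → 0 ≤ ‖A x‖ ^ 2 + 2 * y * c.im := fun y hy => by
    have h1 := hb (y * Complex.I) (by simpa using hy) _ _ (isResolventOf_apply x)
    have h2 := mul_self_le_mul_self (by positivity) h1
    have h3 := norm_sub_sq (𝕜 := ℂ) (A x) (((y : ℂ) * Complex.I) • (x : E))
    rw [inner_smul_right, ← hc] at h3
    have h4 : RCLike.re ((y : ℂ) * Complex.I * c) = -(y * c.im) := by simp
    have h5 : ‖((y : ℂ) * Complex.I) • (x : E)‖ = |y| * ‖(x : E)‖ := by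
      rw [norm_smul]; simp
    rw [h4, h5] at h3
    simp only [Complex.mul_im, Complex.ofReal_re, Complex.I_im, Complex.ofReal_im,
      Complex.I_re, mul_one, mul_zero, add_zero] at h2
    nlinarith
  by_contra hne
  set N := ‖A x‖ ^ 2 with hN
  have hN0 : 0 ≤ N := by positivity
  have := key (-(N + 1) / (2 * c.im)) (div_ne_zero (by linarith) (by simpa using hne))
  have e : 2 * (-(N + 1) / (2 * c.im)) * c.im = -(N + 1) := by field_simp
  linarith

/-- Polarization: reality of the quadratic form at x + y and at x + iy. -/
theorem inner_symm_of_bound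
    (hb : ∀ z : ℂ, z.im ≠ 0 → ∀ ψ φ, IsResolventOf A z ψ φ → |z.im| * ‖φ‖ ≤ ‖ψ‖)
    (x y : A.domain) : (inner ℂ (A x) (y : E) : ℂ) = inner ℂ (x : E) (A y) := by
  have h0 : ∀ x : A.domain, (inner ℂ (A x) (x : E) : ℂ) = inner ℂ (x : E) (A x) := fun x => by
    have := im_inner_eq_zero hb x
    rw [← inner_conj_symm (x : E) (A x)]
    exact (Complex.conj_eq_iff_im.2 this).symm
  have h1 := h0 (x + y)
  have h2 := h0 (x + Complex.I • y)
  simp only [LinearPMap.map_add, LinearPMap.map_smul, Submodule.coe_add, Submodule.coe_smul,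
    inner_add_left, inner_add_right, inner_smul_left, inner_smul_right, h0, Complex.conj_I] at h1 h2
  have h3 : (inner ℂ (A x) (y : E) : ℂ) - inner ℂ (x : E) (A y) +
      (inner ℂ (A y) (x : E) - inner ℂ (y : E) (A x)) = 0 := by linear_combination h1
  have h4 : (inner ℂ (A x) (y : E) : ℂ) - inner ℂ (x : E) (A y) -
      (inner ℂ (A y) (x : E) - inner ℂ (y : E) (A x)) = 0 := by
    have hI : Complex.I * ((inner ℂ (A x) (y : E) : ℂ) - inner ℂ (x : E) (A y) -
      (inner ℂ (A y) (x : E) - inner ℂ (y : E) (A x))) = 0 := by linear_combination h2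
    simpa using hI
  linear_combination (h3 + h4) / 2

variable (hs : ∀ z : ℂ, z.im ≠ 0 → ∀ ψ, ∃ φ, IsResolventOf A z ψ φ)
  (hb : ∀ z : ℂ, z.im ≠ 0 → ∀ ψ φ, IsResolventOf A z ψ φ → |z.im| * ‖φ‖ ≤ ‖ψ‖)

include hs hb

theorem exists_isResolventFamily : ∃ R : ℂ → E →L[ℂ] E, IsResolventFamily A R := by
  have huniq : ∀ {z : ℂ}, z.im ≠ 0 → ∀ {ψ φ φ'}, IsResolventOf A z ψ φ →
      IsResolventOf A z ψ φ' → φ = φ' := fun {z} hz {ψ φ φ'} h h' => by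
    have h1 := h.add (h'.smul (-1))
    rw [neg_one_smul, neg_one_smul, add_neg_cancel] at h1
    have h2 := hb z hz _ _ h1
    rw [norm_zero] at h2
    have h3 : 0 < |z.im| := abs_pos.2 hz
    have h4 : ‖φ + -φ'‖ ≤ 0 := by
      by_contra hcon
      have := mul_pos h3 (not_le.1 hcon)
      linarith
    exact (eq_of_sub_eq_zero (by rw [sub_eq_add_neg]; exact norm_le_zero_iff.1 h4))
  have hR : ∀ z : ℂ, ∃ Rz : E →L[ℂ] E, z.im ≠ 0 → ∀ ψ, IsResolventOf A z ψ (Rz ψ) := fun z => by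
    by_cases hz : z.im = 0
    · exact ⟨0, fun h => absurd hz h⟩
    choose r hr using hs z hz
    refine ⟨LinearMap.mkContinuous
      { toFun := r
        map_add' := fun x y => huniq hz (hr _) ((hr x).add (hr y))
        map_smul' := fun c x => huniq hz (hr _) ((hr x).smul c) } |z.im|⁻¹ fun x => ?_,
      fun _ ψ => hr ψ⟩
    have h3 : 0 < |z.im| := abs_pos.2 hz
    rw [← div_eq_inv_mul, le_div_iff₀ h3, mul_comm]
    exact hb z hz _ _ (hr x)
  choose R hR using hR
  refine ⟨R, fun {z} hz ψ φ => ⟨fun h => huniq hz (hR z hz ψ) h, fun h => h ▸ hR z hz ψ⟩,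
    fun {z} hz x y => ?_⟩
  have hz' : (conj z).im ≠ 0 := by simpa using hz
  obtain ⟨hu, e⟩ := hR z hz x
  obtain ⟨hv, e'⟩ := hR (conj z) hz' y
  have := inner_symm_of_bound hb ⟨_, hu⟩ ⟨_, hv⟩
  conv_lhs => rw [← e']
  conv_rhs => rw [← e]
  rw [inner_sub_right, inner_sub_left, this, inner_smul_left, inner_smul_right]

/-- A vector f orthogonal to the domain, the range of R i, is annihilated by the adjoint R(-i); then
f = (A + i)0 = 0. -/
theorem dense_domain_of_resolvent [CompleteSpace E] : Dense (A.domain : Set E) := by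
  obtain ⟨R, hR⟩ := exists_isResolventFamily hs hb
  rw [Submodule.dense_iff_topologicalClosure_eq_top, Submodule.topologicalClosure_eq_top_iff,
    Submodule.eq_bot_iff]
  intro f hf
  have hI : (Complex.I).im ≠ 0 := by simp
  have hI' : (conj Complex.I).im ≠ 0 := by simp
  have h0 : R (conj Complex.I) f = 0 := by
    refine ext_inner_left ℂ fun x => ?_
    rw [← hR.inner_left hI, inner_zero_right]
    exact hf _ ((hR.iff hI).2 (rfl : R Complex.I x = _)).1
  obtain ⟨hd, e⟩ := (hR.iff hI').2 h0
  rw [← e, smul_zero, sub_zero]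
  exact A.map_zero

/-- For y in the domain of A†, solve (A - i)u = (A† - i)y. Then y - u is orthogonal to the range of
A + i, which is everything, so y = u lies in the domain of A. -/
theorem isSelfAdjoint_of_resolvent [CompleteSpace E] : IsSelfAdjoint A := by
  have hd := dense_domain_of_resolvent hs hb
  have hle : A ≤ A.adjoint :=
    LinearPMap.IsFormalAdjoint.le_adjoint hd fun x y => inner_symm_of_bound hb x y
  rw [LinearPMap.isSelfAdjoint_def]
  refine (LinearPMap.eq_of_le_of_domain_eq hle (le_antisymm hle.1 fun y hy => ?_)).symm
  obtain ⟨u, hu, e⟩ := hs Complex.I (by simp) (A.adjoint ⟨y, hy⟩ - Complex.I • y)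
  suffices h : y - u = 0 by rw [sub_eq_zero.1 h]; exact hu
  refine ext_inner_right ℂ fun v => ?_
  obtain ⟨x, hx, rfl⟩ := hs (-Complex.I) (by simp) v
  have h1 := LinearPMap.adjoint_isFormalAdjoint hd ⟨y, hy⟩ ⟨x, hx⟩
  have h2 := inner_symm_of_bound hb ⟨u, hu⟩ ⟨x, hx⟩
  have h3 : A.adjoint ⟨y, hy⟩ = A ⟨u, hu⟩ - Complex.I • u + Complex.I • y := by rw [e]; abel
  rw [h3, inner_add_left, inner_sub_left, inner_smul_left, inner_smul_left, h2] at h1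
  simp only [Complex.conj_I] at h1
  rw [inner_zero_left, inner_sub_left, inner_sub_right, inner_sub_right, inner_smul_right,
    inner_smul_right]
  linear_combination -h1

end Resolvent

-- Cyclic representations via the bounded normal operator (A - i)⁻¹

section CyclicRepresentation

variable {E : Type*} [NormedAddCommGroup E] [InnerProductSpace ℂ E] [CompleteSpace E]

/-- The scalar spectral measure of a `*`-representation of `C(X)`. -/
theorem exists_measure_of_starAlgHom {X : Type*} [TopologicalSpace X] [CompactSpace X] [T2Space X]
    [MeasurableSpace X] [BorelSpace X] (Φ : C(X, ℂ) →⋆ₐ[ℂ] (E →L[ℂ] E)) (g : E) :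
    ∃ μ : Measure X, IsFiniteMeasure μ ∧ μ.Regular ∧
      ∀ f : C(X, ℂ), ∫ x, ‖f x‖ ^ 2 ∂μ = ‖Φ f g‖ ^ 2 := by
  let c : C(X, ℝ) → C(X, ℂ) := fun f => ⟨fun x => (f x : ℂ), by fun_prop⟩
  have hinner : ∀ f : C(X, ℂ), (inner ℂ g (Φ (star f * f) g) : ℂ) = (‖Φ f g‖ : ℂ) ^ 2 := fun f => by
    rw [map_mul, map_star, mul_apply_eq_comp, ContinuousLinearMap.star_eq_adjoint,
      ContinuousLinearMap.adjoint_inner_right, inner_self_eq_norm_sq_to_K]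
    rfl
  -- This functional is positive since a nonnegative f equals star s * s with s = √f; the
  -- Riesz–Markov–Kakutani theorem represents it by a measure.
  let L : CompactlySupportedContinuousMap X ℝ →ₗ[ℝ] ℝ :=
    { toFun := fun f => (inner ℂ g (Φ (c f.toContinuousMap) g) : ℂ).re
      map_add' := fun f f' => by
        have : c (f + f').toContinuousMap = c f.toContinuousMap + c f'.toContinuousMap := by
          ext x; simp [c]
        rw [this]; simp
      map_smul' := fun a f => by
        have : c (a • f).toContinuousMap = (a : ℂ) • c f.toContinuousMap := by
          ext x; simp [c]
        rw [this, map_smul]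
        change (inner ℂ g ((a : ℂ) • Φ (c f.toContinuousMap) g) : ℂ).re = _
        rw [inner_smul_right, Complex.re_ofReal_mul]
        rfl }
  have hpos : ∀ f : CompactlySupportedContinuousMap X ℝ, 0 ≤ f → 0 ≤ L f := fun f hf => by
    let s : C(X, ℂ) := ⟨fun x => ((Real.sqrt (f x) : ℝ) : ℂ), by
      have := f.toContinuousMap.continuous
      exact Complex.continuous_ofReal.comp (Real.continuous_sqrt.comp this)⟩
    have e : c f.toContinuousMap = star s * s := by
      ext x
      have h0 : 0 ≤ f x := hf x
      simp only [c, s, ContinuousMap.coe_mk, ContinuousMap.mul_apply, ContinuousMap.star_apply]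
      rw [RCLike.star_def, Complex.conj_ofReal, ← Complex.ofReal_mul, Real.mul_self_sqrt h0]
      rfl
    change 0 ≤ (inner ℂ g (Φ (c f.toContinuousMap) g) : ℂ).re
    rw [e, hinner]
    norm_cast
    positivity
  let Λ := PositiveLinearMap.mk₀ L hpos
  refine ⟨RealRMK.rieszMeasure Λ, inferInstance, inferInstance, fun f => ?_⟩
  let q : CompactlySupportedContinuousMap X ℝ :=
    ⟨⟨fun x => ‖f x‖ ^ 2, by fun_prop⟩, HasCompactSupport.of_compactSpace _⟩
  have h1 := RealRMK.integral_rieszMeasure Λ q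
  have e : c q.toContinuousMap = star f * f := by
    ext x
    simp only [c, q, ContinuousMap.coe_mk, ContinuousMap.mul_apply, ContinuousMap.star_apply]
    rw [RCLike.star_def, ← Complex.normSq_eq_conj_mul_self, Complex.normSq_eq_norm_sq]
  have h2 : Λ q = ‖Φ f g‖ ^ 2 := by
    change (inner ℂ g (Φ (c q.toContinuousMap) g) : ℂ).re = _
    rw [e, hinner]
    norm_cast
  rw [← h2, ← h1]
  rfl

/-- The cyclic representation of a vector for a `*`-representation of `C(X)`. -/
theorem exists_cyclic_isometry {X : Type*} [TopologicalSpace X] [CompactSpace X] [T2Space X]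
    [MeasurableSpace X] [BorelSpace X] (Φ : C(X, ℂ) →⋆ₐ[ℂ] (E →L[ℂ] E)) (g : E) :
    ∃ (μ : Measure X) (_ : IsFiniteMeasure μ) (T : Lp ℂ 2 μ →ₗᵢ[ℂ] E),
      (∀ k : Lp ℂ 2 μ, k =ᵐ[μ] (fun _ => (1 : ℂ)) → T k = g) ∧
      ∀ (r : C(X, ℂ)) (h k : Lp ℂ 2 μ), k =ᵐ[μ] (fun x => r x * h x) → T k = Φ r (T h) := by
  obtain ⟨μ, hfin, hreg, hμ⟩ := exists_measure_of_starAlgHom Φ g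
  let e : C(X, ℂ) →L[ℂ] Lp ℂ 2 μ := ContinuousMap.toLp 2 μ ℂ
  let F : C(X, ℂ) →ₗ[ℂ] E :=
    { toFun := fun f => Φ f g
      map_add' := fun f f' => by simp
      map_smul' := fun a f => by simp }
  -- The orbit map f ↦ Φ f g is isometric for the L²(μ) norm, so it extends from the dense image of
  -- C(X).
  have hnorm : ∀ f, ‖F f‖ = ‖e f‖ := fun f => by
    have h1 : ‖e f‖ ^ 2 = ‖F f‖ ^ 2 := by
      rw [norm_sq_eq_integral]
      refine Eq.trans (integral_congr_ae ?_) (hμ f)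
      filter_upwards [ContinuousMap.coeFn_toLp (p := 2) (𝕜 := ℂ) μ f] with x hx
      exact congrArg (fun y : ℂ => ‖y‖ ^ 2) hx
    exact ((sq_eq_sq₀ (norm_nonneg _) (norm_nonneg _)).1 h1).symm
  have hdense : DenseRange e := ContinuousMap.toLp_denseRange ℂ μ (𝕜 := ℂ) (by norm_num)
  have hbd : ∃ C, ∀ f, ‖F f‖ ≤ C * ‖(e : C(X, ℂ) →ₗ[ℂ] Lp ℂ 2 μ) f‖ :=
    ⟨1, fun f => by rw [one_mul]; exact (hnorm f).le⟩
  let T0 := F.extendOfNorm (e : C(X, ℂ) →ₗ[ℂ] Lp ℂ 2 μ)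
  have hT0 : ∀ f, T0 (e f) = Φ f g := fun f => LinearMap.extendOfNorm_eq hdense hbd f
  have hT0n : ∀ h, ‖T0 h‖ = ‖h‖ := fun h =>
    hdense.induction_on (p := fun h => ‖T0 h‖ = ‖h‖) h
      (isClosed_eq T0.continuous.norm continuous_norm) fun f => by rw [hT0]; exact hnorm f
  refine ⟨μ, hfin, ⟨T0, hT0n⟩, fun k hk => ?_, fun r h k hk => ?_⟩
  · have : k = e 1 := by
      refine Lp.ext (hk.trans ?_)
      exact (ContinuousMap.coeFn_toLp (p := 2) (𝕜 := ℂ) μ (1 : C(X, ℂ))).symm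
    change T0 k = g
    rw [this, hT0]; simp
  · change T0 k = Φ r (T0 h)
    rw [← sub_eq_zero, ← norm_eq_zero]
    refine le_antisymm (le_of_forall_pos_le_add fun ε hε => ?_) (norm_nonneg _)
    have hc : 0 < ‖r‖ + ‖Φ r‖ + 1 := by positivity
    obtain ⟨f, hf⟩ := hdense.exists_dist_lt h (div_pos hε hc)
    rw [dist_eq_norm] at hf
    have h1 : ‖k - e (r * f)‖ ≤ ‖r‖ * ‖h - e f‖ := by
      refine Lp.norm_le_mul_norm_of_ae_le_mul ?_
      filter_upwards [Lp.coeFn_sub k (e (r * f)), Lp.coeFn_sub h (e f), hk,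
        ContinuousMap.coeFn_toLp (p := 2) (𝕜 := ℂ) μ (r * f),
        ContinuousMap.coeFn_toLp (p := 2) (𝕜 := ℂ) μ f] with x h1 h2 h3 h4 h5
      have h4' : e (r * f) x = r x * f x := h4
      have h5' : e f x = f x := h5
      rw [h1, h2, Pi.sub_apply, Pi.sub_apply, h3, h4', h5', ← mul_sub, norm_mul]
      gcongr
      exact r.norm_coe_le_norm x
    have h2 : T0 k - Φ r (T0 h) = T0 (k - e (r * f)) - Φ r (T0 (h - e f)) := by
      rw [map_sub, map_sub, map_sub, hT0, hT0, map_mul, mul_apply_eq_comp]; abel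
    rw [h2, zero_add]
    calc _ ≤ ‖T0 (k - e (r * f))‖ + ‖Φ r (T0 (h - e f))‖ := norm_sub_le _ _
      _ ≤ ‖r‖ * ‖h - e f‖ + ‖Φ r‖ * ‖h - e f‖ := by
        gcongr
        · rw [hT0n]; exact h1
        · exact (Φ r).le_opNorm_of_le (hT0n _).le
      _ ≤ (‖r‖ + ‖Φ r‖ + 1) * (ε / (‖r‖ + ‖Φ r‖ + 1)) := by
        rw [← add_mul]
        exact mul_le_mul (by linarith) hf.le (norm_nonneg _) hc.le
      _ = ε := by field_simp

variable {A : E →ₗ.[ℂ] E} {R : ℂ → E →L[ℂ] E}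

omit [CompleteSpace E] in
theorem IsResolventFamily.apply_sub (hR : IsResolventFamily A R) {z w : ℂ} (hz : z.im ≠ 0)
    (hw : w.im ≠ 0) (x : E) : R z x - R w x = (z - w) • R z (R w x) := by
  have h := ((hR.iff hw).2 (rfl : R w x = _)).shift (w := z)
  have h1 := (hR.iff hz).1 h
  rw [map_add, map_smul] at h1
  generalize R z (R w x) = y at h1 ⊢
  rw [← h1]
  module

/-- The cyclic representation of a vector for a self-adjoint operator. -/
theorem IsResolventFamily.exists_spectral_representation (hR : IsResolventFamily A R) (g : E) :
    ∃ (μ : Measure ℝ) (_ : IsFiniteMeasure μ) (T : Lp ℂ 2 μ →ₗᵢ[ℂ] E),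
      (∀ k : Lp ℂ 2 μ, k =ᵐ[μ] (fun _ => (1 : ℂ)) → T k = g) ∧
      ∀ z : ℂ, z.im ≠ 0 → ∀ h k : Lp ℂ 2 μ, (∀ᵐ t : ℝ ∂μ, ((t : ℂ) - z) * k t = h t) →
        R z (T h) = T k := by
  have hI : (Complex.I).im ≠ 0 := by simp
  have hI' : (-Complex.I).im ≠ 0 := by simp
  set B := R Complex.I with hB
  have hstar : star B = R (-Complex.I) := by
    rw [ContinuousLinearMap.star_eq_adjoint, eq_comm, ContinuousLinearMap.eq_adjoint_iff]
    intro x y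
    rw [hR.inner_left hI']; simp [hB]
  -- The resolvent identity between i and -i, taken in both orders, shows that B is normal and that
  -- its spectrum lies on the circle x - x̄ = 2i|x|², the image of ℝ ∪ {∞} under t ↦ (t - i)⁻¹.
  have e1 : B - star B = (2 * Complex.I) • (star B * B) := by
    ext x
    have := hR.apply_sub hI' hI x
    simp only [hstar, sub_apply, smul_apply,
      mul_apply_eq_comp]
    rw [← neg_sub, hB, this, ← neg_smul]; congr 1; ring
  have e2 : B - star B = (2 * Complex.I) • (B * star B) := by
    ext x
    have := hR.apply_sub hI hI' x
    simp only [hstar, sub_apply, smul_apply,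
      mul_apply_eq_comp]
    rw [hB, this]; congr 1; ring
  have hnormal : IsStarNormal B := ⟨by
    have : (2 * Complex.I) • (star B * B) = (2 * Complex.I) • (B * star B) := e1.symm.trans e2
    exact smul_right_injective _ (by simp : (2 * Complex.I) ≠ 0) this⟩
  set Φ := cfcHom (R := ℂ) hnormal
  set ι : C(spectrum ℂ B, ℂ) := (ContinuousMap.id ℂ).restrict (spectrum ℂ B) with hι
  have hΦ : Φ ι = B := cfcHom_id (R := ℂ) hnormal
  have hcircle : ∀ x : spectrum ℂ B, (x : ℂ) - conj (x : ℂ) = 2 * Complex.I * (conj (x : ℂ) * x) := by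
    have h1 : ι - star ι = (2 * Complex.I) • (star ι * ι) := by
      refine (cfcHom_isClosedEmbedding (R := ℂ) hnormal).injective ?_
      change Φ _ = Φ _
      rw [map_sub, map_smul, map_mul, map_star, hΦ, e1]
    intro x
    exact congrArg (fun f : C(spectrum ℂ B, ℂ) => f x) h1
  obtain ⟨ν, hν, T, hT1, hTr⟩ := exists_cyclic_isometry Φ g
  have hinj : ∀ x, B x = 0 → x = 0 := fun x hx => by
    obtain ⟨hd, e⟩ := (hR.iff hI).2 hx
    rw [← e, smul_zero, sub_zero]
    exact A.map_zero
  -- The point 0 corresponds to t = ∞. It has no mass: its indicator would be sent to a vector in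
  -- the kernel of B, and B is injective.
  have hatom : ∀ᵐ x : spectrum ℂ B ∂ν, (x : ℂ) ≠ 0 := by
    have hm : MeasurableSet {x : spectrum ℂ B | (x : ℂ) = 0} :=
      (isClosed_singleton.preimage continuous_subtype_val).measurableSet
    set k : Lp ℂ 2 ν := indicatorConstLp 2 hm (measure_ne_top ν _) 1
    have hk : (0 : Lp ℂ 2 ν) =ᵐ[ν] fun x => ι x * k x := by
      filter_upwards [Lp.coeFn_zero ℂ 2 ν, indicatorConstLp_coeFn (p := 2) (hs := hm)
        (hμs := measure_ne_top ν _) (c := (1 : ℂ))] with x h0 h1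
      rw [h0, h1]
      by_cases hx : (x : ℂ) = 0
      · simp [hι, hx]
      · simp [hx]
    have h1 := hTr ι k 0 hk
    rw [hΦ, map_zero] at h1
    have h2 := hinj _ h1.symm
    have h3 : k = 0 := T.injective (by rw [h2, map_zero])
    have h4 : k =ᵐ[ν] 0 := by rw [h3]; exact Lp.coeFn_zero ℂ 2 ν
    filter_upwards [h4, indicatorConstLp_coeFn (p := 2) (hs := hm)
        (hμs := measure_ne_top ν _) (c := (1 : ℂ))] with x h5 h6 hx
    rw [h5] at h6
    simp [hx] at h6
  -- θ inverts t ↦ (t - i)⁻¹: off 0 the circle equation says that 1/x + i is real.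
  set θ : spectrum ℂ B → ℝ := fun x => ((x : ℂ)⁻¹).re with hθ
  have hθm : Measurable θ := Complex.measurable_re.comp (measurable_subtype_coe.inv)
  have hθx : ∀ x : spectrum ℂ B, (x : ℂ) ≠ 0 → (x : ℂ) * ((θ x : ℂ) - Complex.I) = 1 :=
    fun x hx => by
      have h1 := hcircle x
      have hx' : conj (x : ℂ) ≠ 0 := by simpa using hx
      have h2 : (x : ℂ)⁻¹ - conj ((x : ℂ)⁻¹) = -(2 * Complex.I) := by
        rw [map_inv₀]
        field_simp
        linear_combination -h1
      have h3 : (θ x : ℂ) = (x : ℂ)⁻¹ + Complex.I := by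
        have h4 := Complex.re_eq_add_conj ((x : ℂ)⁻¹)
        rw [hθ]
        simp only
        rw [h4]
        linear_combination -h2 / 2
      rw [h3, add_sub_cancel_right, mul_inv_cancel₀ hx]
  have hmp : MeasurePreserving θ ν (ν.map θ) := ⟨hθm, rfl⟩
  let P : Lp ℂ 2 (ν.map θ) →ₗᵢ[ℂ] Lp ℂ 2 ν := Lp.compMeasurePreservingₗᵢ ℂ θ hmp
  have hP : ∀ k, P k =ᵐ[ν] k ∘ θ := fun k => Lp.coeFn_compMeasurePreserving k hmp
  refine ⟨ν.map θ, Measure.isFiniteMeasure_map ν θ, T.comp P, fun k hk => ?_,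
    fun z hz h k hhk => ?_⟩
  · refine hT1 _ ((hP k).trans ?_)
    exact hmp.quasiMeasurePreserving.ae_eq_comp hk
  -- From (t - z)k = h follows (t - i)k = h + (z - i)k, which expresses k through multiplication by
  -- ι; the shift then returns from i to z.
  · have h1 : P k =ᵐ[ν] fun x => ι x * (P (h + (z - Complex.I) • k) : Lp ℂ 2 ν) x := by
      have a1 := hmp.quasiMeasurePreserving.ae hhk
      have a2 := hmp.quasiMeasurePreserving.ae (Lp.coeFn_add h ((z - Complex.I) • k))
      have a3 := hmp.quasiMeasurePreserving.ae (Lp.coeFn_smul (z - Complex.I) k)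
      filter_upwards [hatom, a1, a2, a3, hP k, hP (h + (z - Complex.I) • k)] with x b0 b1 b2 b3 b4 b5
      rw [b4, b5, Function.comp_apply, Function.comp_apply, b2, Pi.add_apply, b3, Pi.smul_apply,
        ← b1, smul_eq_mul]
      have : ι x = (x : ℂ) := rfl
      rw [this]
      linear_combination -(k (θ x)) * hθx x b0
    have h2 := hTr ι _ _ h1
    rw [hΦ] at h2
    have h3 := ((hR.iff hI).2 h2.symm).shift (w := z)
    have h4 := (hR.iff hz).1 h3
    simp only [map_add, map_smul] at h4
    change R z (T (P h)) = T (P k)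
    refine Eq.trans ?_ h4
    module

end CyclicRepresentation

-- Uniqueness for Stieltjes transforms

section Stieltjes

variable {μ : Measure ℝ}

theorem abs_im_le_norm_sub (t : ℝ) (z : ℂ) : |z.im| ≤ ‖(t : ℂ) - z‖ := by
  have := Complex.abs_im_le_norm ((t : ℂ) - z)
  simpa using this

theorem ofReal_sub_ne_zero (t : ℝ) {z : ℂ} (hz : z.im ≠ 0) : (t : ℂ) - z ≠ 0 := fun h => by
  have := abs_im_le_norm_sub t z
  rw [h, norm_zero] at this
  exact hz (abs_nonpos_iff.1 this)

theorem norm_inv_sub_le (t : ℝ) {z : ℂ} (hz : z.im ≠ 0) : ‖((t : ℂ) - z)⁻¹‖ ≤ |z.im|⁻¹ := by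
  rw [norm_inv]
  exact inv_anti₀ (abs_pos.2 hz) (abs_im_le_norm_sub t z)

theorem measurable_inv_sub (z : ℂ) : Measurable fun t : ℝ => ((t : ℂ) - z)⁻¹ :=
  (Complex.measurable_ofReal.sub_const z).inv

theorem integrable_inv_sub_mul {κ : ℝ → ℂ} (hκ : Integrable κ μ) {z : ℂ} (hz : z.im ≠ 0) :
    Integrable (fun t : ℝ => ((t : ℂ) - z)⁻¹ * κ t) μ :=
  hκ.bdd_mul (c := |z.im|⁻¹) (measurable_inv_sub z).aestronglyMeasurable
    (Eventually.of_forall fun t => norm_inv_sub_le t hz)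

theorem poisson_kernel_eq (t x : ℝ) {y : ℝ} (hy : 0 < y) :
    (((y / ((x - t) ^ 2 + y ^ 2) : ℝ)) : ℂ) =
      (2 * Complex.I)⁻¹ * (((t : ℂ) - (x + y * Complex.I))⁻¹ - ((t : ℂ) - (x - y * Complex.I))⁻¹) := by
  have h1 : (t : ℂ) - (x + y * Complex.I) ≠ 0 := ofReal_sub_ne_zero t (by simpa using hy.ne')
  have h2 : (t : ℂ) - (x - y * Complex.I) ≠ 0 := ofReal_sub_ne_zero t (by simpa using hy.ne')
  have h3 : ((x : ℂ) - t) ^ 2 + (y : ℂ) ^ 2 ≠ 0 := by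
    have : (x - t) ^ 2 + y ^ 2 ≠ 0 := by positivity
    exact_mod_cast this
  push_cast
  field_simp
  linear_combination (-2 * Complex.I * y ^ 3) * Complex.I_sq

/-- A complex measure is determined by its Stieltjes transform off the real axis. -/
theorem ae_eq_zero_of_stieltjes_eq_zero [IsFiniteMeasure μ] {κ : ℝ → ℂ} (hκ : Integrable κ μ)
    (h : ∀ z : ℂ, z.im ≠ 0 → ∫ t : ℝ, ((t : ℂ) - z)⁻¹ * κ t ∂μ = 0) : κ =ᵐ[μ] 0 := by
  refine ae_eq_zero_of_integral_contDiff_smul_eq_zero hκ.locallyIntegrable fun φ hφ hφc => ?_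
  have hcont : Continuous φ := hφ.continuous
  obtain ⟨M, hM⟩ := hφc.exists_bound_of_continuous hcont
  have hpoisson : ∀ x y : ℝ, 0 < y → ∫ t, ((y / ((x - t) ^ 2 + y ^ 2) : ℝ) : ℂ) * κ t ∂μ = 0 :=
    fun x y hy => by
      have i1 := integrable_inv_sub_mul hκ (z := x + y * Complex.I) (by simpa using hy.ne')
      have i2 := integrable_inv_sub_mul hκ (z := x - y * Complex.I) (by simpa using hy.ne')
      have e : (fun t => ((y / ((x - t) ^ 2 + y ^ 2) : ℝ) : ℂ) * κ t) = fun t : ℝ =>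
          (2 * Complex.I)⁻¹ * (((t : ℂ) - (x + y * Complex.I))⁻¹ * κ t -
            ((t : ℂ) - (x - y * Complex.I))⁻¹ * κ t) := by
        funext t
        rw [poisson_kernel_eq t x hy]; ring
      rw [e, integral_const_mul, integral_sub i1 i2, h _ (by simpa using hy.ne'),
        h _ (by simpa using hy.ne')]
      simp
  -- P y is π times the Poisson mean of φ at height y, written with x = t + ys so that y → 0 is a
  -- dominated limit. By Fubini it pairs to zero with κ for every y > 0, hence so does φ.
  let P : ℝ → ℝ → ℝ := fun y t => ∫ s, φ (t + y * s) * (1 + s ^ 2)⁻¹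
  have hP : ∀ y, 0 < y → ∀ t, P y t = ∫ x, φ x * (y / ((x - t) ^ 2 + y ^ 2)) := fun y hy t => by
    have e1 : P y t = ∫ s, (fun x => (fun x => y * (φ x * (y / ((x - t) ^ 2 + y ^ 2)))) (t + x))
        (y * s) := by
      refine integral_congr_ae (Eventually.of_forall fun s => ?_)
      simp only [add_sub_cancel_left]
      field_simp
      ring
    rw [e1, Measure.integral_comp_mul_left
      (fun x => (fun x => y * (φ x * (y / ((x - t) ^ 2 + y ^ 2)))) (t + x)), integral_add_left_eq_self
      (fun x => y * (φ x * (y / ((x - t) ^ 2 + y ^ 2)))) t, integral_const_mul, abs_of_pos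
      (inv_pos.2 hy), smul_eq_mul, inv_mul_cancel_left₀ hy.ne']
  have hswap : ∀ y, 0 < y → ∫ t, (P y t : ℂ) * κ t ∂μ = 0 := fun y hy => by
    have hint : Integrable (Function.uncurry fun (t x : ℝ) =>
        ((φ x * (y / ((x - t) ^ 2 + y ^ 2)) : ℝ) : ℂ) * κ t) (μ.prod volume) := by
      have h1 : Integrable (fun p : ℝ × ℝ => κ p.1 * (φ p.2 : ℂ)) (μ.prod volume) :=
        hκ.mul_prod (hcont.integrable_of_hasCompactSupport hφc).ofReal
      have h2 := h1.bdd_mul (c := y⁻¹)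
        (f := fun p : ℝ × ℝ => ((y / ((p.2 - p.1) ^ 2 + y ^ 2) : ℝ) : ℂ)) ?_ ?_
      · refine h2.congr (Eventually.of_forall fun p => ?_)
        simp only [Function.uncurry]
        push_cast; ring
      · refine Continuous.aestronglyMeasurable ?_
        refine Complex.continuous_ofReal.comp (continuous_const.div (by fun_prop) fun p => ?_)
        positivity
      · refine Eventually.of_forall fun p => ?_
        rw [Complex.norm_real, Real.norm_of_nonneg (by positivity), div_le_iff₀ (by positivity)]
        have : y⁻¹ * y ^ 2 = y := by field_simp
        have h3 : 0 ≤ y⁻¹ * (p.2 - p.1) ^ 2 := by positivity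
        linarith
    have e : ∀ t, (P y t : ℂ) * κ t =
        ∫ x, ((φ x * (y / ((x - t) ^ 2 + y ^ 2)) : ℝ) : ℂ) * κ t := fun t => by
      rw [hP y hy t, integral_mul_const, integral_complex_ofReal]
    simp only [e]
    rw [integral_integral_swap hint]
    have : ∀ x, ∫ t, ((φ x * (y / ((x - t) ^ 2 + y ^ 2)) : ℝ) : ℂ) * κ t ∂μ = 0 := fun x => by
      simp only [Complex.ofReal_mul, mul_assoc]
      rw [integral_const_mul, hpoisson x y hy, mul_zero]
    simp only [this, integral_zero]
  have hPlim : ∀ t, Tendsto (fun n : ℕ => P (1 / ((n : ℝ) + 1)) t) atTop (𝓝 (Real.pi * φ t)) :=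
    fun t => by
      have e : Real.pi * φ t = ∫ s : ℝ, φ t * (1 + s ^ 2)⁻¹ := by
        rw [integral_const_mul, integral_univ_inv_one_add_sq, mul_comm]
      rw [e]
      refine tendsto_integral_of_dominated_convergence (fun s : ℝ => M * (1 + s ^ 2)⁻¹)
        (fun n => ?_) (integrable_inv_one_add_sq.const_mul M) (fun n => ?_) ?_
      · refine Continuous.aestronglyMeasurable ((hcont.comp (by fun_prop)).mul ?_)
        exact Continuous.inv₀ (by fun_prop) fun s => by positivity
      · refine Eventually.of_forall fun s => ?_
        rw [norm_mul, Real.norm_of_nonneg (by positivity : 0 ≤ (1 + s ^ 2)⁻¹)]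
        gcongr
        exact hM _
      · refine Eventually.of_forall fun s => Tendsto.mul_const _ ?_
        have h1 : Tendsto (fun n : ℕ => t + 1 / ((n : ℝ) + 1) * s) atTop (𝓝 (t + 0 * s)) :=
          (tendsto_one_div_add_atTop_nhds_zero_nat.mul_const s).const_add t
        rw [zero_mul, add_zero] at h1
        exact (hcont.tendsto t).comp h1
  have hPbd : ∀ y t, ‖P y t‖ ≤ M * Real.pi := fun y t => by
    have e : M * Real.pi = ∫ s : ℝ, M * (1 + s ^ 2)⁻¹ := by
      rw [integral_const_mul, integral_univ_inv_one_add_sq]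
    rw [e]
    refine norm_integral_le_of_norm_le (integrable_inv_one_add_sq.const_mul M)
      (Eventually.of_forall fun s => ?_)
    rw [norm_mul, Real.norm_of_nonneg (by positivity : 0 ≤ (1 + s ^ 2)⁻¹)]
    gcongr
    exact hM _
  have hPm : ∀ y, AEStronglyMeasurable (fun t => (P y t : ℂ)) μ := fun y => by
    refine Complex.continuous_ofReal.comp_aestronglyMeasurable ?_
    refine Continuous.aestronglyMeasurable ?_
    refine continuous_of_dominated (bound := fun s : ℝ => M * (1 + s ^ 2)⁻¹) (fun t => ?_)
      (fun t => ?_) (integrable_inv_one_add_sq.const_mul M) ?_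
    · refine Continuous.aestronglyMeasurable ((hcont.comp (by fun_prop)).mul ?_)
      exact Continuous.inv₀ (by fun_prop) fun s => by positivity
    · refine Eventually.of_forall fun s => ?_
      rw [norm_mul, Real.norm_of_nonneg (by positivity : 0 ≤ (1 + s ^ 2)⁻¹)]
      gcongr
      exact hM _
    · exact Eventually.of_forall fun s => (hcont.comp (by fun_prop)).mul continuous_const
  have hlim : Tendsto (fun n : ℕ => ∫ t, (P (1 / ((n : ℝ) + 1)) t : ℂ) * κ t ∂μ) atTop
      (𝓝 (∫ t, ((Real.pi * φ t : ℝ) : ℂ) * κ t ∂μ)) := by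
    refine tendsto_integral_of_dominated_convergence (fun t => M * Real.pi * ‖κ t‖)
      (fun n => (hPm _).mul hκ.aestronglyMeasurable) (hκ.norm.const_mul _) (fun n => ?_) ?_
    · refine Eventually.of_forall fun t => ?_
      rw [norm_mul, Complex.norm_real]
      gcongr
      exact hPbd _ _
    · refine Eventually.of_forall fun t => Tendsto.mul_const _ ?_
      exact (Complex.continuous_ofReal.tendsto _).comp (hPlim t)
  have h0 : ∫ t, ((Real.pi * φ t : ℝ) : ℂ) * κ t ∂μ = 0 := by
    refine tendsto_nhds_unique hlim ?_
    simp only [fun n : ℕ => hswap (1 / ((n : ℝ) + 1)) (by positivity)]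
    exact tendsto_const_nhds
  simp only [Complex.ofReal_mul, mul_assoc] at h0
  rw [integral_const_mul] at h0
  have hpi : (Real.pi : ℂ) ≠ 0 := by exact_mod_cast Real.pi_ne_zero
  simpa [hpi] using h0

/-- A finite measure is determined by its Stieltjes transform. -/
theorem eq_of_stieltjes_eq {ν : Measure ℝ} [IsFiniteMeasure μ] [IsFiniteMeasure ν]
    (h : ∀ z : ℂ, z.im ≠ 0 → ∫ t : ℝ, ((t : ℂ) - z)⁻¹ ∂μ = ∫ t : ℝ, ((t : ℂ) - z)⁻¹ ∂ν) : μ = ν := by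
  have hμ : μ ≪ μ + ν := Measure.AbsolutelyContinuous.rfl.add_right ν
  have hν : ν ≪ μ + ν := by
    rw [add_comm]; exact Measure.AbsolutelyContinuous.rfl.add_right μ
  have hint : ∀ ρ : Measure ℝ, IsFiniteMeasure ρ →
      Integrable (fun t => ((ρ.rnDeriv (μ + ν) t).toReal : ℂ)) (μ + ν) := fun ρ _ =>
    Measure.integrable_toReal_rnDeriv.ofReal
  -- Applied to the difference of the densities of μ and ν with respect to μ + ν.
  have key := ae_eq_zero_of_stieltjes_eq_zero ((hint μ inferInstance).sub (hint ν inferInstance))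
    fun z hz => by
      have e : ∀ ρ : Measure ℝ, IsFiniteMeasure ρ → ρ ≪ μ + ν →
          ∫ t : ℝ, ((t : ℂ) - z)⁻¹ * ((ρ.rnDeriv (μ + ν) t).toReal : ℂ) ∂(μ + ν) =
            ∫ t : ℝ, ((t : ℂ) - z)⁻¹ ∂ρ := fun ρ _ hρ => by
        rw [← integral_rnDeriv_smul hρ]
        refine integral_congr_ae (Eventually.of_forall fun t => ?_)
        simp only [Complex.real_smul]; ring
      simp only [Pi.sub_apply, mul_sub]
      refine (integral_sub (integrable_inv_sub_mul (hint μ inferInstance) hz)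
        (integrable_inv_sub_mul (hint ν inferInstance) hz)).trans ?_
      rw [e μ inferInstance hμ, e ν inferInstance hν, h z hz, sub_self]
  refine (Measure.withDensity_rnDeriv_eq μ _ hμ).symm.trans
    (Eq.trans (withDensity_congr_ae ?_) (Measure.withDensity_rnDeriv_eq ν _ hν))
  filter_upwards [key, Measure.rnDeriv_lt_top μ (μ + ν), Measure.rnDeriv_lt_top ν (μ + ν)]
    with t h1 h2 h3
  simp only [Pi.sub_apply, Pi.zero_apply, sub_eq_zero, Complex.ofReal_inj] at h1
  exact (ENNReal.toReal_eq_toReal_iff' h2.ne h3.ne).1 h1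

end Stieltjes

-- Separating singular parts by differentiation of measures

section SeparateSingularParts

/-- If `μ₁(B) μ₂(B) ≤ ε²` for every ball `B` of radius `ε`, then the singular parts of `μ₁` and
`μ₂` are mutually singular. -/
theorem exists_disjoint_null_sets {μ₁ μ₂ : Measure ℝ} [IsFiniteMeasure μ₁] [IsFiniteMeasure μ₂]
    (h : ∀ x ε : ℝ, 0 < ε → μ₁ (Metric.closedBall x ε) * μ₂ (Metric.closedBall x ε) ≤
      ENNReal.ofReal ε ^ 2) :
    ∃ N₁ N₂ : Set ℝ, MeasurableSet N₁ ∧ MeasurableSet N₂ ∧ volume N₁ = 0 ∧ volume N₂ = 0 ∧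
      μ₁ N₂ = 0 ∧ μ₂ N₁ = 0 ∧ μ₁.restrict N₁ᶜ ≪ volume ∧ μ₂.restrict N₂ᶜ ≪ volume := by
  set ρ := μ₁ + μ₂ with hρ
  have h1ρ : μ₁ ≪ ρ := Measure.AbsolutelyContinuous.rfl.add_right μ₂
  have h2ρ : μ₂ ≪ ρ := by
    rw [hρ, add_comm]; exact Measure.AbsolutelyContinuous.rfl.add_right μ₁
  set f₁ := μ₁.rnDeriv ρ with hf₁
  set f₂ := μ₂.rnDeriv ρ with hf₂
  set D := (volume : Measure ℝ).rnDeriv ρ with hD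
  have hf₁m : Measurable f₁ := Measure.measurable_rnDeriv _ _
  have hDm : Measurable D := Measure.measurable_rnDeriv _ _
  let v := Besicovitch.vitaliFamily ρ
  -- Densities are limits of ratios of ball masses. The hypothesis and ε² ≤ (2ε)² bound the product
  -- of the ratios for μ₁, μ₂ by the squared ratio for Lebesgue measure, whose limit is D².
  have hprod : ∀ᵐ x ∂ρ, D x = 0 → f₁ x * f₂ x = 0 := by
    filter_upwards [v.ae_tendsto_rnDeriv μ₁, v.ae_tendsto_rnDeriv μ₂,
      v.ae_tendsto_rnDeriv (volume : Measure ℝ), Measure.rnDeriv_lt_top μ₁ ρ,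
      Measure.rnDeriv_lt_top μ₂ ρ] with x l1 l2 l3 t1 t2 hDx
    have hb := Besicovitch.tendsto_filterAt ρ x
    have l1' := l1.comp hb
    have l2' := l2.comp hb
    have l3' := l3.comp hb
    have l12 := ENNReal.Tendsto.mul l1' (Or.inr t2.ne) l2' (Or.inr t1.ne)
    change Tendsto _ _ (𝓝 (D x)) at l3'
    rw [hDx] at l3'
    have l33 := ENNReal.Tendsto.mul l3' (Or.inr ENNReal.zero_ne_top) l3'
      (Or.inr ENNReal.zero_ne_top)
    rw [mul_zero] at l33
    refine le_antisymm (le_of_tendsto_of_tendsto l12 l33 ?_) bot_le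
    filter_upwards [self_mem_nhdsWithin] with ε hε
    have hε' : 0 < ε := hε
    simp only [Function.comp_apply, div_eq_mul_inv]
    calc _ = μ₁ (Metric.closedBall x ε) * μ₂ (Metric.closedBall x ε) *
          ((ρ (Metric.closedBall x ε))⁻¹ * (ρ (Metric.closedBall x ε))⁻¹) := by ring
      _ ≤ volume (Metric.closedBall x ε) * volume (Metric.closedBall x ε) *
          ((ρ (Metric.closedBall x ε))⁻¹ * (ρ (Metric.closedBall x ε))⁻¹) := by
        gcongr ?_ * _
        refine (h x ε hε').trans ?_
        rw [Real.volume_closedBall, ← sq]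
        gcongr
        linarith
      _ = _ := by ring
  obtain ⟨Z, hZm, hZ1, hZ2⟩ := Measure.mutuallySingular_singularPart (volume : Measure ℝ) ρ
  have hZρ : ρ Zᶜ = 0 := hZ2
  set S := {x | D x = 0} with hS
  have hSm : MeasurableSet S := hDm (measurableSet_singleton 0)
  -- N is Lebesgue null and ρ is absolutely continuous off N. Intersecting with Z removes the part
  -- of Lebesgue measure that is singular to ρ and invisible to D.
  set N := S ∩ Z with hN
  have hNm : MeasurableSet N := hSm.inter hZm
  have hdecomp := Measure.haveLebesgueDecomposition_add (volume : Measure ℝ) ρ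
  have hNv : volume N = 0 := by
    rw [hdecomp, Measure.add_apply, withDensity_apply _ hNm]
    have a1 : (Measure.singularPart volume ρ) N = 0 := measure_mono_null inter_subset_right hZ1
    rw [a1, zero_add, setLIntegral_congr_fun hNm (g := 0) (fun x hx => hx.1)]
    simp
  have hac : ∀ s, volume s = 0 → ρ (s ∩ Nᶜ) = 0 := fun s hs => by
    have a1 : ρ.withDensity D s = 0 := by
      refine le_antisymm (le_trans ?_ hs.le) bot_le
      conv_rhs => rw [hdecomp]
      exact Measure.le_add_left le_rfl s
    have a2 : ρ ({x | D x ≠ 0} ∩ s) = 0 := (withDensity_apply_eq_zero hDm).1 a1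
    refine measure_mono_null (fun x hx => ?_) (measure_union_null a2 hZρ)
    by_cases hxZ : x ∈ Z
    · exact Or.inl ⟨fun h0 => hx.2 ⟨h0, hxZ⟩, hx.1⟩
    · exact Or.inr hxZ
  -- Since f₁ f₂ = 0 almost everywhere on N, cutting N by f₁ separates the two measures.
  set N₁ := N ∩ {x | f₁ x ≠ 0} with hN₁
  set N₂ := N ∩ {x | f₁ x = 0} with hN₂
  have hm0 : MeasurableSet {x | f₁ x = 0} := hf₁m (measurableSet_singleton 0)
  have hN₁m : MeasurableSet N₁ := hNm.inter hm0.compl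
  have hN₂m : MeasurableSet N₂ := hNm.inter hm0
  have h12 : μ₁ N₂ = 0 := by
    rw [← Measure.setLIntegral_rnDeriv h1ρ, setLIntegral_congr_fun hN₂m (g := 0)
      (fun x hx => hx.2)]
    simp
  have h21 : μ₂ N₁ = 0 := by
    rw [← Measure.setLIntegral_rnDeriv h2ρ, setLIntegral_congr_fun_ae hN₁m (g := 0)]
    · simp
    · filter_upwards [hprod] with x hx hxN
      exact (mul_eq_zero.1 (hx hxN.1.1)).resolve_left hxN.2
  refine ⟨N₁, N₂, hN₁m, hN₂m, measure_mono_null inter_subset_left hNv,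
    measure_mono_null inter_subset_left hNv, h12, h21, ?_, ?_⟩
  · refine Measure.AbsolutelyContinuous.mk fun s hs hs0 => ?_
    rw [Measure.restrict_apply hs]
    refine measure_mono_null (fun x hx => ?_) (measure_union_null (h1ρ (hac s hs0)) h12)
    by_cases hxN : x ∈ N
    · exact Or.inr ⟨hxN, by_contra fun h0 => hx.2 ⟨hxN, h0⟩⟩
    · exact Or.inl ⟨hx.1, hxN⟩
  · refine Measure.AbsolutelyContinuous.mk fun s hs hs0 => ?_
    rw [Measure.restrict_apply hs]
    refine measure_mono_null (fun x hx => ?_) (measure_union_null (h2ρ (hac s hs0)) h21)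
    by_cases hxN : x ∈ N
    · exact Or.inr ⟨hxN, fun h0 => hx.2 ⟨hxN, h0⟩⟩
    · exact Or.inl ⟨hx.1, hxN⟩

end SeparateSingularParts

-- Multiplication by the variable in L²(μ₁) ⊕ L²(μ₂)

section MultiplicationModel

variable {E : Type*} [NormedAddCommGroup E] [InnerProductSpace ℂ E]
  {μ μ₁ μ₂ : Measure ℝ} {A : E →ₗ.[ℂ] E} {R : ℂ → E →L[ℂ] E}

/-- `T` intertwines multiplication by `(t - z)⁻¹` on `L²(μ)` with `R z`. -/
def Intertwines (R : ℂ → E →L[ℂ] E) (T : Lp ℂ 2 μ →ₗᵢ[ℂ] E) : Prop :=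
  ∀ z : ℂ, z.im ≠ 0 → ∀ h k : Lp ℂ 2 μ, (∀ᵐ t : ℝ ∂μ, ((t : ℂ) - z) * k t = h t) → R z (T h) = T k

theorem exists_inv_sub_mul {z : ℂ} (hz : z.im ≠ 0) (h : Lp ℂ 2 μ) :
    ∃ k : Lp ℂ 2 μ, k =ᵐ[μ] fun t => ((t : ℂ) - z)⁻¹ * h t := by
  have hm : MemLp (fun t : ℝ => ((t : ℂ) - z)⁻¹ * h t) 2 μ := by
    refine (Lp.memLp h).of_le_mul (c := |z.im|⁻¹)
      ((measurable_inv_sub z).aestronglyMeasurable.mul (Lp.aestronglyMeasurable h))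
      (Eventually.of_forall fun t => ?_)
    rw [norm_mul]
    gcongr
    exact norm_inv_sub_le t hz
  exact ⟨hm.toLp _, hm.coeFn_toLp⟩

theorem Intertwines.apply {T : Lp ℂ 2 μ →ₗᵢ[ℂ] E} (hT : Intertwines R T) {z : ℂ} (hz : z.im ≠ 0)
    {h k : Lp ℂ 2 μ} (hk : k =ᵐ[μ] fun t => ((t : ℂ) - z)⁻¹ * h t) : R z (T h) = T k := by
  refine hT z hz h k ?_
  filter_upwards [hk] with t ht
  rw [ht, mul_inv_cancel_left₀ (ofReal_sub_ne_zero t hz)]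

theorem Intertwines.exists_eq {T : Lp ℂ 2 μ →ₗᵢ[ℂ] E} (hT : Intertwines R T) {z : ℂ}
    (hz : z.im ≠ 0) (h : Lp ℂ 2 μ) : ∃ k, R z (T h) = T k := by
  obtain ⟨k, hk⟩ := exists_inv_sub_mul hz h
  exact ⟨k, hT.apply hz hk⟩

theorem integrable_mul_conj (h k : Lp ℂ 2 μ) : Integrable (fun t => k t * conj (h t)) μ :=
  L2.integrable_inner (𝕜 := ℂ) h k

theorem inner_eq_integral (h k : Lp ℂ 2 μ) : (inner ℂ h k : ℂ) = ∫ t, k t * conj (h t) ∂μ :=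
  L2.inner_def (𝕜 := ℂ) h k

theorem Intertwines.inner_apply {T : Lp ℂ 2 μ →ₗᵢ[ℂ] E} (hT : Intertwines R T) {z : ℂ}
    (hz : z.im ≠ 0) (h k : Lp ℂ 2 μ) :
    (inner ℂ (T h) (R z (T k)) : ℂ) = ∫ t : ℝ, ((t : ℂ) - z)⁻¹ * (k t * conj (h t)) ∂μ := by
  obtain ⟨l, hl⟩ := exists_inv_sub_mul hz k
  rw [hT.apply hz hl, LinearIsometry.inner_map_map, inner_eq_integral]
  refine integral_congr_ae ?_
  filter_upwards [hl] with t ht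
  rw [ht, mul_assoc]

/-- The measure `|h|² μ`. -/
def sqMeasure (h : Lp ℂ 2 μ) : Measure ℝ := μ.withDensity fun t => ENNReal.ofReal (‖h t‖ ^ 2)

theorem aemeasurable_sq (h : Lp ℂ 2 μ) : AEMeasurable (fun t => ENNReal.ofReal (‖h t‖ ^ 2)) μ :=
  ((Lp.aestronglyMeasurable h).norm.aemeasurable.pow_const 2).ennreal_ofReal

instance isFiniteMeasure_sqMeasure (h : Lp ℂ 2 μ) : IsFiniteMeasure (sqMeasure h) :=
  isFiniteMeasure_withDensity (integrable_norm_sq h).lintegral_lt_top.ne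

theorem integral_sqMeasure (h : Lp ℂ 2 μ) (f : ℝ → ℂ) :
    ∫ t, f t ∂(sqMeasure h) = ∫ t, f t * (h t * conj (h t)) ∂μ := by
  rw [sqMeasure, integral_withDensity_eq_integral_toReal_smul₀ (aemeasurable_sq h)
    (Eventually.of_forall fun t => ENNReal.ofReal_lt_top)]
  refine integral_congr_ae (Eventually.of_forall fun t => ?_)
  simp only
  rw [ENNReal.toReal_ofReal (by positivity), Complex.mul_conj, Complex.normSq_eq_norm_sq,
    Complex.real_smul, mul_comm]

theorem sqMeasure_eq_zero_iff (h : Lp ℂ 2 μ) {s : Set ℝ} (hs : MeasurableSet s) :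
    sqMeasure h s = 0 ↔ ∀ᵐ t ∂μ, t ∈ s → h t = 0 := by
  rw [sqMeasure, withDensity_apply _ hs, lintegral_eq_zero_iff' (aemeasurable_sq h).restrict,
    EventuallyEq, ae_restrict_iff' hs]
  refine eventually_congr (Eventually.of_forall fun t => imp_congr_right fun _ => ?_)
  simp only [Pi.zero_apply, ENNReal.ofReal_eq_zero]
  constructor
  · intro h1
    have : ‖h t‖ ^ 2 = 0 := le_antisymm h1 (by positivity)
    simpa using this
  · intro h1; simp [h1]

/-- Off N the measure |h|²μ is both absolutely continuous and singular, hence zero. -/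
theorem ae_eq_zero_of_mutuallySingular {N : Set ℝ} (hN : MeasurableSet N)
    (hac : μ.restrict Nᶜ ≪ volume) (h : Lp ℂ 2 μ)
    (hsing : sqMeasure h ⟂ₘ (volume : Measure ℝ)) : ∀ᵐ t ∂μ, t ∉ N → h t = 0 := by
  obtain ⟨s, hs, h1, h2⟩ := hsing
  refine (sqMeasure_eq_zero_iff h hN.compl).1 ?_
  have h3 : μ (sᶜ ∩ Nᶜ) = 0 := by
    rw [← Measure.restrict_apply hs.compl]
    exact hac h2
  have h4 : sqMeasure h (sᶜ ∩ Nᶜ) = 0 := withDensity_absolutelyContinuous _ _ h3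
  refine measure_mono_null (fun t ht => ?_) (measure_union_null h1 h4)
  by_cases hts : t ∈ s
  · exact Or.inl hts
  · exact Or.inr ⟨hts, ht⟩

section Pair

variable [IsFiniteMeasure μ₁] [IsFiniteMeasure μ₂]
  {T₁ : Lp ℂ 2 μ₁ →ₗᵢ[ℂ] E} {T₂ : Lp ℂ 2 μ₂ →ₗᵢ[ℂ] E}
  (hR : IsResolventFamily A R) (hT₁ : Intertwines R T₁) (hT₂ : Intertwines R T₂)
  (horth : ∀ h k, (inner ℂ (T₁ h) (T₂ k) : ℂ) = 0)

omit [IsFiniteMeasure μ₁] [IsFiniteMeasure μ₂] in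
include horth in
theorem inner_pair (h h' : Lp ℂ 2 μ₁) (k k' : Lp ℂ 2 μ₂) :
    (inner ℂ (T₁ h + T₂ k) (T₁ h' + T₂ k') : ℂ) = inner ℂ h h' + inner ℂ k k' := by
  have h2 : (inner ℂ (T₂ k) (T₁ h') : ℂ) = 0 := inner_eq_zero_symm.1 (horth _ _)
  rw [inner_add_left, inner_add_right, inner_add_right, horth, h2,
    LinearIsometry.inner_map_map, LinearIsometry.inner_map_map, add_zero, zero_add]

omit [IsFiniteMeasure μ₁] [IsFiniteMeasure μ₂] in
include hT₁ hT₂ horth in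
theorem inner_resolvent_pair {z : ℂ} (hz : z.im ≠ 0) (h h' : Lp ℂ 2 μ₁) (k k' : Lp ℂ 2 μ₂) :
    (inner ℂ (T₁ h + T₂ k) (R z (T₁ h' + T₂ k')) : ℂ) =
      (∫ t : ℝ, ((t : ℂ) - z)⁻¹ * (h' t * conj (h t)) ∂μ₁) +
        ∫ t : ℝ, ((t : ℂ) - z)⁻¹ * (k' t * conj (k t)) ∂μ₂ := by
  obtain ⟨l, hl⟩ := hT₁.exists_eq hz h'
  obtain ⟨m, hm⟩ := hT₂.exists_eq hz k'
  rw [map_add, hl, hm, inner_pair horth, ← LinearIsometry.inner_map_map T₁,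
    ← LinearIsometry.inner_map_map T₂, ← hl, ← hm, hT₁.inner_apply hz, hT₂.inner_apply hz]

-- The cross terms vanish by orthogonality, so the two spectral measures add.
omit [IsFiniteMeasure μ₁] [IsFiniteMeasure μ₂] in
include hR hT₁ hT₂ horth in
theorem isSpectralMeasure_pair (h : Lp ℂ 2 μ₁) (k : Lp ℂ 2 μ₂) :
    IsSpectralMeasure A (T₁ h + T₂ k) (sqMeasure h + sqMeasure k) := by
  refine ⟨inferInstance, fun z φ hz hφ => ?_⟩
  rw [← (hR.iff hz).1 hφ, inner_resolvent_pair hT₁ hT₂ horth hz, integral_add_measure,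
    integral_sqMeasure, integral_sqMeasure]
  all_goals
    simpa using integrable_inv_sub_mul (integrable_const (1 : ℂ)) hz

include hR in
theorem IsSpectralMeasure.unique {ψ : E} {ν ν' : Measure ℝ} (h : IsSpectralMeasure A ψ ν)
    (h' : IsSpectralMeasure A ψ ν') : ν = ν' := by
  have := h.1
  have := h'.1
  refine eq_of_stieltjes_eq fun z hz => ?_
  rw [← h.2 z _ hz ((hR.iff hz).2 rfl), ← h'.2 z _ hz ((hR.iff hz).2 rfl)]

variable {N₁ N₂ : Set ℝ}

-- The spectral measure |h|²μ₁ + |k|²μ₂ is singular exactly when both summands are, that is, when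
-- they live on the null sets N₁ and N₂.
omit [IsFiniteMeasure μ₁] [IsFiniteMeasure μ₂] in
include hR hT₁ hT₂ horth in
theorem mem_singularSubspace_iff (hN₁ : MeasurableSet N₁) (hN₂ : MeasurableSet N₂)
    (hv₁ : volume N₁ = 0) (hv₂ : volume N₂ = 0) (hac₁ : μ₁.restrict N₁ᶜ ≪ volume)
    (hac₂ : μ₂.restrict N₂ᶜ ≪ volume) (h : Lp ℂ 2 μ₁) (k : Lp ℂ 2 μ₂) :
    T₁ h + T₂ k ∈ singularSubspace A ↔
      (∀ᵐ t ∂μ₁, t ∉ N₁ → h t = 0) ∧ ∀ᵐ t ∂μ₂, t ∉ N₂ → k t = 0 := by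
  have hsp := isSpectralMeasure_pair hR hT₁ hT₂ horth h k
  constructor
  · rintro ⟨ν, hν, hs⟩
    rw [IsSpectralMeasure.unique hR hν hsp] at hs
    have hs' := Measure.MutuallySingular.add_left_iff.1 hs
    exact ⟨ae_eq_zero_of_mutuallySingular hN₁ hac₁ h hs'.1,
      ae_eq_zero_of_mutuallySingular hN₂ hac₂ k hs'.2⟩
  · rintro ⟨h1, h2⟩
    refine ⟨_, hsp, Measure.MutuallySingular.add_left_iff.2 ⟨⟨N₁ᶜ, hN₁.compl, ?_, ?_⟩,
      ⟨N₂ᶜ, hN₂.compl, ?_, ?_⟩⟩⟩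
    · exact (sqMeasure_eq_zero_iff h hN₁.compl).2 h1
    · rwa [compl_compl]
    · exact (sqMeasure_eq_zero_iff k hN₂.compl).2 h2
    · rwa [compl_compl]

theorem exists_indicator {N : Set ℝ} (hN : MeasurableSet N) (h : Lp ℂ 2 μ) :
    ∃ k : Lp ℂ 2 μ, k =ᵐ[μ] N.indicator h := by
  have hm : MemLp (N.indicator h) 2 μ := (Lp.memLp h).indicator hN
  exact ⟨hm.toLp _, hm.coeFn_toLp⟩

variable [CompleteSpace E]

include hR hT₁ hT₂ horth in
/-- An operator which is unitarily equivalent to multiplication by the variable in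
`L²(μ₁) ⊕ L²(μ₂)` has simple singular spectrum if the singular parts of `μ₁` and `μ₂` are
mutually singular. -/
theorem hasSimpleSingularSpectrum_of_pair (hgen : ∀ x, ∃ h k, x = T₁ h + T₂ k)
    (hN₁ : MeasurableSet N₁) (hN₂ : MeasurableSet N₂)
    (hv₁ : volume N₁ = 0) (hv₂ : volume N₂ = 0) (h12 : μ₁ N₂ = 0) (h21 : μ₂ N₁ = 0)
    (hac₁ : μ₁.restrict N₁ᶜ ≪ volume) (hac₂ : μ₂.restrict N₂ᶜ ≪ volume) :
    HasSimpleSingularSpectrum A := by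
  have hmem := mem_singularSubspace_iff hR hT₁ hT₂ horth hN₁ hN₂ hv₁ hv₂ hac₁ hac₂
  set e₁ : Lp ℂ 2 μ₁ := indicatorConstLp 2 hN₁ (measure_ne_top μ₁ _) 1 with he₁
  set e₂ : Lp ℂ 2 μ₂ := indicatorConstLp 2 hN₂ (measure_ne_top μ₂ _) 1 with he₂
  have c₁ : e₁ =ᵐ[μ₁] N₁.indicator fun _ => (1 : ℂ) := indicatorConstLp_coeFn
  have c₂ : e₂ =ᵐ[μ₂] N₂.indicator fun _ => (1 : ℂ) := indicatorConstLp_coeFn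
  set ψ := T₁ e₁ + T₂ e₂ with hψ
  have hψmem : ψ ∈ singularSubspace A := by
    refine (hmem _ _).2 ⟨?_, ?_⟩
    · filter_upwards [c₁] with t ht hn
      rw [ht, indicator_of_notMem hn]
    · filter_upwards [c₂] with t ht hn
      rw [ht, indicator_of_notMem hn]
  set S : Submodule ℂ E := Submodule.span ℂ {φ | ∃ z : ℂ, z.im ≠ 0 ∧ IsResolventOf A z ψ φ}
    with hS
  have hcyc : ∀ x, x ∈ cyclicSubspace A ψ ↔ ∀ y ∈ Sᗮ, (inner ℂ y x : ℂ) = 0 := fun x => by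
    rw [cyclicSubspace, ← Submodule.orthogonal_orthogonal_eq_closure, Submodule.mem_orthogonal]
  have hperp : ∀ h k, T₁ h + T₂ k ∈ Sᗮ ↔
      (∀ᵐ t ∂μ₁, t ∈ N₁ → h t = 0) ∧ ∀ᵐ t ∂μ₂, t ∈ N₂ → k t = 0 := fun h k => by
    have a1 : T₁ h + T₂ k ∈ Sᗮ ↔
        ∀ z : ℂ, z.im ≠ 0 → (inner ℂ (T₁ h + T₂ k) (R z ψ) : ℂ) = 0 := by
      rw [hS, Submodule.mem_orthogonal']
      constructor
      · intro H z hz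
        exact H _ (Submodule.subset_span ⟨z, hz, (hR.iff hz).2 rfl⟩)
      · intro H x hx
        induction hx using Submodule.span_induction with
        | mem x hx =>
          obtain ⟨z, hz, hzx⟩ := hx
          rw [← (hR.iff hz).1 hzx]
          exact H z hz
        | zero => rw [inner_zero_right]
        | add x y _ _ hx hy => rw [inner_add_right, hx, hy, add_zero]
        | smul a x _ hx => rw [inner_smul_right, hx, mul_zero]
    rw [a1]
    set κ₁ : ℝ → ℂ := fun t => e₁ t * conj (h t)
    set κ₂ : ℝ → ℂ := fun t => e₂ t * conj (k t)
    have i₁ : Integrable κ₁ μ₁ := integrable_mul_conj h e₁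
    have i₂ : Integrable κ₂ μ₂ := integrable_mul_conj k e₂
    have hae₁ : ∀ᵐ t ∂μ₁, t ∉ N₂ := measure_eq_zero_iff_ae_notMem.1 h12
    have hae₂ : ∀ᵐ t ∂μ₂, t ∉ N₁ := measure_eq_zero_iff_ae_notMem.1 h21
    -- Mutual singularity enters here: as μ₁ N₂ = μ₂ N₁ = 0, one function is κ₁ for μ₁ and κ₂ for
    -- μ₂. The orthogonality condition becomes the vanishing of a single Stieltjes transform over μ₁
    -- + μ₂, which kills both densities.
    have b₁ : N₁.indicator κ₁ + N₂.indicator κ₂ =ᵐ[μ₁] κ₁ := by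
      filter_upwards [hae₁, c₁] with t ht hc
      rw [Pi.add_apply, indicator_of_notMem ht, add_zero]
      by_cases h1 : t ∈ N₁
      · rw [indicator_of_mem h1]
      · rw [indicator_of_notMem h1]
        simp only [κ₁]
        rw [hc, indicator_of_notMem h1, zero_mul]
    have b₂ : N₁.indicator κ₁ + N₂.indicator κ₂ =ᵐ[μ₂] κ₂ := by
      filter_upwards [hae₂, c₂] with t ht hc
      rw [Pi.add_apply, indicator_of_notMem ht, zero_add]
      by_cases h1 : t ∈ N₂
      · rw [indicator_of_mem h1]
      · rw [indicator_of_notMem h1]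
        simp only [κ₂]
        rw [hc, indicator_of_notMem h1, zero_mul]
    have d₁ : (∀ᵐ t ∂μ₁, t ∈ N₁ → h t = 0) ↔ κ₁ =ᵐ[μ₁] 0 := by
      refine eventually_congr ?_
      filter_upwards [c₁] with t ht
      simp only [κ₁, Pi.zero_apply, ht]
      by_cases h1 : t ∈ N₁ <;> simp [h1]
    have d₂ : (∀ᵐ t ∂μ₂, t ∈ N₂ → k t = 0) ↔ κ₂ =ᵐ[μ₂] 0 := by
      refine eventually_congr ?_
      filter_upwards [c₂] with t ht
      simp only [κ₂, Pi.zero_apply, ht]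
      by_cases h1 : t ∈ N₂ <;> simp [h1]
    rw [d₁, d₂]
    constructor
    · intro H
      have := ae_eq_zero_of_stieltjes_eq_zero (μ := μ₁ + μ₂)
        (κ := N₁.indicator κ₁ + N₂.indicator κ₂)
        (Integrable.add_measure (i₁.congr b₁.symm) (i₂.congr b₂.symm)) fun z hz => by
          rw [integral_add_measure (integrable_inv_sub_mul (i₁.congr b₁.symm) hz)
            (integrable_inv_sub_mul (i₂.congr b₂.symm) hz), ← H z hz,
            inner_resolvent_pair hT₁ hT₂ horth hz]
          congr 1
          · refine integral_congr_ae ?_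
            filter_upwards [b₁] with t ht
            rw [ht]
          · refine integral_congr_ae ?_
            filter_upwards [b₂] with t ht
            rw [ht]
      have hadd := ae_add_measure_iff.1 this
      exact ⟨b₁.symm.trans hadd.1, b₂.symm.trans hadd.2⟩
    · rintro ⟨H1, H2⟩ z hz
      rw [inner_resolvent_pair hT₁ hT₂ horth hz,
        integral_congr_ae (g := 0), integral_congr_ae (μ := μ₂) (g := 0)]
      · simp
      · filter_upwards [H2] with t ht
        change _ * κ₂ t = _
        rw [ht]; simp
      · filter_upwards [H1] with t ht
        change _ * κ₁ t = _
        rw [ht]; simp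
  refine ⟨ψ, hψmem, Set.ext fun x => ?_⟩
  obtain ⟨h, k, rfl⟩ := hgen x
  rw [SetLike.mem_coe, hcyc, hmem]
  constructor
  · intro H
    -- The parts of h and k off N₁ and N₂ form a vector orthogonal to S; testing against it shows
    -- that its norm is zero.
    obtain ⟨h', hh'⟩ := exists_indicator hN₁.compl h
    obtain ⟨k', hk'⟩ := exists_indicator hN₂.compl k
    have hz1 : T₁ h' + T₂ k' ∈ Sᗮ := by
      refine (hperp _ _).2 ⟨?_, ?_⟩
      · filter_upwards [hh'] with t ht hn
        rw [ht, indicator_of_notMem (notMem_compl_iff.2 hn)]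
      · filter_upwards [hk'] with t ht hn
        rw [ht, indicator_of_notMem (notMem_compl_iff.2 hn)]
    have h1 := H _ hz1
    have p1 : (inner ℂ h' h : ℂ) = inner ℂ h' h' := by
      rw [inner_eq_integral, inner_eq_integral]
      refine integral_congr_ae ?_
      filter_upwards [hh'] with t ht
      rw [ht]
      by_cases h1 : t ∈ N₁ᶜ <;> simp [h1]
    have p2 : (inner ℂ k' k : ℂ) = inner ℂ k' k' := by
      rw [inner_eq_integral, inner_eq_integral]
      refine integral_congr_ae ?_
      filter_upwards [hk'] with t ht
      rw [ht]
      by_cases h1 : t ∈ N₂ᶜ <;> simp [h1]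
    rw [inner_pair horth, p1, p2, inner_self_eq_norm_sq_to_K, inner_self_eq_norm_sq_to_K] at h1
    have h2 : ‖h'‖ ^ 2 + ‖k'‖ ^ 2 = 0 := Complex.ofReal_eq_zero.1 (by
      rw [Complex.ofReal_add, Complex.ofReal_pow, Complex.ofReal_pow]; exact h1)
    have h3 : h' = 0 := by
      rw [← norm_eq_zero, ← sq_eq_zero_iff]; nlinarith [sq_nonneg ‖h'‖, sq_nonneg ‖k'‖]
    have h4 : k' = 0 := by
      rw [← norm_eq_zero, ← sq_eq_zero_iff]; nlinarith [sq_nonneg ‖h'‖, sq_nonneg ‖k'‖]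
    rw [h3] at hh'
    rw [h4] at hk'
    constructor
    · filter_upwards [hh', Lp.coeFn_zero ℂ 2 μ₁] with t ht h0 hn
      rw [h0, indicator_of_mem (mem_compl hn)] at ht
      exact ht.symm
    · filter_upwards [hk', Lp.coeFn_zero ℂ 2 μ₂] with t ht h0 hn
      rw [h0, indicator_of_mem (mem_compl hn)] at ht
      exact ht.symm
  · rintro ⟨H1, H2⟩ y hy
    obtain ⟨h', k', rfl⟩ := hgen y
    obtain ⟨q1, q2⟩ := (hperp _ _).1 hy
    rw [inner_pair horth, inner_eq_integral, inner_eq_integral,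
      integral_congr_ae (g := 0), integral_congr_ae (μ := μ₂) (g := 0)]
    · simp
    · filter_upwards [H2, q2] with t h1 h2
      by_cases hn : t ∈ N₂
      · simp [h2 hn]
      · simp [h1 hn]
    · filter_upwards [H1, q1] with t h1 h2
      by_cases hn : t ∈ N₁
      · simp [h2 hn]
      · simp [h1 hn]

end Pair

end MultiplicationModel

-- Representers of boundary functionals and the spectral measures

section BoundaryRepresenters

variable {E : Type*} [NormedAddCommGroup E] [InnerProductSpace ℂ E] [CompleteSpace E]
  {μ : Measure ℝ} {A : E →ₗ.[ℂ] E} {R : ℂ → E →L[ℂ] E}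

theorem exists_inner_eq (T : Lp ℂ 2 μ →ₗᵢ[ℂ] E) (x : E) :
    ∃ c : Lp ℂ 2 μ, ∀ k, (inner ℂ x (T k) : ℂ) = inner ℂ c k :=
  ⟨ContinuousLinearMap.adjoint T.toContinuousLinearMap x, fun k =>
    (ContinuousLinearMap.adjoint_inner_left T.toContinuousLinearMap k x).symm⟩

/-- h is the adjoint of T applied to x; as T is isometric, T h is the projection of x onto its
range. -/
theorem exists_orthogonal_sub (T : Lp ℂ 2 μ →ₗᵢ[ℂ] E) (x : E) :
    ∃ h : Lp ℂ 2 μ, ∀ k, (inner ℂ (T k) (x - T h) : ℂ) = 0 := by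
  obtain ⟨c, hc⟩ := exists_inner_eq T x
  refine ⟨c, fun k => ?_⟩
  rw [inner_sub_right, LinearIsometry.inner_map_map, ← inner_conj_symm, hc, inner_conj_symm,
    sub_self]

/-- The vector representing `g ↦ ⟪γ, (A - I) (R w g)⟫`. -/
def shiftedRepresenter (R : ℂ → E →L[ℂ] E) (γ : E) (w : ℂ) : E :=
  γ + (conj w + Complex.I) • R (conj w) γ

variable [IsFiniteMeasure μ] {T : Lp ℂ 2 μ →ₗᵢ[ℂ] E}

theorem exists_one : ∃ e : Lp ℂ 2 μ, e =ᵐ[μ] fun _ => (1 : ℂ) :=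
  ⟨(memLp_const (1 : ℂ)).toLp _, MemLp.coeFn_toLp _⟩

/-- The functional ⟨x, T ·⟩ has an integrable density with vanishing Stieltjes transform: resolvents
applied to T 1 are total in the range of T. -/
theorem Intertwines.orthogonal_of_orthogonal_resolvent (hT : Intertwines R T) {e : Lp ℂ 2 μ}
    (he : e =ᵐ[μ] fun _ => (1 : ℂ)) {x : E}
    (hx : ∀ z : ℂ, z.im ≠ 0 → (inner ℂ x (R z (T e)) : ℂ) = 0) (k : Lp ℂ 2 μ) :
    (inner ℂ x (T k) : ℂ) = 0 := by
  obtain ⟨c, hc⟩ := exists_inner_eq T x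
  have hκ : Integrable (fun t => conj (c t)) μ := by
    refine (integrable_mul_conj c e).congr ?_
    filter_upwards [he] with t ht
    rw [ht, one_mul]
  have h0 := ae_eq_zero_of_stieltjes_eq_zero hκ fun z hz => by
    obtain ⟨l, hl⟩ := exists_inv_sub_mul hz e
    rw [← hx z hz, hT.apply hz hl, hc, inner_eq_integral]
    refine integral_congr_ae ?_
    filter_upwards [hl, he] with t h1 h2
    rw [h1, h2, mul_one]
  rw [hc, inner_eq_integral]
  refine (integral_congr_ae (g := 0) ?_).trans (by simp)
  filter_upwards [h0] with t ht
  rw [ht]; simp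

omit [CompleteSpace E] [IsFiniteMeasure μ] in
theorem Intertwines.resolvent_orthogonal (hR : IsResolventFamily A R) (hT : Intertwines R T)
    {x : E} (hx : ∀ k, (inner ℂ (T k) x : ℂ) = 0) {z : ℂ} (hz : z.im ≠ 0) (k : Lp ℂ 2 μ) :
    (inner ℂ (T k) (R z x) : ℂ) = 0 := by
  have hz' : (conj z).im ≠ 0 := by simpa using hz
  obtain ⟨l, hl⟩ := hT.exists_eq hz' k
  have := hR.inner_left hz' (T k) x
  rw [Complex.conj_conj] at this
  rw [← this, hl, hx]

-- The orthogonal complement of the range of T is resolvent invariant, so it contains the cyclic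
-- subspace of S 1 along with S 1.
omit [IsFiniteMeasure μ] in
theorem Intertwines.orthogonal_range {ν : Measure ℝ} [IsFiniteMeasure ν]
    (hR : IsResolventFamily A R) (hT : Intertwines R T)
    {S : Lp ℂ 2 ν →ₗᵢ[ℂ] E} (hS : Intertwines R S) {e : Lp ℂ 2 ν}
    (he : e =ᵐ[ν] fun _ => (1 : ℂ)) (hx : ∀ k, (inner ℂ (T k) (S e) : ℂ) = 0)
    (h : Lp ℂ 2 μ) (k : Lp ℂ 2 ν) : (inner ℂ (T h) (S k) : ℂ) = 0 :=
  hS.orthogonal_of_orthogonal_resolvent he (fun _ hz => hT.resolvent_orthogonal hR hx hz h) k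

omit [CompleteSpace E] in
/-- The mass of an interval of radius `ε` about `x` is controlled by the resolvent at
height `ε`. -/
theorem Intertwines.measure_closedBall_le (hT : Intertwines R T) {e : Lp ℂ 2 μ}
    (he : e =ᵐ[μ] fun _ => (1 : ℂ)) (x : ℝ) {ε : ℝ} (hε : 0 < ε) :
    μ.real (Metric.closedBall x ε) ≤
      2 * ε ^ 2 * ‖T e + (conj ((x : ℂ) + ε * Complex.I) + Complex.I) •
        R (conj ((x : ℂ) + ε * Complex.I)) (T e)‖ ^ 2 := by
  set w : ℂ := conj ((x : ℂ) + ε * Complex.I) with hw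
  have hwim : w.im = -ε := by simp [hw]
  have hwre : w.re = x := by simp [hw]
  have hz : w.im ≠ 0 := by rw [hwim]; exact neg_ne_zero.2 hε.ne'
  obtain ⟨l, hl⟩ := exists_inv_sub_mul hz e
  rw [hT.apply hz hl, ← map_smul, ← map_add, LinearIsometry.norm_map, norm_sq_eq_integral,
    ← integral_const_mul, ← integral_indicator_one Metric.isClosed_closedBall.measurableSet]
  refine integral_mono_ae ((integrable_const (1 : ℝ)).indicator
    Metric.isClosed_closedBall.measurableSet) ((integrable_norm_sq _).const_mul _) ?_
  filter_upwards [he, hl, Lp.coeFn_add e ((w + Complex.I) • l),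
    Lp.coeFn_smul (w + Complex.I) l] with t h1 h2 h3 h4
  rw [h3, Pi.add_apply, h4, Pi.smul_apply, h2, h1, smul_eq_mul, mul_one]
  by_cases ht : t ∈ Metric.closedBall x ε
  · rw [indicator_of_mem ht, Pi.one_apply]
    have hne := ofReal_sub_ne_zero t hz
    -- In the model the shifted representer is (t + i)/(t - w). For |t - x| ≤ ε its squared modulus
    -- is at least 1/(2ε²), since t² + 1 ≥ 1 and (t - x)² + ε² ≤ 2ε².
    have e1 : 1 + (w + Complex.I) * ((t : ℂ) - w)⁻¹ = (t + Complex.I) / ((t : ℂ) - w) := by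
      field_simp
      ring
    rw [e1, norm_div, div_pow, ← Complex.normSq_eq_norm_sq, ← Complex.normSq_eq_norm_sq]
    have e2 : Complex.normSq ((t : ℂ) + Complex.I) = t ^ 2 + 1 := by
      rw [Complex.normSq_apply]; simp; ring
    have e3 : Complex.normSq ((t : ℂ) - w) = (t - x) ^ 2 + ε ^ 2 := by
      rw [Complex.normSq_apply]; simp [hwre, hwim]; ring
    rw [e2, e3, mul_div_assoc', le_div_iff₀ (by positivity)]
    have h5 : |t - x| ≤ ε := by simpa [Real.dist_eq] using ht
    have h6 : (t - x) ^ 2 ≤ ε ^ 2 := sq_le_sq' (abs_le.1 h5).1 (abs_le.1 h5).2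
    nlinarith [sq_nonneg (ε * t)]
  · rw [indicator_of_notMem ht]
    positivity

-- Orthogonality of a and b forces ⟨a₁, b₁⟩ = ‖σ‖², whence ‖σ‖⁴ ≤ ‖a₁‖²‖b₁‖². By Pythagoras this is
-- the claim.
omit [CompleteSpace E] in
theorem norm_sq_mul_norm_sq_le {a b σ a₁ b₁ : E} (ha : a = σ + a₁) (hb : b = -σ + b₁)
    (h1 : (inner ℂ σ a₁ : ℂ) = 0) (h2 : (inner ℂ σ b₁ : ℂ) = 0) (hab : (inner ℂ a b : ℂ) = 0) :
    ‖a + b‖ ^ 2 * ‖σ‖ ^ 2 ≤ ‖a‖ ^ 2 * ‖b‖ ^ 2 := by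
  have h1' : (inner ℂ a₁ σ : ℂ) = 0 := inner_eq_zero_symm.1 h1
  have n1 : ‖a‖ ^ 2 = ‖σ‖ ^ 2 + ‖a₁‖ ^ 2 := by
    have := norm_add_sq_eq_norm_sq_add_norm_sq_of_inner_eq_zero (𝕜 := ℂ) σ a₁ h1
    rw [ha]; nlinarith
  have n2 : ‖b‖ ^ 2 = ‖σ‖ ^ 2 + ‖b₁‖ ^ 2 := by
    have := norm_add_sq_eq_norm_sq_add_norm_sq_of_inner_eq_zero (𝕜 := ℂ) (-σ) b₁ (by
      rw [inner_neg_left, h2, neg_zero])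
    rw [norm_neg] at this
    rw [hb]; nlinarith
  have n3 : ‖a + b‖ ^ 2 = ‖a‖ ^ 2 + ‖b‖ ^ 2 := by
    have := norm_add_sq_eq_norm_sq_add_norm_sq_of_inner_eq_zero (𝕜 := ℂ) a b hab
    nlinarith
  have n4 : (inner ℂ a₁ b₁ : ℂ) = (‖σ‖ : ℂ) ^ 2 := by
    rw [ha, hb, inner_add_left, inner_add_right, inner_add_right, inner_neg_right,
      inner_neg_right, h2, h1', inner_self_eq_norm_sq_to_K] at hab
    have : (inner ℂ a₁ b₁ : ℂ) = (RCLike.ofReal ‖σ‖ : ℂ) ^ 2 := by linear_combination hab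
    exact this
  have n5 : ‖σ‖ ^ 2 ≤ ‖a₁‖ * ‖b₁‖ := by
    have := norm_inner_le_norm (𝕜 := ℂ) a₁ b₁
    rw [n4, norm_pow, Complex.norm_real, norm_norm] at this
    exact this
  have n6 : (‖σ‖ ^ 2) ^ 2 ≤ ‖a₁‖ ^ 2 * ‖b₁‖ ^ 2 := by
    rw [← mul_pow]
    exact pow_le_pow_left₀ (by positivity) n5 2
  rw [n3, n1, n2]
  nlinarith

/-- A vector whose cyclic subspace is annihilated by both boundary functionals is zero. -/
theorem inner_eq_zero_of_boundary_zero {γ₁ γ₂ h : E} (hT : Intertwines R T) {e : Lp ℂ 2 μ}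
    (he : e =ᵐ[μ] fun _ => (1 : ℂ)) (hγ₁ : ∀ k, (inner ℂ γ₁ (T k) : ℂ) = 0)
    (hγ₂ : ∀ k, (inner ℂ γ₂ (T k) : ℂ) = 0)
    (hC : ∀ s : ℝ, ∃ C : ℝ, ∀ g, (inner ℂ γ₁ g : ℂ) = 0 → (inner ℂ γ₂ g : ℂ) = 0 →
      ‖(inner ℂ h (R Complex.I g) : ℂ)‖ ≤ C * ‖g + (Complex.I - s) • R Complex.I g‖) :
    (inner ℂ h (T e) : ℂ) = 0 := by
  obtain ⟨c, hc⟩ := exists_inner_eq T h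
  have hκ : Integrable (fun t => conj (c t)) μ := by
    refine (integrable_mul_conj c e).congr ?_
    filter_upwards [he] with t ht
    rw [ht, one_mul]
  set κ : ℝ → ℂ := fun t => conj (c t) with hκdef
  have hI : (Complex.I).im ≠ 0 := by simp
  -- Choose g with R i (T g) = T 1_J, J the interval between s and s'. Then T g + (i - s) R i (T g)
  -- = T((t - s)1_J), of norm at most |s' - s| times the root of a mass from which the point s may
  -- be deleted, as t - s vanishes there.
  have key : ∀ s : ℝ, ∃ C : ℝ, 0 ≤ C ∧ ∀ s' r : ℝ, |s' - s| ≤ r →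
      ‖∫ t in s..s', κ t ∂μ‖ ≤ C * (|s' - s| * √(μ.real (Metric.closedBall s r \ {s}))) := by
    intro s
    obtain ⟨C, hC⟩ := hC s
    refine ⟨|C|, abs_nonneg C, fun s' r hr => ?_⟩
    rw [intervalIntegral.norm_integral_eq_norm_integral_uIoc]
    have hJ : MeasurableSet (uIoc s s') := measurableSet_uIoc
    have hJs : ∀ t ∈ uIoc s s', |t - s| ≤ |s' - s| := fun t ht => by
      have := uIoc_subset_uIcc ht
      exact abs_sub_left_of_mem_uIcc this
    have hm : MemLp ((uIoc s s').indicator fun t : ℝ => ((t : ℂ) - Complex.I)) 2 μ := by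
      refine MemLp.of_bound (by
        exact ((Complex.measurable_ofReal.sub_const _).indicator hJ).aestronglyMeasurable)
        (|s' - s| + |s| + 1) (Eventually.of_forall fun t => ?_)
      by_cases ht : t ∈ uIoc s s'
      · rw [indicator_of_mem ht]
        have b1 := hJs t ht
        have b2 : ‖(t : ℂ) - Complex.I‖ ≤ |t| + 1 := by
          refine (norm_sub_le _ _).trans ?_
          simp
        have b3 : |t| ≤ |t - s| + |s| := by
          have := abs_add_le (t - s) s
          rwa [sub_add_cancel] at this
        linarith
      · rw [indicator_of_notMem ht, norm_zero]; positivity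
    set g : Lp ℂ 2 μ := hm.toLp _ with hg
    have hgc : g =ᵐ[μ] (uIoc s s').indicator fun t : ℝ => ((t : ℂ) - Complex.I) := hm.coeFn_toLp
    set k : Lp ℂ 2 μ := indicatorConstLp 2 hJ (measure_ne_top μ _) 1 with hk
    have hkc : k =ᵐ[μ] (uIoc s s').indicator fun _ => (1 : ℂ) := indicatorConstLp_coeFn
    have hRg : R Complex.I (T g) = T k := by
      refine hT _ hI g k ?_
      filter_upwards [hgc, hkc] with t h1 h2
      rw [h1, h2]
      by_cases ht : t ∈ uIoc s s' <;> simp [ht]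
    have hint : (inner ℂ h (T k) : ℂ) = ∫ t in uIoc s s', κ t ∂μ := by
      rw [hc, inner_eq_integral, ← integral_indicator hJ]
      refine integral_congr_ae ?_
      filter_upwards [hkc] with t h2
      rw [h2]
      by_cases ht : t ∈ uIoc s s' <;> simp [ht, κ]
    have hbd := hC (T g) (hγ₁ g) (hγ₂ g)
    rw [hRg, hint, ← map_smul, ← map_add, LinearIsometry.norm_map] at hbd
    refine hbd.trans ?_
    refine mul_le_mul (le_abs_self C) ?_ (norm_nonneg _) (abs_nonneg C)
    set B := Metric.closedBall s r \ {s} with hB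
    have hBm : MeasurableSet B :=
      Metric.isClosed_closedBall.measurableSet.diff (measurableSet_singleton s)
    refine abs_le_of_sq_le_sq' ?_ (by positivity) |>.2
    rw [mul_pow, Real.sq_sqrt measureReal_nonneg, norm_sq_eq_integral, sq_abs, mul_comm,
      ← smul_eq_mul, ← integral_indicator_const _ hBm]
    refine integral_mono_ae (integrable_norm_sq _) ((integrable_const _).indicator hBm) ?_
    filter_upwards [hgc, hkc, Lp.coeFn_add g ((Complex.I - (s : ℂ)) • k),
      Lp.coeFn_smul (Complex.I - (s : ℂ)) k] with t h1 h2 h3 h4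
    rw [h3, Pi.add_apply, h4, Pi.smul_apply, h1, h2]
    by_cases ht : t ∈ uIoc s s'
    · have e1 : (t : ℂ) - Complex.I + (Complex.I - (s : ℂ)) • (1 : ℂ) = ((t - s : ℝ) : ℂ) := by
        rw [smul_eq_mul]; push_cast; ring
      rw [indicator_of_mem ht, indicator_of_mem ht, e1, Complex.norm_real, Real.norm_eq_abs, sq_abs]
      by_cases hts : t = s
      · rw [hts]
        simp [hB]
      · have hmem : t ∈ B := ⟨by
          rw [Metric.mem_closedBall, Real.dist_eq]
          exact (hJs t ht).trans hr, hts⟩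
        rw [indicator_of_mem hmem]
        exact sq_le_sq.2 (hJs t ht)
    · rw [indicator_of_notMem ht, indicator_of_notMem ht]
      simp only [smul_zero, add_zero, norm_zero]
      rw [zero_pow two_ne_zero]
      exact indicator_nonneg (fun _ _ => sq_nonneg _) _
  have hii : ∀ a b : ℝ, IntervalIntegrable κ μ a b := fun a b => hκ.intervalIntegrable
  set F : ℝ → ℂ := fun s => ∫ t in (0 : ℝ)..s, κ t ∂μ with hF
  -- The punctured balls shrink to the empty set, so their mass tends to 0 even if μ has an atom at
  -- s; increments of F are therefore o(|s' - s|).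
  have hderiv : ∀ s, HasDerivAt F 0 s := fun s => by
    obtain ⟨C, hC0, hCb⟩ := key s
    have hlim : Tendsto (fun r => μ.real (Metric.closedBall s r \ {s})) (𝓝[>] 0) (𝓝 0) := by
      have h1 := tendsto_measure_biInter_gt (μ := μ) (s := fun r : ℝ => Metric.closedBall s r \ {s})
        (a := 0) (fun r _ => (Metric.isClosed_closedBall.measurableSet.diff
          (measurableSet_singleton s)).nullMeasurableSet)
        (fun i j _ hij => sdiff_subset_sdiff_left (Metric.closedBall_subset_closedBall hij))
        ⟨1, one_pos, measure_ne_top _ _⟩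
      have h2 : (⋂ r > (0 : ℝ), Metric.closedBall s r \ {s}) = ∅ := by
        refine eq_empty_of_forall_notMem fun t ht => ?_
        rw [mem_iInter₂] at ht
        have hts : t ≠ s := (ht 1 one_pos).2
        have h3 := (ht (dist t s / 2) (half_pos (dist_pos.2 hts))).1
        rw [Metric.mem_closedBall] at h3
        have := dist_pos.2 hts
        linarith
      rw [h2, measure_empty] at h1
      exact (ENNReal.tendsto_toReal ENNReal.zero_ne_top).comp h1
    rw [hasDerivAt_iff_isLittleO, Asymptotics.isLittleO_iff]
    intro ε hε
    have hlim2 : Tendsto (fun r => C * √(μ.real (Metric.closedBall s r \ {s}))) (𝓝[>] 0)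
        (𝓝 0) := by
      have := (hlim.sqrt).const_mul C
      rwa [Real.sqrt_zero, mul_zero] at this
    obtain ⟨r, hr1, hr0⟩ := ((hlim2.eventually_lt_const hε).and self_mem_nhdsWithin).exists
    filter_upwards [Metric.ball_mem_nhds s hr0] with s' hs'
    have hs'' : |s' - s| ≤ r := by
      rw [Metric.mem_ball, Real.dist_eq] at hs'
      exact hs'.le
    have e1 : F s' - F s - (s' - s) • (0 : ℂ) = ∫ t in s..s', κ t ∂μ := by
      rw [smul_zero, sub_zero]
      exact intervalIntegral.integral_interval_sub_left (hii _ _) (hii _ _)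
    rw [e1, Real.norm_eq_abs]
    refine (hCb s' r hs'').trans ?_
    calc _ = (C * √(μ.real (Metric.closedBall s r \ {s}))) * |s' - s| := by ring
      _ ≤ ε * |s' - s| := by gcongr
  have hzero : ∀ a b : ℝ, ∫ t in a..b, κ t ∂μ = 0 := fun a b => by
    have h1 := is_const_of_deriv_eq_zero (fun s => (hderiv s).differentiableAt)
      (fun s => (hderiv s).deriv) a b
    have h2 := intervalIntegral.integral_interval_sub_left (hii 0 b) (hii 0 a)
    rw [← h2]
    exact sub_eq_zero.2 h1.symm
  have hlim := intervalIntegral_tendsto_integral hκ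
    (tendsto_neg_atTop_atBot.comp tendsto_natCast_atTop_atTop)
    (tendsto_natCast_atTop_atTop (R := ℝ))
  simp only [hzero] at hlim
  have h0 := tendsto_nhds_unique hlim tendsto_const_nhds
  rw [hc, inner_eq_integral, ← h0]
  refine integral_congr_ae ?_
  filter_upwards [he] with t ht
  rw [ht, one_mul]

end BoundaryRepresenters

-- The abstract criterion for simple singular spectrum

section SimpleSingularSpectrum

variable {E : Type*} [NormedAddCommGroup E] [InnerProductSpace ℂ E] {μ : Measure ℝ}
  {A : E →ₗ.[ℂ] E} {R : ℂ → E →L[ℂ] E}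

theorem Intertwines.exists_shiftedRepresenter_eq {T : Lp ℂ 2 μ →ₗᵢ[ℂ] E} (hT : Intertwines R T)
    {w : ℂ} (hw : w.im ≠ 0) (h : Lp ℂ 2 μ) : ∃ k, shiftedRepresenter R (T h) w = T k := by
  obtain ⟨l, hl⟩ := hT.exists_eq (z := conj w) (by simpa using hw) h
  exact ⟨h + (conj w + Complex.I) • l, by rw [shiftedRepresenter, hl, map_add, map_smul]⟩

theorem shiftedRepresenter_add (R : ℂ → E →L[ℂ] E) (γ γ' : E) (w : ℂ) :
    shiftedRepresenter R (γ + γ') w = shiftedRepresenter R γ w + shiftedRepresenter R γ' w := by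
  simp only [shiftedRepresenter, map_add, smul_add]
  abel

/-- The difference of the two sides is (Re(p + q))² + (Im p - Im q)². -/
theorem four_mul_im_mul_im_le (p q : ℂ) : 4 * (p.im * q.im) ≤ ‖p + q‖ ^ 2 := by
  rw [← Complex.normSq_eq_norm_sq, Complex.normSq_apply, Complex.add_re, Complex.add_im]
  nlinarith [sq_nonneg (p.re + q.re), sq_nonneg (p.im - q.im)]

variable [CompleteSpace E]

/-- An operator whose singular spectrum is simple because its resolvent is determined by two
boundary functionals with representers `γ₁` and `γ₂`, decoupled by two Herglotz functions. -/
theorem hasSimpleSingularSpectrum_of_boundary (hR : IsResolventFamily A R) {γ₁ γ₂ : E}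
    (hdet : ∀ w : ℂ, 0 < w.im → ∃ (p q : ℂ) (a b : E), 0 < p.im ∧ 0 < q.im ∧
      a = shiftedRepresenter R γ₂ w - conj p • shiftedRepresenter R γ₁ w ∧
      b = -shiftedRepresenter R γ₂ w - conj q • shiftedRepresenter R γ₁ w ∧
      (inner ℂ a b : ℂ) = 0 ∧ ‖a‖ ^ 2 ≤ p.im / w.im ∧ ‖b‖ ^ 2 ≤ q.im / w.im)
    (𝓗 : Set E) (hsep : ∀ f : E, (∀ h ∈ 𝓗, (inner ℂ h f : ℂ) = 0) → f = 0)
    (hC : ∀ h ∈ 𝓗, ∀ s : ℝ, ∃ C : ℝ, ∀ g, (inner ℂ γ₁ g : ℂ) = 0 → (inner ℂ γ₂ g : ℂ) = 0 →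
      ‖(inner ℂ h (R Complex.I g) : ℂ)‖ ≤ C * ‖g + (Complex.I - s) • R Complex.I g‖) :
    HasSimpleSingularSpectrum A := by
  obtain ⟨μ₁, _, T₁, hT₁e, hT₁⟩ := hR.exists_spectral_representation γ₁
  obtain ⟨e₁, he₁⟩ := exists_one (μ := μ₁)
  obtain ⟨m, hm⟩ := exists_orthogonal_sub T₁ γ₂
  obtain ⟨μ₂, _, T₂, hT₂e, hT₂⟩ := hR.exists_spectral_representation (γ₂ - T₁ m)
  obtain ⟨e₂, he₂⟩ := exists_one (μ := μ₂)
  change Intertwines R T₁ at hT₁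
  change Intertwines R T₂ at hT₂
  have hγ₁ : γ₁ = T₁ e₁ := (hT₁e e₁ he₁).symm
  have hγ₂ : γ₂ = T₂ e₂ + T₁ m := by rw [hT₂e e₂ he₂, sub_add_cancel]
  have horth : ∀ h k, (inner ℂ (T₁ h) (T₂ k) : ℂ) = 0 :=
    hT₁.orthogonal_range hR hT₂ he₂ fun k => by rw [hT₂e e₂ he₂]; exact hm k
  have hgen : ∀ x, ∃ h k, x = T₁ h + T₂ k := fun x => by
    obtain ⟨h, hh⟩ := exists_orthogonal_sub T₁ x
    obtain ⟨k, hk⟩ := exists_orthogonal_sub T₂ x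
    refine ⟨h, k, ?_⟩
    set f := x - (T₁ h + T₂ k) with hf
    have hf₁ : ∀ j, (inner ℂ (T₁ j) f : ℂ) = 0 := fun j => by
      have : f = (x - T₁ h) - T₂ k := by rw [hf]; abel
      rw [this, inner_sub_right, hh, horth, sub_zero]
    have hf₂ : ∀ j, (inner ℂ (T₂ j) f : ℂ) = 0 := fun j => by
      have : f = (x - T₂ k) - T₁ h := by rw [hf]; abel
      rw [this, inner_sub_right, hk, inner_eq_zero_symm.1 (horth _ _), sub_zero]
    -- The whole cyclic subspace of the residual f is orthogonal to both ranges, so both boundary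
    -- functionals vanish on it.
    obtain ⟨ν, _, T, hTe, hT⟩ := hR.exists_spectral_representation f
    obtain ⟨e, he⟩ := exists_one (μ := ν)
    change Intertwines R T at hT
    have h1 : ∀ j l, (inner ℂ (T₁ j) (T l) : ℂ) = 0 :=
      hT₁.orthogonal_range hR hT he fun j => by rw [hTe e he]; exact hf₁ j
    have h2 : ∀ j l, (inner ℂ (T₂ j) (T l) : ℂ) = 0 :=
      hT₂.orthogonal_range hR hT he fun j => by rw [hTe e he]; exact hf₂ j
    refine sub_eq_zero.1 (hsep f fun y hy => ?_)
    rw [← hTe e he]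
    refine inner_eq_zero_of_boundary_zero (γ₁ := γ₁) (γ₂ := γ₂) hT he (fun l => ?_) (fun l => ?_)
      (hC y hy)
    · rw [hγ₁, h1]
    · rw [hγ₂, inner_add_left, h1, h2, add_zero]
  have hmeas : ∀ x ε : ℝ, 0 < ε → μ₁ (Metric.closedBall x ε) * μ₂ (Metric.closedBall x ε) ≤
      ENNReal.ofReal ε ^ 2 := fun x ε hε => by
    set w : ℂ := (x : ℂ) + ε * Complex.I with hw
    have hwim : w.im = ε := by simp [hw]
    have hw0 : 0 < w.im := by rw [hwim]; exact hε
    obtain ⟨p, q, a, b, hp, hq, ha, hb, hab, hna, hnb⟩ := hdet w hw0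
    have m₁ := hT₁.measure_closedBall_le he₁ x hε
    have m₂ := hT₂.measure_closedBall_le he₂ x hε
    rw [← hγ₁] at m₁
    set G := shiftedRepresenter R γ₁ w with hG
    set σ := shiftedRepresenter R (T₂ e₂) w with hσ
    have m₁' : μ₁.real (Metric.closedBall x ε) ≤ 2 * ε ^ 2 * ‖G‖ ^ 2 := m₁
    have m₂' : μ₂.real (Metric.closedBall x ε) ≤ 2 * ε ^ 2 * ‖σ‖ ^ 2 := m₂
    obtain ⟨k₁, hk₁⟩ := hT₁.exists_shiftedRepresenter_eq hw0.ne' e₁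
    obtain ⟨k, hk⟩ := hT₁.exists_shiftedRepresenter_eq hw0.ne' m
    obtain ⟨k₂, hk₂⟩ := hT₂.exists_shiftedRepresenter_eq hw0.ne' e₂
    have hGk : G = T₁ k₁ := by rw [hG, hγ₁, hk₁]
    have hG2 : shiftedRepresenter R γ₂ w = σ + T₁ k := by
      rw [hγ₂, shiftedRepresenter_add, hk]
    have hσ0 : ∀ l, (inner ℂ σ (T₁ l) : ℂ) = 0 := fun l => by
      rw [hσ, hk₂]; exact inner_eq_zero_symm.1 (horth _ _)
    have hsum : a + b = -(conj (p + q)) • G := by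
      rw [ha, hb, map_add]; module
    have hmain := norm_sq_mul_norm_sq_le (a := a) (b := b) (σ := σ)
      (a₁ := T₁ (k - conj p • k₁)) (b₁ := T₁ (-k - conj q • k₁))
      (by rw [ha, hG2, map_sub, map_smul, ← hGk]; abel)
      (by rw [hb, hG2, map_sub, map_smul, map_neg, ← hGk]; abel) (hσ0 _) (hσ0 _) hab
    have hn : ‖a + b‖ ^ 2 = ‖p + q‖ ^ 2 * ‖G‖ ^ 2 := by
      rw [hsum, norm_smul, norm_neg, Complex.norm_conj, mul_pow]
    rw [hn] at hmain
    rw [hwim] at hna hnb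
    set X := ‖G‖ ^ 2 * ‖σ‖ ^ 2 with hX
    have hX0 : 0 ≤ X := by positivity
    have hpq : 0 < p.im * q.im := mul_pos hp hq
    -- The factor Im p · Im q occurs on both sides and cancels, leaving a bound on X that does not
    -- involve the Herglotz functions.
    have h1 : 4 * (p.im * q.im) * X ≤ (p.im * q.im) / ε ^ 2 := by
      calc 4 * (p.im * q.im) * X ≤ ‖p + q‖ ^ 2 * X :=
            mul_le_mul_of_nonneg_right (four_mul_im_mul_im_le p q) hX0
        _ = ‖p + q‖ ^ 2 * ‖G‖ ^ 2 * ‖σ‖ ^ 2 := by rw [hX]; ring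
        _ ≤ ‖a‖ ^ 2 * ‖b‖ ^ 2 := hmain
        _ ≤ (p.im / ε) * (q.im / ε) := by gcongr
        _ = (p.im * q.im) / ε ^ 2 := by field_simp
    have h2 : 4 * X * ε ^ 2 ≤ 1 := by
      rw [le_div_iff₀ (by positivity)] at h1
      refine le_of_mul_le_mul_left ?_ hpq
      linarith
    have h3 : μ₁.real (Metric.closedBall x ε) * μ₂.real (Metric.closedBall x ε) ≤ ε ^ 2 := by
      calc _ ≤ (2 * ε ^ 2 * ‖G‖ ^ 2) * (2 * ε ^ 2 * ‖σ‖ ^ 2) :=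
            mul_le_mul m₁' m₂' measureReal_nonneg (by positivity)
        _ = ε ^ 2 * (4 * X * ε ^ 2) := by rw [hX]; ring
        _ ≤ ε ^ 2 * 1 := by gcongr
        _ = ε ^ 2 := mul_one _
    rw [← ofReal_measureReal (μ := μ₁), ← ofReal_measureReal (μ := μ₂),
      ← ENNReal.ofReal_mul measureReal_nonneg, ← ENNReal.ofReal_pow hε.le]
    exact ENNReal.ofReal_le_ofReal h3
  obtain ⟨N₁, N₂, hN₁, hN₂, hv₁, hv₂, h12, h21, hac₁, hac₂⟩ := exists_disjoint_null_sets hmeas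
  exact hasSimpleSingularSpectrum_of_pair hR hT₁ hT₂ horth hgen hN₁ hN₂ hv₁ hv₂ h12 h21 hac₁ hac₂

end SimpleSingularSpectrum

-- Resolvent and test vectors of the Schrödinger operator

section SchrodingerResolvent

variable {V : ℝ → ℝ} {w z : ℂ} {u : ℝ → ℂ} {φ f : L2R}

theorem isResolventOf_iff : IsResolventOf (schrodingerOperator V) z f φ ↔
    ∃ u, IsLineSolution V z u φ f := by
  constructor
  · rintro ⟨hd, e⟩
    have hg : (φ, schrodingerOperator V ⟨φ, hd⟩) ∈ (schrodingerOperator V).graph :=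
      (schrodingerOperator V).mem_graph ⟨φ, hd⟩
    rw [schrodingerOperator_graph] at hg
    obtain ⟨u, hu, hs⟩ := hg
    refine ⟨u, hu, hs.congr_right ?_⟩
    rw [sub_eq_iff_eq_add'] at e
    filter_upwards [hu, Lp.coeFn_add (z • φ) f, Lp.coeFn_smul z φ] with x h1 h2 h3
    rw [e, h2, Pi.add_apply, h3, Pi.smul_apply, smul_eq_mul, ← h1]
  · rintro ⟨u, hu, hs⟩
    have hg : (φ, z • φ + f) ∈ schrodingerGraph V := by
      refine ⟨u, hu, hs.congr_right ?_⟩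
      filter_upwards [hu, Lp.coeFn_add (z • φ) f, Lp.coeFn_smul z φ] with x h1 h2 h3
      rw [h2, Pi.add_apply, h3, Pi.smul_apply, smul_eq_mul, ← h1]
    rw [← schrodingerOperator_graph, LinearPMap.mem_graph_iff] at hg
    obtain ⟨y, h1, h2⟩ := hg
    simp only at h1 h2
    subst h1
    exact ⟨y.2, by rw [sub_eq_iff_eq_add']; exact h2⟩

theorem IsLineSolution.shift (h : IsLineSolution V z u φ f) (w : ℂ) :
    IsLineSolution V w u φ (f + (z - w) • φ) := by
  refine ⟨h.ae_eq, h.solves.congr_right ?_⟩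
  filter_upwards [h.ae_eq, Lp.coeFn_add f ((z - w) • φ), Lp.coeFn_smul (z - w) φ] with x h1 h2 h3
  rw [h2, Pi.add_apply, h3, Pi.smul_apply, smul_eq_mul, ← h1]
  ring

theorem volume_uIoc_lt_top (a b : ℝ) : volume (uIoc a b) < ⊤ := by
  rw [uIoc]; exact measure_Ioc_lt_top

/-- The indicator function of the interval between `0` and `x`, as an element of `L²(ℝ)`. -/
def indicatorUIoc (x : ℝ) : L2R :=
  indicatorConstLp 2 (measurableSet_uIoc (a := (0 : ℝ)) (b := x)) (volume_uIoc_lt_top 0 x).ne 1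

theorem inner_indicatorUIoc (x : ℝ) (f : L2R) :
    (inner ℂ (indicatorUIoc x) f : ℂ) = ∫ t in uIoc 0 x, f t :=
  L2.inner_indicatorConstLp_one _ _ _

theorem eq_zero_of_forall_integral_eq_zero
    (h : ∀ x : ℝ, (inner ℂ (indicatorUIoc x) f : ℂ) = 0) : f = 0 := by
  rw [Lp.eq_zero_iff_ae_eq_zero]
  have hz : ∀ x : ℝ, ∫ t in (0 : ℝ)..x, f t = 0 := fun x => by
    have := h x
    rw [inner_indicatorUIoc] at this
    rw [← norm_eq_zero, intervalIntegral.norm_integral_eq_norm_integral_uIoc, this, norm_zero]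
  filter_upwards [LocallyIntegrable.ae_hasDerivAt_integral (locallyIntegrable_coe f)] with x hx
  have h1 := hx 0
  simp only [hz] at h1
  exact h1.unique (hasDerivAt_const x 0)

/-- Only continuous dependence on [-|x|, |x|] is used, not a resolvent bound, so s may be real,
where (H - s)⁻¹ need not exist. -/
theorem exists_norm_inner_le (hV : LocallyIntegrable V volume) (s : ℂ) (x : ℝ) :
    ∃ C : ℝ, ∀ (u : ℝ → ℂ) (φ f : L2R), IsLineSolution V s u φ f → u 0 = 0 → deriv u 0 = 0 →
      ‖(inner ℂ (indicatorUIoc x) φ : ℂ)‖ ≤ C * ‖f‖ := by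
  obtain ⟨C, hC0, hC⟩ := exists_norm_solution_le hV s (abs_nonneg x)
  refine ⟨C * √(2 * |x|) * volume.real (uIoc 0 x), fun u φ f h h0 h0' => ?_⟩
  have hsub : ∀ t ∈ uIoc 0 x, t ∈ Icc (-|x|) |x| := fun t ht => by
    have h1 := abs_sub_left_of_mem_uIcc (uIoc_subset_uIcc ht)
    rw [sub_zero, sub_zero] at h1
    exact abs_le.1 h1
  have hb : ∀ t ∈ uIoc 0 x, ‖u t‖ ≤ C * √(2 * |x|) * ‖f‖ := fun t ht => by
    have h1 := (hC u f (locallyIntegrable_coe f) h.solves t (hsub t ht)).1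
    rw [h0, h0', norm_zero, add_zero, zero_add] at h1
    refine h1.trans ?_
    rw [mul_assoc]
    exact mul_le_mul_of_nonneg_left (integral_norm_le_sqrt_mul f (abs_nonneg x)) hC0
  rw [inner_indicatorUIoc, setIntegral_congr_ae (g := u) measurableSet_uIoc
    (h.ae_eq.mono fun t ht _ => ht)]
  refine (norm_setIntegral_le_of_norm_le_const (volume_uIoc_lt_top 0 x) hb).trans (le_of_eq ?_)
  ring

end SchrodingerResolvent

-- Application of the criterion to the Schrödinger operator

section KacGilbertTheorem

variable {V : ℝ → ℝ} {R : ℂ → L2R →L[ℂ] L2R}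

/-- The solution u at energy w with source f is also the solution at energy i with source (H - i)(H
- w)⁻¹f, so a boundary functional known at i is known at every nonreal w. -/
theorem inner_shiftedRepresenter (hR : IsResolventFamily (schrodingerOperator V) R) {γ : L2R}
    {ℓ : (ℝ → ℂ) → ℂ}
    (hγ : ∀ u φ f, IsLineSolution V Complex.I u φ f → (inner ℂ γ f : ℂ) = ℓ u)
    {w : ℂ} (hw : w.im ≠ 0) {u : ℝ → ℂ} {φ f : L2R} (h : IsLineSolution V w u φ f) :
    (inner ℂ (shiftedRepresenter R γ w) f : ℂ) = ℓ u := by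
  have hφ : R w f = φ := (hR.iff hw).1 (isResolventOf_iff.2 ⟨u, h⟩)
  have hw' : (conj w).im ≠ 0 := by simpa using hw
  rw [← hγ _ _ _ (h.shift Complex.I), shiftedRepresenter, inner_add_left, inner_smul_left,
    hR.inner_left hw', Complex.conj_conj, hφ, inner_add_right, inner_smul_right]
  simp [sub_eq_add_neg]

theorem hasSimpleSingularSpectrum_schrodingerOperator (hV : LocallyIntegrable V volume)
    (hTop : LimitPointAtTop V) (hBot : LimitPointAtBot V)
    (hR : IsResolventFamily (schrodingerOperator V) R) :
    HasSimpleSingularSpectrum (schrodingerOperator V) := by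
  have hI : (Complex.I).im ≠ 0 := by simp
  obtain ⟨D⟩ := nonempty_weylData hV hTop hBot hI
  have hD : D.mp + D.mm ≠ 0 := fun h => by
    have h1 := D.mp_pos
    have h2 := D.mm_pos
    have h3 := congrArg Complex.im h
    rw [Complex.add_im, Complex.zero_im] at h3
    rw [Complex.I_im, one_mul] at h1 h2
    linarith
  -- Adding the two Weyl functionals eliminates u'(0) and leaves -(m₊ + m₋)u(0). Conjugates appear
  -- because the inner product is conjugate linear in its first argument.
  set γ₁ : L2R := -(conj (D.mp + D.mm))⁻¹ • (D.A + D.B) with hγ₁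
  set γ₂ : L2R := D.A + conj D.mp • γ₁ with hγ₂
  have r₁ : ∀ u φ f, IsLineSolution V Complex.I u φ f → (inner ℂ γ₁ f : ℂ) = u 0 :=
    fun u φ f h => by
      rw [hγ₁, inner_smul_left, inner_add_left, D.inner_A u φ f h, D.inner_B u φ f h, map_neg,
        map_inv₀, Complex.conj_conj]
      field_simp
      ring
  have r₂ : ∀ u φ f, IsLineSolution V Complex.I u φ f → (inner ℂ γ₂ f : ℂ) = deriv u 0 :=
    fun u φ f h => by
      rw [hγ₂, inner_add_left, inner_smul_left, r₁ u φ f h, D.inner_A u φ f h, Complex.conj_conj]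
      ring
  refine hasSimpleSingularSpectrum_of_boundary hR (γ₁ := γ₁) (γ₂ := γ₂) (fun w hw => ?_)
    (range indicatorUIoc)
    (fun f hf => eq_zero_of_forall_integral_eq_zero fun x => hf _ ⟨x, rfl⟩) ?_
  · obtain ⟨W⟩ := nonempty_weylData hV hTop hBot hw.ne'
    refine ⟨W.mp, W.mm, W.A, W.B, pos_of_mul_pos_right W.mp_pos hw.le,
      pos_of_mul_pos_right W.mm_pos hw.le, ?_, ?_, W.orth, W.norm_A, W.norm_B⟩
    · refine ext_inner_right ℂ fun f => ?_
      obtain ⟨u, φ, h⟩ := W.exists_solution f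
      rw [W.inner_A u φ f h, inner_sub_left, inner_smul_left, Complex.conj_conj,
        inner_shiftedRepresenter hR (ℓ := fun u => u 0) r₁ hw.ne' h,
        inner_shiftedRepresenter hR (ℓ := fun u => deriv u 0) r₂ hw.ne' h]
    · refine ext_inner_right ℂ fun f => ?_
      obtain ⟨u, φ, h⟩ := W.exists_solution f
      rw [W.inner_B u φ f h, inner_sub_left, inner_neg_left, inner_smul_left, Complex.conj_conj,
        inner_shiftedRepresenter hR (ℓ := fun u => u 0) r₁ hw.ne' h,
        inner_shiftedRepresenter hR (ℓ := fun u => deriv u 0) r₂ hw.ne' h]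
  · rintro _ ⟨x, rfl⟩ s
    obtain ⟨C, hC⟩ := exists_norm_inner_le hV s x
    refine ⟨C, fun g h1 h2 => ?_⟩
    obtain ⟨u, hu⟩ := isResolventOf_iff.1 ((hR.iff hI).2 (rfl : R Complex.I g = _))
    rw [r₁ u _ g hu] at h1
    rw [r₂ u _ g hu] at h2
    exact hC u _ _ (hu.shift s) h1 h2

end KacGilbertTheorem

end KacGilbert

end

theorem theorem5p2 (V : ℝ → ℝ) (hV : MeasureTheory.LocallyIntegrable V MeasureTheory.volume)
    (hTop : KacGilbert.LimitPointAtTop V) (hBot : KacGilbert.LimitPointAtBot V) :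
    IsSelfAdjoint (KacGilbert.schrodingerOperator V) ∧
      KacGilbert.HasSimpleSingularSpectrum (KacGilbert.schrodingerOperator V) := by
  have hs : ∀ z : ℂ, z.im ≠ 0 → ∀ ψ, ∃ φ,
      KacGilbert.IsResolventOf (KacGilbert.schrodingerOperator V) z ψ φ := fun z hz ψ => by
    obtain ⟨D⟩ := KacGilbert.nonempty_weylData hV hTop hBot hz
    obtain ⟨u, φ, h⟩ := D.exists_solution ψ
    exact ⟨φ, KacGilbert.isResolventOf_iff.2 ⟨u, h⟩⟩
  have hb : ∀ z : ℂ, z.im ≠ 0 → ∀ ψ φ,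
      KacGilbert.IsResolventOf (KacGilbert.schrodingerOperator V) z ψ φ →
        |z.im| * ‖φ‖ ≤ ‖ψ‖ := fun z hz ψ φ h => by
    obtain ⟨D⟩ := KacGilbert.nonempty_weylData hV hTop hBot hz
    obtain ⟨u, hu⟩ := KacGilbert.isResolventOf_iff.1 h
    exact D.norm_le u φ ψ hu
  obtain ⟨R, hR⟩ := KacGilbert.exists_isResolventFamily hs hb
  exact ⟨KacGilbert.isSelfAdjoint_of_resolvent hs hb,
    KacGilbert.hasSimpleSingularSpectrum_schrodingerOperator hV hTop hBot hR⟩
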